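/- Let $T_n(z)=e^{-z}\sum_{k\ge 0}k^n z^k/k!$ be the Touchard polynomials, let $x>0$ and $\mu=n/x$. For a root $t_0$ of $te^t=-\mu$ put $\psi(t)=-e^t/\mu-\log t$ and $a_r=\psi^{(r+2)}(t_0)/(r+2)!$ for $r\ge 0$, let $B_{k,0}=\delta_{k,0}$, $B_{k,j}=\sum_{r=1}^{k-j+1}a_rB_{k-r,j-1}$ be the partial ordinary Bell polynomials in $a_1,a_2,\dots$, and let $$c_{2s}(t_0)=\frac{(-1)^s}{a_0^s}\sum_{j=0}^{2s}\frac{(-1)^j(s+\frac12)_j}{j!\,a_0^j}B_{2s,j},\qquad A(t_0)=\frac{\Gamma(n)\,e^{x+n/t_0}}{\sqrt{2\pi(1+t_0)}\;t_0^{\,n-1}},\qquad J_N(t_0)=A(t_0)\sum_{s=0}^{N-1}\frac{c_{2s}(t_0)\,\Gamma(s+\frac12)}{n^{s+1/2}\,\Gamma(\frac12)},$$ with the principal square root. **Case $\mu>1/e$.** The roots of $te^t=-\mu$ of smallest modulus form exactly one pair of non-real complex conjugates; let $t_0$ be either of them. For all $N\ge 0$, $a>0$, $\delta>0$, as $n\to\infty$,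 $$T_{n-1}(-x)=2\,\mathrm{Re}\,J_N(t_0)+O\!\left(\frac{|A(t_0)|}{\sqrt n}\Big(\frac{|t_0|}{n}\Big)^{N}\right)$$ uniformly in all $x\ge a$ with $n/x\ge 1/e+\delta$ (in particular for $x$ fixed, when $|t_0|$ grows like $\log n$, and for $x$ a fixed multiple of $n$). This is the dominant contribution: for all $a,\delta>0$ there are $C$ and $c>0$ such that, for all large $n$ and the same $x$, every root $t\ne t_0,\overline{t_0}$ of $te^t=-\mu$ satisfies $|A(t)|\le C\,e^{-cn/|t_0|^2}\,|A(t_0)|$. **Case $0<\mu<1/e$.** The equation $te^t=-\mu$ has exactly two real roots $t_1<-1<t_0<0$; $t_0$ is the one of smaller absolute value. For all $N\ge 0$, $B>0$, $\delta>0$, as $n\to\infty$, $$T_{n-1}(-x)=J_N(t_0)+O\!\left(\frac{|A(t_0)|}{\sqrt n}\,n^{-N}\right)$$ uniformly in all $0<x\le Bn$ with $n/x\le 1/e-\delta$. -/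

import Mathlib

open scoped Nat

noncomputable section

/-- The Touchard (exponential) polynomial `T_n(z) = e^{-z} ∑_{k ≥ 0} k^n z^k / k!`
(with `0 ^ 0 = 1`). -/
def touchard (n : ℕ) (z : ℂ) : ℂ :=
  Complex.exp (-z) * ∑' k : ℕ, (k : ℂ) ^ n * z ^ k / (k ! : ℂ)

/-- `t` is a (complex) root of `t e^t = -μ`. -/
def IsSaddle (μ : ℝ) (t : ℂ) : Prop :=
  t * Complex.exp t = -(μ : ℂ)

/-- `t` is a root of smallest modulus among all complex roots of `t e^t = -μ`. -/
def IsSmallestSaddle (μ : ℝ) (t : ℂ) : Prop :=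
  IsSaddle μ t ∧ ∀ w : ℂ, IsSaddle μ w → ‖t‖ ≤ ‖w‖

/-- `t` is a real root of `t e^t = -μ`, the smallest in absolute value among the real roots. -/
def IsSmallestRealSaddle (μ t : ℝ) : Prop :=
  t * Real.exp t = -μ ∧ ∀ w : ℝ, w * Real.exp w = -μ → |t| ≤ |w|

/-- The derivative `ψ'(t) = -e^t / μ - 1 / t` of the phase function `ψ(t) = -e^t / μ - log t`.
It does not depend on the branch of the logarithm, and it is analytic at the negative real
saddles too, where the principal branch of `log` is discontinuous. -/
def phaseDeriv (μ : ℝ) (t : ℂ) : ℂ :=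
  -Complex.exp t / (μ : ℂ) - 1 / t

/-- The coefficients `a_r = ψ^{(r+2)}(t₀) / (r+2)!` of the Taylor expansion
`ψ(t) - ψ(t₀) = ∑_r a_r (t - t₀)^{r+2}` at a saddle `t₀`. -/
def phaseCoeff (μ : ℝ) (t₀ : ℂ) (r : ℕ) : ℂ :=
  iteratedDeriv (r + 1) (phaseDeriv μ) t₀ / ((r + 2)! : ℂ)

/-- The partial ordinary Bell polynomials `B_{k,j}(a_1, a_2, …)`:
`B_{k,0} = δ_{k,0}` and `B_{k,j} = ∑_{r=1}^{k-j+1} a_r B_{k-r,j-1}`. -/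
def ordBell (a : ℕ → ℂ) : ℕ → ℕ → ℂ
  | k, 0 => if k = 0 then 1 else 0
  | k, j + 1 => ∑ r ∈ Finset.Icc 1 (k - j), a r * ordBell a (k - r) j

/-- The steepest descent coefficient
`c_{2s}(t₀) = ((-1)^s / a_0^s) ∑_{j=0}^{2s} (-1)^j (s + 1/2)_j / (j! a_0^j) B_{2s,j}`. -/
def saddleCoeff (μ : ℝ) (t₀ : ℂ) (s : ℕ) : ℂ :=
  (-1) ^ s / phaseCoeff μ t₀ 0 ^ s *
    ∑ j ∈ Finset.range (2 * s + 1),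
      (-1) ^ j * (ascPochhammer ℂ j).eval ((s : ℂ) + 1 / 2) /
        ((j ! : ℂ) * phaseCoeff μ t₀ 0 ^ j) * ordBell (phaseCoeff μ t₀) (2 * s) j

/-- The factor `Γ(n) e^{x + n/t₀} / (√(2π(1 + t₀)) t₀^{n-1})` (principal square root) in front
of the series at the saddle `t₀`. -/
def saddleFactor (n : ℕ) (x : ℝ) (t₀ : ℂ) : ℂ :=
  (Real.Gamma n : ℂ) * Complex.exp ((x : ℂ) + (n : ℂ) / t₀) /
    ((2 * (Real.pi : ℂ) * (1 + t₀)) ^ (1 / 2 : ℂ) * t₀ ^ (n - 1))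

/-- The first `N` terms of the series at the saddle `t₀` for `T_{n-1}(-x)`, with `μ = n / x`. -/
def saddleSeries (N n : ℕ) (x : ℝ) (t₀ : ℂ) : ℂ :=
  saddleFactor n x t₀ *
    ∑ s ∈ Finset.range N,
      saddleCoeff ((n : ℝ) / x) t₀ s * (Real.Gamma ((s : ℝ) + 1 / 2) : ℂ) /
        ((((n : ℝ) ^ ((s : ℝ) + 1 / 2) : ℝ) : ℂ) * (Real.Gamma (1 / 2) : ℂ))

end

noncomputable section

/-! Cauchy's formula on the circle `|t| = |t₀|` writes `T_{n-1}(-x)` as `e^x Γ(n)/(2π)` times the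
integral of `exp(-x e^t) t^{-(n-1)}` over the angle. Put `t = t₀ e^{iθ}`. The saddle equation in the
form `-x e^{t₀} = n/t₀` then extracts the prefactor `contourFactor` and leaves `arcIntegrand`, which
is `1` at `θ = 0` (`touchard_eq_arcIntegral`).

Near the saddle, put `y = σ(e^{iθ} - 1)` with `σ ≥ max(1, |t₀|)`. The exponent becomes `(n/σ) y² ∑
β_r y^r`, where all `|β_r| ≤ 1` and `β_0 = (1 + t₀)/(2σ)`. This normalization gives uniformity:
every constant depends only on a lower bound `c` for `Re β_0`, and the large parameter is `λ = n/σ`.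
The integrand has a primitive in the unit disc, so the arc can be replaced by the segment from `-ir`
to `ir` at an exponentially small cost (`norm_arcIntegral_sub_le`). On the segment, `exp` of the
non-quadratic part is expanded in powers of `y`, with Bell polynomials as coefficients. The
truncation error is absorbed by the Gaussian, and the Gaussian moments give the terms
(`norm_localIntegral_sub_le`). Homogeneity of the Bell polynomials turns these terms into those of
`saddleSeries` (`saddleSeries_eq`). `saddle_expansion` combines all this, given that the integrand
is at most `e^{-k√n}` away from the saddle.

That decay is proved separately in the two cases. For a real saddle it is an elementary inequality
on the whole circle (`norm_arcIntegrand_real_le`). For a complex saddle, symmetry reduces to the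
upper half circle and produces `2 Re` (`touchard_eq_two_re`). There `Re(-e^t)` has angular
derivative of the sign of `sin(θ + ρ sin θ)`, and the saddle angle `θ₀` satisfies `θ₀ + ρ sin θ₀ =
π`. So the modulus rises up to the saddle and then falls, except possibly where it is already small
(`circlePhase_large_angle`). The exponents are at least of order `n/|t₀|³`, which is at least `√n`
because `|t₀| ≤ 2 + log μ`.

The roots are located through the polar form `|t| = b / sin b`, `Re t = -b cot b` with `b = Im t`:
there is one root with `0 < b < π`, and every other root in the upper half plane has `b > 2π`.
Dominance compares the moduli of the prefactors via `e^{Re t - Re w} = |w|/|t|` (`IsSaddle.re_gap`).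
-/

/-! ### Partial ordinary Bell polynomials -/

theorem ordBell_eq_zero_of_lt (a : ℕ → ℂ) {j k : ℕ} (h : k < j) : ordBell a k j = 0 := by
  cases j with
  | zero => omega
  | succ j =>
    have : k - j = 0 := by omega
    simp [ordBell, this]

/-- The added terms vanish. In this shape the recursion is a Cauchy product, so `B_{·,j}` are the
coefficients of a `j`-th power. -/
theorem ordBell_succ_eq_sum_antidiagonal (a : ℕ → ℂ) (k j : ℕ) :
    ordBell a k (j + 1) =
      ∑ p ∈ Finset.HasAntidiagonal.antidiagonal k, (if p.1 = 0 then 0 else a p.1) * ordBell a p.2 j := by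
  rw [Finset.Nat.sum_antidiagonal_eq_sum_range_succ_mk, ordBell]
  rw [← Finset.sum_subset (s₁ := Finset.Icc 1 (k - j)) (s₂ := Finset.range k.succ)]
  · refine Finset.sum_congr rfl fun r hr => ?_
    rw [Finset.mem_Icc] at hr
    rw [if_neg (by simp; omega)]
  · intro r hr
    rw [Finset.mem_Icc] at hr
    rw [Finset.mem_range]
    omega
  · intro r hr hr'
    rw [Finset.mem_Icc] at hr'
    rw [Finset.mem_range] at hr
    by_cases h0 : r = 0
    · simp [h0]
    · rw [ordBell_eq_zero_of_lt a (by simp only; omega), mul_zero]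

/-- Each monomial of `B_{k,j}` has `j` factors whose indices sum to `k`. This makes the final
coefficients independent of the rescaling at the saddle. -/
theorem ordBell_scale (a : ℕ → ℂ) (c d : ℂ) (k j : ℕ) :
    ordBell (fun r => c * d ^ r * a r) k j = c ^ j * d ^ k * ordBell a k j := by
  induction j generalizing k with
  | zero =>
    by_cases hk : k = 0 <;> simp [ordBell, hk]
  | succ j ih =>
    rw [ordBell_succ_eq_sum_antidiagonal, ordBell_succ_eq_sum_antidiagonal, Finset.mul_sum]
    refine Finset.sum_congr rfl fun p hp => ?_
    rw [Finset.HasAntidiagonal.mem_antidiagonal] at hp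
    rw [ih, ← hp]
    split_ifs
    · simp
    · ring

/-! ### Truncating the exponential of a power series -/

section Tails

variable {β : ℕ → ℂ}

/-- The power series `∑_{r ≥ 1} β_r y^r`. -/
def tailSeries (β : ℕ → ℂ) (y : ℂ) : ℂ :=
  ∑' r : ℕ, (if r = 0 then 0 else β r) * y ^ r

theorem hasSum_geometric_shift {s : ℝ} (h0 : 0 ≤ s) (h1 : s < 1) :
    HasSum (fun r : ℕ => if r = 0 then 0 else s ^ r) (s / (1 - s)) := by
  have h := (hasSum_geometric_of_lt_one h0 h1).mul_left s
  rw [← hasSum_nat_add_iff' 1]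
  simp only [Finset.range_one, Finset.sum_singleton, if_true, sub_zero, Nat.add_eq_zero_iff,
    one_ne_zero, and_false, if_false]
  rw [div_eq_mul_inv]
  simpa only [pow_succ'] using h

theorem norm_tailSeries_term_le (hβ : ∀ r, ‖β r‖ ≤ 1) (y : ℂ) (r : ℕ) :
    ‖(if r = 0 then 0 else β r) * y ^ r‖ ≤ if r = 0 then 0 else ‖y‖ ^ r := by
  split_ifs
  · simp
  · rw [norm_mul, norm_pow]
    exact mul_le_of_le_one_left (by positivity) (hβ r)

theorem summable_norm_tailSeries (hβ : ∀ r, ‖β r‖ ≤ 1) {y : ℂ} (hy : ‖y‖ < 1) :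
    Summable fun r : ℕ => ‖(if r = 0 then 0 else β r) * y ^ r‖ :=
  Summable.of_nonneg_of_le (fun _ => norm_nonneg _) (norm_tailSeries_term_le hβ y)
    (hasSum_geometric_shift (norm_nonneg y) hy).summable

theorem tsum_norm_tailSeries_le (hβ : ∀ r, ‖β r‖ ≤ 1) {y : ℂ} (hy : ‖y‖ < 1) :
    ∑' r : ℕ, ‖(if r = 0 then 0 else β r) * y ^ r‖ ≤ ‖y‖ / (1 - ‖y‖) := by
  rw [← (hasSum_geometric_shift (norm_nonneg y) hy).tsum_eq]
  exact (summable_norm_tailSeries hβ hy).tsum_le_tsum (norm_tailSeries_term_le hβ y)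
    (hasSum_geometric_shift (norm_nonneg y) hy).summable

theorem norm_tailSeries_le (hβ : ∀ r, ‖β r‖ ≤ 1) {y : ℂ} (hy : ‖y‖ ≤ 1 / 2) :
    ‖tailSeries β y‖ ≤ 2 * ‖y‖ := by
  have h1 : ‖y‖ < 1 := by linarith
  refine (norm_tsum_le_tsum_norm (summable_norm_tailSeries hβ h1)).trans ?_
  refine (tsum_norm_tailSeries_le hβ h1).trans ?_
  rw [div_le_iff₀ (by linarith)]
  nlinarith [norm_nonneg y]

theorem ordBell_succ_mul_pow (k j : ℕ) (y : ℂ) :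
    ordBell β k (j + 1) * y ^ k = ∑ p ∈ Finset.HasAntidiagonal.antidiagonal k,
      ((if p.1 = 0 then 0 else β p.1) * y ^ p.1) * (ordBell β p.2 j * y ^ p.2) := by
  rw [ordBell_succ_eq_sum_antidiagonal, Finset.sum_mul]
  refine Finset.sum_congr rfl fun p hp => ?_
  rw [Finset.HasAntidiagonal.mem_antidiagonal] at hp
  rw [← hp]
  ring

/-- Induction on `j` by Cauchy products. Absolute summability and the bound `(2‖y‖)^j` go through
the same induction because the next product needs them. -/
theorem summable_norm_ordBell (hβ : ∀ r, ‖β r‖ ≤ 1) {y : ℂ} (hy : ‖y‖ ≤ 1 / 2) (j : ℕ) :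
    (Summable fun k : ℕ => ‖ordBell β k j * y ^ k‖) ∧
      (∑' k : ℕ, ‖ordBell β k j * y ^ k‖) ≤ (2 * ‖y‖) ^ j ∧
      (∑' k : ℕ, ordBell β k j * y ^ k) = tailSeries β y ^ j := by
  have h1 : ‖y‖ < 1 := by linarith
  have hT := summable_norm_tailSeries hβ h1
  have hT' : (∑' r : ℕ, ‖(if r = 0 then 0 else β r) * y ^ r‖) ≤ 2 * ‖y‖ := by
    refine (tsum_norm_tailSeries_le hβ h1).trans ?_
    rw [div_le_iff₀ (by linarith)]
    nlinarith [norm_nonneg y]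
  induction j with
  | zero =>
    have h0 : ∀ k ∉ ({0} : Finset ℕ), ordBell β k 0 * y ^ k = 0 := by
      intro k hk
      rw [Finset.mem_singleton] at hk
      simp [ordBell, hk]
    have h2 : HasSum (fun k : ℕ => ordBell β k 0 * y ^ k) 1 := by
      have := hasSum_sum_of_ne_finset_zero (L := .unconditional ℕ) h0
      simpa [ordBell] using this
    have h3 : HasSum (fun k : ℕ => ‖ordBell β k 0 * y ^ k‖) 1 := by
      have := hasSum_sum_of_ne_finset_zero (L := .unconditional ℕ) (f := fun k : ℕ => ‖ordBell β k 0 * y ^ k‖)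
        (s := {0}) (fun k hk => by rw [h0 k hk, norm_zero])
      simpa [ordBell] using this
    exact ⟨h3.summable, by rw [h3.tsum_eq]; simp, by rw [h2.tsum_eq]; simp⟩
  | succ j ih =>
    obtain ⟨ih1, ih2, ih3⟩ := ih
    have hfun : (fun k : ℕ => ordBell β k (j + 1) * y ^ k) = fun k =>
        ∑ p ∈ Finset.HasAntidiagonal.antidiagonal k,
          ((if p.1 = 0 then 0 else β p.1) * y ^ p.1) * (ordBell β p.2 j * y ^ p.2) := by
      funext k
      exact ordBell_succ_mul_pow k j y
    have hs := summable_norm_sum_mul_antidiagonal_of_summable_norm hT ih1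
    have hle : ∀ k : ℕ, ‖ordBell β k (j + 1) * y ^ k‖ ≤ ∑ p ∈ Finset.HasAntidiagonal.antidiagonal k,
        ‖(if p.1 = 0 then 0 else β p.1) * y ^ p.1‖ * ‖ordBell β p.2 j * y ^ p.2‖ := by
      intro k
      rw [ordBell_succ_mul_pow]
      refine (norm_sum_le _ _).trans (Finset.sum_le_sum fun p _ => ?_)
      rw [norm_mul]
    have hprod := tsum_mul_tsum_eq_tsum_sum_antidiagonal_of_summable_norm
      (f := fun r : ℕ => ‖(if r = 0 then 0 else β r) * y ^ r‖)
      (g := fun k : ℕ => ‖ordBell β k j * y ^ k‖) (by simpa using hT) (by simpa using ih1)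
    have hsum' := summable_norm_sum_mul_antidiagonal_of_summable_norm
      (f := fun r : ℕ => ‖(if r = 0 then 0 else β r) * y ^ r‖)
      (g := fun k : ℕ => ‖ordBell β k j * y ^ k‖) (by simpa using hT) (by simpa using ih1)
    have hsum := hsum'.of_norm
    have hsummable : Summable fun k : ℕ => ‖ordBell β k (j + 1) * y ^ k‖ :=
      Summable.of_nonneg_of_le (fun _ => norm_nonneg _) hle hsum
    refine ⟨hsummable, ?_, ?_⟩
    · refine (hsummable.tsum_le_tsum hle hsum).trans ?_
      rw [← hprod, pow_succ']
      exact mul_le_mul hT' ih2 (tsum_nonneg fun _ => norm_nonneg _) (by positivity)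
    · rw [hfun, ← tsum_mul_tsum_eq_tsum_sum_antidiagonal_of_summable_norm hT ih1, ih3, pow_succ']
      rfl

/-- If `∑ ‖f_k‖ r^k ≤ S`, the part of order `≥ K` of `∑ f_k y^k` is at most `(‖y‖/r)^K S`. -/
theorem norm_tsum_sub_sum_range_le {f : ℕ → ℂ} {r S : ℝ} (hr : 0 < r)
    (hf : Summable fun k => ‖f k‖ * r ^ k) (hS : ∑' k, ‖f k‖ * r ^ k ≤ S) (K : ℕ) {y : ℂ}
    (hy : ‖y‖ ≤ r) :
    ‖(∑' k, f k * y ^ k) - ∑ k ∈ Finset.range K, f k * y ^ k‖ ≤ (‖y‖ / r) ^ K * S := by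
  have hle : ∀ k, ‖f k * y ^ k‖ ≤ ‖f k‖ * r ^ k := by
    intro k
    rw [norm_mul, norm_pow]
    gcongr
  have hs : Summable fun k => f k * y ^ k := (Summable.of_nonneg_of_le
    (fun _ => norm_nonneg _) hle hf).of_norm
  rw [← hs.sum_add_tsum_nat_add K, add_sub_cancel_left]
  have hf' := (summable_nat_add_iff K).2 hf
  have hq : ‖y‖ / r ≤ 1 := (div_le_one hr).2 hy
  have hb : ∀ k, ‖f (k + K) * y ^ (k + K)‖ ≤ (‖y‖ / r) ^ K * (‖f (k + K)‖ * r ^ (k + K)) := by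
    intro k
    have h : ‖y‖ ^ (k + K) ≤ (‖y‖ / r) ^ K * r ^ (k + K) := by
      have h1 : ‖y‖ ^ (k + K) = (‖y‖ / r) ^ (k + K) * r ^ (k + K) := by
        rw [← mul_pow, div_mul_cancel₀ _ hr.ne']
      rw [h1]
      exact mul_le_mul_of_nonneg_right
        (pow_le_pow_of_le_one (by positivity) hq (by omega)) (by positivity)
    rw [norm_mul, norm_pow]
    calc ‖f (k + K)‖ * ‖y‖ ^ (k + K) ≤ ‖f (k + K)‖ * ((‖y‖ / r) ^ K * r ^ (k + K)) := by gcongr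
      _ = _ := by ring
  refine (tsum_of_norm_bounded (hf'.mul_left _).hasSum hb).trans ?_
  rw [tsum_mul_left]
  refine mul_le_mul_of_nonneg_left (le_trans ?_ hS) (by positivity)
  rw [← hf.sum_add_tsum_nat_add K]
  exact le_add_of_nonneg_left (Finset.sum_nonneg fun _ _ => by positivity)

/-- Beyond radius `r` the partial sum itself obeys the bound that the remainder obeys inside, since
`‖y‖/r ≥ 1` there. -/
theorem norm_sum_range_le_of_le_norm {f : ℕ → ℂ} {r S : ℝ} (hr : 0 < r)
    (hf : Summable fun k => ‖f k‖ * r ^ k) (hS : ∑' k, ‖f k‖ * r ^ k ≤ S) (K : ℕ) {y : ℂ}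
    (hy : r ≤ ‖y‖) :
    ‖∑ k ∈ Finset.range K, f k * y ^ k‖ ≤ (‖y‖ / r) ^ K * S := by
  have hq : 1 ≤ ‖y‖ / r := (one_le_div hr).2 hy
  have hsum : ∑ k ∈ Finset.range K, ‖f k‖ * r ^ k ≤ S :=
    (hf.sum_le_tsum _ fun _ _ => by positivity).trans hS
  refine (norm_sum_le _ _).trans ?_
  refine le_trans ?_ (mul_le_mul_of_nonneg_left hsum (by positivity))
  rw [Finset.mul_sum]
  refine Finset.sum_le_sum fun k hk => ?_
  rw [Finset.mem_range] at hk
  have h : ‖y‖ ^ k ≤ (‖y‖ / r) ^ K * r ^ k := by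
    have h1 : ‖y‖ ^ k = (‖y‖ / r) ^ k * r ^ k := by
      rw [← mul_pow, div_mul_cancel₀ _ hr.ne']
    rw [h1]
    exact mul_le_mul_of_nonneg_right (pow_le_pow_right₀ hq hk.le) (by positivity)
  rw [norm_mul, norm_pow]
  calc ‖f k‖ * ‖y‖ ^ k ≤ ‖f k‖ * ((‖y‖ / r) ^ K * r ^ k) := by gcongr
    _ = _ := by ring

/-- The coefficient of `y^k` in `exp (τ ∑_{r ≥ 1} β_r y^r)`. -/
def expBell (β : ℕ → ℂ) (k : ℕ) (τ : ℂ) : ℂ :=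
  ∑ j ∈ Finset.range (k + 1), τ ^ j / (j ! : ℂ) * ordBell β k j

theorem hasSum_expBell (k : ℕ) (τ : ℂ) :
    HasSum (fun j : ℕ => τ ^ j / (j ! : ℂ) * ordBell β k j) (expBell β k τ) := by
  refine hasSum_sum_of_ne_finset_zero fun j hj => ?_
  rw [Finset.mem_range] at hj
  rw [ordBell_eq_zero_of_lt β (by omega), mul_zero]

theorem summable_norm_ordBell_mul_pow (hβ : ∀ r, ‖β r‖ ≤ 1) {r : ℝ} (hr : 0 < r)
    (hr' : r ≤ 1 / 2) (j : ℕ) :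
    (Summable fun k : ℕ => ‖ordBell β k j‖ * r ^ k) ∧
      ∑' k : ℕ, ‖ordBell β k j‖ * r ^ k ≤ (2 * r) ^ j := by
  have hn : ‖(r : ℂ)‖ = r := by rw [Complex.norm_real, Real.norm_of_nonneg hr.le]
  have h := summable_norm_ordBell hβ (y := (r : ℂ)) (by rw [hn]; exact hr') j
  simp only [norm_mul, norm_pow, hn] at h
  exact ⟨h.1, h.2.1⟩

theorem hasSum_exp_series (z : ℂ) : HasSum (fun j : ℕ => z ^ j / (j ! : ℂ)) (Complex.exp z) := by
  rw [Complex.exp_eq_exp_ℂ]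
  exact NormedSpace.expSeries_div_hasSum_exp z

theorem hasSum_exp_series_real (z : ℝ) : HasSum (fun j : ℕ => z ^ j / (j ! : ℝ)) (Real.exp z) := by
  rw [Real.exp_eq_exp_ℝ]
  exact NormedSpace.expSeries_div_hasSum_exp z

/-- Expand the exponential first: truncating the `j`-th power in `y` costs `(‖y‖/r)^K (2r)^j`, and
summing against `‖τ‖^j/j!` gives the exponential. -/
theorem norm_exp_tailSeries_sub_le (hβ : ∀ r, ‖β r‖ ≤ 1) {r : ℝ} (hr : 0 < r)
    (hr' : r ≤ 1 / 2) (K : ℕ) (τ : ℂ) {y : ℂ} (hy : ‖y‖ ≤ r) :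
    ‖Complex.exp (τ * tailSeries β y) - ∑ k ∈ Finset.range K, expBell β k τ * y ^ k‖ ≤
      (‖y‖ / r) ^ K * Real.exp (2 * r * ‖τ‖) := by
  have h1 : HasSum (fun j : ℕ => ∑ k ∈ Finset.range K,
      τ ^ j / (j ! : ℂ) * ordBell β k j * y ^ k) (∑ k ∈ Finset.range K, expBell β k τ * y ^ k) :=
    hasSum_sum fun k _ => (hasSum_expBell k τ).mul_right _
  have h2 := (hasSum_exp_series (τ * tailSeries β y)).sub h1
  have h3 := (hasSum_exp_series_real (2 * r * ‖τ‖)).mul_left ((‖y‖ / r) ^ K)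
  rw [← h2.tsum_eq]
  refine tsum_of_norm_bounded h3 fun j => ?_
  obtain ⟨hs, hS⟩ := summable_norm_ordBell_mul_pow hβ hr hr' j
  have h4 := norm_tsum_sub_sum_range_le hr hs hS K hy
  rw [(summable_norm_ordBell hβ (hy.trans hr') j).2.2] at h4
  have h5 : (τ * tailSeries β y) ^ j / (j ! : ℂ) - ∑ k ∈ Finset.range K,
      τ ^ j / (j ! : ℂ) * ordBell β k j * y ^ k = τ ^ j / (j ! : ℂ) *
        (tailSeries β y ^ j - ∑ k ∈ Finset.range K, ordBell β k j * y ^ k) := by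
    rw [mul_sub, Finset.mul_sum, mul_pow]
    congr 1
    · ring
    · exact Finset.sum_congr rfl fun _ _ => by ring
  rw [h5, norm_mul, norm_div, norm_pow, Complex.norm_natCast]
  calc ‖τ‖ ^ j / (j ! : ℝ) * _ ≤ ‖τ‖ ^ j / (j ! : ℝ) * ((‖y‖ / r) ^ K * (2 * r) ^ j) := by gcongr
    _ = _ := by rw [mul_pow]; ring

/-- With this the Gaussian integrals can run over the whole line, with no separate estimate for `|v|
> r`. -/
theorem norm_sum_expBell_le (hβ : ∀ r, ‖β r‖ ≤ 1) {r : ℝ} (hr : 0 < r)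
    (hr' : r ≤ 1 / 2) (K : ℕ) (τ : ℂ) {y : ℂ} (hy : r ≤ ‖y‖) :
    ‖∑ k ∈ Finset.range K, expBell β k τ * y ^ k‖ ≤
      (‖y‖ / r) ^ K * Real.exp (2 * r * ‖τ‖) := by
  have h1 : HasSum (fun j : ℕ => ∑ k ∈ Finset.range K,
      τ ^ j / (j ! : ℂ) * ordBell β k j * y ^ k) (∑ k ∈ Finset.range K, expBell β k τ * y ^ k) :=
    hasSum_sum fun k _ => (hasSum_expBell k τ).mul_right _
  have h3 := (hasSum_exp_series_real (2 * r * ‖τ‖)).mul_left ((‖y‖ / r) ^ K)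
  rw [← h1.tsum_eq]
  refine tsum_of_norm_bounded h3 fun j => ?_
  obtain ⟨hs, hS⟩ := summable_norm_ordBell_mul_pow hβ hr hr' j
  have h4 := norm_sum_range_le_of_le_norm hr hs hS K hy
  have h5 : ∑ k ∈ Finset.range K, τ ^ j / (j ! : ℂ) * ordBell β k j * y ^ k =
      τ ^ j / (j ! : ℂ) * ∑ k ∈ Finset.range K, ordBell β k j * y ^ k := by
    rw [Finset.mul_sum]
    exact Finset.sum_congr rfl fun _ _ => by ring
  rw [h5, norm_mul, norm_div, norm_pow, Complex.norm_natCast]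
  calc ‖τ‖ ^ j / (j ! : ℝ) * _ ≤ ‖τ‖ ^ j / (j ! : ℝ) * ((‖y‖ / r) ^ K * (2 * r) ^ j) := by gcongr
    _ = _ := by rw [mul_pow]; ring

end Tails

/-! ### Principal square roots -/

theorem ofReal_mul_cpow_half {r : ℝ} (hr : 0 < r) {z : ℂ} (hz : z ≠ 0) :
    ((r : ℂ) * z) ^ (1 / 2 : ℂ) = (√r : ℂ) * z ^ (1 / 2 : ℂ) := by
  have hr' : (r : ℂ) ≠ 0 := by exact_mod_cast hr.ne'
  rw [Complex.cpow_def_of_ne_zero (mul_ne_zero hr' hz), Complex.log_ofReal_mul hr hz, add_mul,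
    Complex.exp_add, ← Complex.cpow_def_of_ne_zero hz, Real.sqrt_eq_rpow,
    Complex.ofReal_cpow hr.le, Complex.cpow_def_of_ne_zero hr', Complex.ofReal_log hr.le]
  norm_num

theorem inv_cpow_half {z : ℂ} (hz : 0 < z.re) : z⁻¹ ^ (1 / 2 : ℂ) = (z ^ (1 / 2 : ℂ))⁻¹ := by
  refine Complex.inv_cpow z _ fun h => ?_
  rw [Complex.arg_eq_pi_iff] at h
  linarith [h.1]

theorem ne_zero_of_re_pos {z : ℂ} (hz : 0 < z.re) : z ≠ 0 := by
  rintro rfl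
  simp at hz

/-! ### Gaussian moments with a complex parameter -/

section Gaussian

open MeasureTheory

theorem integrable_pow_mul_exp_neg_mul_sq {b : ℝ} (hb : 0 < b) (m : ℕ) :
    Integrable fun v : ℝ => v ^ m * Real.exp (-b * v ^ 2) := by
  have h := integrable_rpow_mul_exp_neg_mul_sq hb (s := (m : ℝ)) (by
    have : (0 : ℝ) ≤ m := Nat.cast_nonneg m
    linarith)
  simpa only [Real.rpow_natCast] using h

theorem integrable_pow_mul_cexp_neg_mul_sq {b : ℂ} (hb : 0 < b.re) (m : ℕ) :
    Integrable fun v : ℝ => (v : ℂ) ^ m * Complex.exp (-b * (v : ℂ) ^ 2) := by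
  refine (integrable_norm_iff ?_).1 ?_
  · exact (by fun_prop : Continuous fun v : ℝ =>
      (v : ℂ) ^ m * Complex.exp (-b * (v : ℂ) ^ 2)).aestronglyMeasurable
  · refine (integrable_pow_mul_exp_neg_mul_sq hb m).norm.congr (ae_of_all _ fun v => ?_)
    simp only [norm_mul, norm_pow, norm_cexp_neg_mul_sq, Complex.norm_real, Real.norm_eq_abs,
      Real.abs_exp]

/-- Integration by parts: the derivative of `v^{2m+1} e^{-bv²}` has integral zero. -/
theorem integral_pow_mul_cexp_succ {b : ℂ} (hb : 0 < b.re) (m : ℕ) :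
    ∫ v : ℝ, (v : ℂ) ^ (2 * (m + 1)) * Complex.exp (-b * (v : ℂ) ^ 2) =
      (m + 1 / 2) / b * ∫ v : ℝ, (v : ℂ) ^ (2 * m) * Complex.exp (-b * (v : ℂ) ^ 2) := by
  have hb0 := ne_zero_of_re_pos hb
  have hi1 := (integrable_pow_mul_cexp_neg_mul_sq hb (2 * m)).const_mul (2 * m + 1 : ℂ)
  have hi2 := (integrable_pow_mul_cexp_neg_mul_sq hb (2 * (m + 1))).const_mul (2 * b)
  have hd : ∀ v : ℝ, HasDerivAt
      (fun v : ℝ => (v : ℂ) ^ (2 * m + 1) * Complex.exp (-b * (v : ℂ) ^ 2))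
      ((2 * m + 1 : ℂ) * ((v : ℂ) ^ (2 * m) * Complex.exp (-b * (v : ℂ) ^ 2)) -
        2 * b * ((v : ℂ) ^ (2 * (m + 1)) * Complex.exp (-b * (v : ℂ) ^ 2))) v := by
    intro v
    have h1 : HasDerivAt (fun z : ℂ => z ^ (2 * m + 1) * Complex.exp (-b * z ^ 2)) _ (v : ℂ) :=
      (hasDerivAt_pow (2 * m + 1) (v : ℂ)).mul (((hasDerivAt_pow 2 (v : ℂ)).const_mul (-b)).cexp)
    convert h1.comp_ofReal using 1
    push_cast
    ring
  have h0 := integral_eq_zero_of_hasDerivAt_of_integrable hd (hi1.sub hi2)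
    (integrable_pow_mul_cexp_neg_mul_sq hb (2 * m + 1))
  rw [integral_sub hi1 hi2, integral_const_mul, integral_const_mul, sub_eq_zero] at h0
  generalize ∫ v : ℝ, (v : ℂ) ^ (2 * (m + 1)) * Complex.exp (-b * (v : ℂ) ^ 2) = p at h0 ⊢
  generalize ∫ v : ℝ, (v : ℂ) ^ (2 * m) * Complex.exp (-b * (v : ℂ) ^ 2) = q at h0 ⊢
  field_simp
  linear_combination -h0

theorem integral_even_pow_mul_cexp {b : ℂ} (hb : 0 < b.re) (m : ℕ) :
    ∫ v : ℝ, (v : ℂ) ^ (2 * m) * Complex.exp (-b * (v : ℂ) ^ 2) =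
      (Real.Gamma (m + 1 / 2) : ℂ) / (b ^ m * b ^ (1 / 2 : ℂ)) := by
  have hb0 := ne_zero_of_re_pos hb
  induction m with
  | zero =>
    simp only [mul_zero, pow_zero, one_mul]
    rw [integral_gaussian_complex hb, div_eq_mul_inv, ofReal_mul_cpow_half Real.pi_pos
      (inv_ne_zero hb0), inv_cpow_half hb]
    rw [Nat.cast_zero, zero_add, Real.Gamma_one_half_eq]
    exact (div_eq_mul_inv _ _).symm
  | succ m ih =>
    rw [integral_pow_mul_cexp_succ hb, ih]
    have : ((m + 1 : ℕ) : ℝ) + 1 / 2 = (m + 1 / 2 : ℝ) + 1 := by push_cast; ring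
    rw [this, Real.Gamma_add_one (by positivity)]
    push_cast
    rw [pow_succ]
    field_simp

theorem integral_odd_pow_mul_cexp (b : ℂ) (m : ℕ) :
    ∫ v : ℝ, (v : ℂ) ^ (2 * m + 1) * Complex.exp (-b * (v : ℂ) ^ 2) = 0 := by
  have h := integral_neg_eq_self
    (fun v : ℝ => (v : ℂ) ^ (2 * m + 1) * Complex.exp (-b * (v : ℂ) ^ 2)) volume
  have h2 : (fun v : ℝ => ((-v : ℝ) : ℂ) ^ (2 * m + 1) * Complex.exp (-b * ((-v : ℝ) : ℂ) ^ 2)) =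
      fun v : ℝ => -((v : ℂ) ^ (2 * m + 1) * Complex.exp (-b * (v : ℂ) ^ 2)) := by
    funext v
    push_cast
    rw [Odd.neg_pow ⟨m, rfl⟩, neg_sq]
    ring
  rw [h2, integral_neg] at h
  exact self_eq_neg.1 h.symm

theorem integral_even_pow_mul_exp {b : ℝ} (hb : 0 < b) (m : ℕ) :
    ∫ v : ℝ, v ^ (2 * m) * Real.exp (-b * v ^ 2) =
      Real.Gamma (m + 1 / 2) / (b ^ m * √b) := by
  have h := integral_even_pow_mul_cexp (b := (b : ℂ)) (by simpa using hb) m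
  have h1 := ofReal_mul_cpow_half hb (z := 1) one_ne_zero
  rw [mul_one, Complex.one_cpow, mul_one] at h1
  rw [h1] at h
  apply Complex.ofReal_injective
  rw [← integral_complex_ofReal]
  push_cast
  exact h

end Gaussian

/-! ### Laplace's method on a straight segment -/

theorem Gamma_add_nat_eq_ascPochhammer {x : ℝ} (hx : 0 < x) (j : ℕ) :
    (Real.Gamma (x + j) : ℂ) = (ascPochhammer ℂ j).eval (x : ℂ) * (Real.Gamma x : ℂ) := by
  induction j with
  | zero => simp
  | succ j ih =>
    have : x + ((j + 1 : ℕ) : ℝ) = (x + j) + 1 := by push_cast; ring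
    rw [this, Real.Gamma_add_one (by positivity), ascPochhammer_succ_eval]
    push_cast
    rw [ih]
    ring

/-- The coefficient of `Γ(s + 1/2) / (β₀^{1/2} λ^{s+1/2})` in the expansion of
`∫ exp (λ ∑_r β_r (iv)^{r+2}) dv`. -/
def laplaceCoeff (β : ℕ → ℂ) (s : ℕ) : ℂ :=
  (-1) ^ s / β 0 ^ s *
    ∑ j ∈ Finset.range (2 * s + 1),
      (-1) ^ j * (ascPochhammer ℂ j).eval ((s : ℂ) + 1 / 2) /
        ((j ! : ℂ) * β 0 ^ j) * ordBell β (2 * s) j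

section Laplace

open MeasureTheory

variable {β : ℕ → ℂ}

theorem expBell_term_eq (k j : ℕ) (lam v : ℝ) :
    Complex.exp (-((lam : ℂ) * β 0) * (v : ℂ) ^ 2) *
      ((-(lam * v ^ 2 : ℝ) : ℂ) ^ j / (j ! : ℂ) * ordBell β k j) * (Complex.I * v) ^ k =
    ((-lam : ℂ) ^ j / (j ! : ℂ) * ordBell β k j * Complex.I ^ k) *
      ((v : ℂ) ^ (2 * j + k) * Complex.exp (-((lam : ℂ) * β 0) * (v : ℂ) ^ 2)) := by
  push_cast
  rw [pow_add, pow_mul, mul_pow Complex.I, ← neg_mul (lam : ℂ) ((v : ℂ) ^ 2), mul_pow (-(lam : ℂ))]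
  ring

theorem integrable_expBell_term {lam : ℝ} (hlam : 0 < lam) (h0 : 0 < (β 0).re) (k : ℕ) :
    Integrable fun v : ℝ => Complex.exp (-((lam : ℂ) * β 0) * (v : ℂ) ^ 2) *
      expBell β k (-(lam * v ^ 2 : ℝ) : ℂ) * (Complex.I * v) ^ k := by
  have hb : 0 < ((lam : ℂ) * β 0).re := by
    rw [Complex.re_ofReal_mul]
    positivity
  simp only [expBell, Finset.mul_sum, Finset.sum_mul, expBell_term_eq]
  exact integrable_finsetSum _ fun j _ =>
    (integrable_pow_mul_cexp_neg_mul_sq hb (2 * j + k)).const_mul _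

theorem integral_expBell_odd {lam : ℝ} (hlam : 0 < lam) (h0 : 0 < (β 0).re) (s : ℕ) :
    ∫ v : ℝ, Complex.exp (-((lam : ℂ) * β 0) * (v : ℂ) ^ 2) *
      expBell β (2 * s + 1) (-(lam * v ^ 2 : ℝ) : ℂ) * (Complex.I * v) ^ (2 * s + 1) = 0 := by
  have hb : 0 < ((lam : ℂ) * β 0).re := by
    rw [Complex.re_ofReal_mul]
    positivity
  simp only [expBell, Finset.mul_sum, Finset.sum_mul, expBell_term_eq]
  rw [integral_finsetSum _ fun j _ =>
    (integrable_pow_mul_cexp_neg_mul_sq hb (2 * j + (2 * s + 1))).const_mul _]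
  refine Finset.sum_eq_zero fun j _ => ?_
  have : 2 * j + (2 * s + 1) = 2 * (j + s) + 1 := by ring
  rw [integral_const_mul, this, integral_odd_pow_mul_cexp, mul_zero]

theorem integral_expBell_even {lam : ℝ} (hlam : 0 < lam) (h0 : 0 < (β 0).re) (s : ℕ) :
    ∫ v : ℝ, Complex.exp (-((lam : ℂ) * β 0) * (v : ℂ) ^ 2) *
      expBell β (2 * s) (-(lam * v ^ 2 : ℝ) : ℂ) * (Complex.I * v) ^ (2 * s) =
    laplaceCoeff β s * (Real.Gamma (s + 1 / 2) : ℂ) /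
      ((lam : ℂ) ^ s * (√lam : ℂ) * β 0 ^ (1 / 2 : ℂ)) := by
  have hb : 0 < ((lam : ℂ) * β 0).re := by
    rw [Complex.re_ofReal_mul]
    positivity
  have hβ0 := ne_zero_of_re_pos h0
  have hl0 : (lam : ℂ) ≠ 0 := by exact_mod_cast hlam.ne'
  have hs0 : (√lam : ℂ) ≠ 0 := by exact_mod_cast (Real.sqrt_pos.2 hlam).ne'
  have hc0 : β 0 ^ (1 / 2 : ℂ) ≠ 0 := by simp [hβ0]
  simp only [expBell, Finset.mul_sum, Finset.sum_mul, expBell_term_eq]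
  rw [integral_finsetSum _ fun j _ =>
    (integrable_pow_mul_cexp_neg_mul_sq hb (2 * j + 2 * s)).const_mul _]
  rw [laplaceCoeff, Finset.mul_sum, Finset.sum_mul, Finset.sum_div]
  refine Finset.sum_congr rfl fun j _ => ?_
  have : 2 * j + 2 * s = 2 * (s + j) := by ring
  rw [integral_const_mul, this, integral_even_pow_mul_cexp hb, ofReal_mul_cpow_half hlam hβ0,
    pow_mul Complex.I, Complex.I_sq]
  have hG := Gamma_add_nat_eq_ascPochhammer (x := (s : ℝ) + 1 / 2) (by positivity) j
  have hx : ((s + j : ℕ) : ℝ) + 1 / 2 = (s : ℝ) + 1 / 2 + j := by push_cast; ring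
  rw [hx, hG, mul_pow, neg_pow (lam : ℂ), pow_add, pow_add]
  push_cast
  have hj : (j ! : ℂ) ≠ 0 := by exact_mod_cast Nat.factorial_ne_zero j
  field_simp

theorem integral_sum_expBell {lam : ℝ} (hlam : 0 < lam) (h0 : 0 < (β 0).re) (N : ℕ) :
    ∫ v : ℝ, Complex.exp (-((lam : ℂ) * β 0) * (v : ℂ) ^ 2) *
      ∑ k ∈ Finset.range (2 * N), expBell β k (-(lam * v ^ 2 : ℝ) : ℂ) * (Complex.I * v) ^ k =
    ∑ s ∈ Finset.range N, laplaceCoeff β s * (Real.Gamma (s + 1 / 2) : ℂ) /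
      ((lam : ℂ) ^ s * (√lam : ℂ) * β 0 ^ (1 / 2 : ℂ)) := by
  simp only [Finset.mul_sum, ← mul_assoc]
  rw [integral_finsetSum _ fun k _ => integrable_expBell_term hlam h0 k]
  induction N with
  | zero => simp
  | succ N ih =>
    rw [mul_add, mul_one, Finset.sum_range_succ, Finset.sum_range_succ, ih,
      integral_expBell_odd hlam h0, integral_expBell_even hlam h0, add_zero, Finset.sum_range_succ]

/-- The integrand `exp (λ y² (β₀ + ∑_{r ≥ 1} β_r y^r))` of the local Laplace integral. -/
def localIntegrand (β : ℕ → ℂ) (lam : ℝ) (y : ℂ) : ℂ :=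
  Complex.exp ((lam : ℂ) * (y ^ 2 * (β 0 + tailSeries β y)))

theorem localIntegrand_imaginary (lam v : ℝ) :
    localIntegrand β lam (Complex.I * v) = Complex.exp (-((lam : ℂ) * β 0) * (v : ℂ) ^ 2) *
      Complex.exp ((-(lam * v ^ 2 : ℝ) : ℂ) * tailSeries β (Complex.I * v)) := by
  rw [localIntegrand, ← Complex.exp_add, mul_pow, Complex.I_sq]
  congr 1
  push_cast
  ring

/-- With `τ = -λv²` the truncation error grows like `e^{2rλv²}`. Since `4r ≤ c`, the Gaussian `e^{-λ
Re β_0 v²}` absorbs it and still leaves `e^{-λ(c/2)v²}`, whose moment of order `2N` is the stated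
bound. -/
theorem norm_localIntegral_sub_le (hβ : ∀ r, ‖β r‖ ≤ 1) {c r lam : ℝ} (hc : 0 < c)
    (hc0 : c ≤ (β 0).re) (hr : 0 < r) (hr' : r ≤ 1 / 2) (hrc : 4 * r ≤ c) (hlam : 0 < lam)
    (hcont : ContinuousOn (fun v : ℝ => localIntegrand β lam (Complex.I * v)) (Set.Icc (-r) r))
    (N : ℕ) :
    ‖(∫ v in (-r)..r, localIntegrand β lam (Complex.I * v)) -
      ∑ s ∈ Finset.range N, laplaceCoeff β s * (Real.Gamma (s + 1 / 2) : ℂ) /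
        ((lam : ℂ) ^ s * (√lam : ℂ) * β 0 ^ (1 / 2 : ℂ))‖ ≤
      Real.Gamma (N + 1 / 2) / (r ^ (2 * N) * (c / 2) ^ N * √(c / 2)) / (lam ^ N * √lam) := by
  have h0 : 0 < (β 0).re := hc.trans_le hc0
  -- The finite sum becomes an integral over the whole line and the local integrand is extended by
  -- zero, so one pointwise bound covers both `|v| ≤ r` and `|v| > r`.
  rw [← integral_sum_expBell hlam h0, intervalIntegral.integral_of_le (by linarith),
    ← integral_Icc_eq_integral_Ioc, ← integral_indicator measurableSet_Icc]
  have hi1 : Integrable (Set.indicator (Set.Icc (-r) r)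
      fun v : ℝ => localIntegrand β lam (Complex.I * v)) :=
    (hcont.integrableOn_compact isCompact_Icc).integrable_indicator measurableSet_Icc
  have hi2 : Integrable fun v : ℝ => Complex.exp (-((lam : ℂ) * β 0) * (v : ℂ) ^ 2) *
      ∑ k ∈ Finset.range (2 * N), expBell β k (-(lam * v ^ 2 : ℝ) : ℂ) * (Complex.I * v) ^ k := by
    simp only [Finset.mul_sum, ← mul_assoc]
    exact integrable_finsetSum _ fun k _ => integrable_expBell_term hlam h0 k
  rw [← integral_sub hi1 hi2]
  have hg : Integrable fun v : ℝ => (r ^ (2 * N))⁻¹ *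
      (v ^ (2 * N) * Real.exp (-(lam * (c / 2)) * v ^ 2)) :=
    (integrable_pow_mul_exp_neg_mul_sq (by positivity) (2 * N)).const_mul _
  refine (norm_integral_le_of_norm_le hg (ae_of_all _ fun v => ?_)).trans (le_of_eq ?_)
  · have hny : ‖Complex.I * (v : ℂ)‖ = |v| := by simp
    have hτ : ‖(-(lam * v ^ 2 : ℝ) : ℂ)‖ = lam * v ^ 2 := by
      rw [norm_neg, Complex.norm_real, Real.norm_of_nonneg (by positivity)]
    have key : ‖Set.indicator (Set.Icc (-r) r)
          (fun v : ℝ => localIntegrand β lam (Complex.I * v)) v -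
        Complex.exp (-((lam : ℂ) * β 0) * (v : ℂ) ^ 2) *
          ∑ k ∈ Finset.range (2 * N), expBell β k (-(lam * v ^ 2 : ℝ) : ℂ) *
            (Complex.I * v) ^ k‖ ≤ Real.exp (-(lam * (β 0).re) * v ^ 2) *
        ((|v| / r) ^ (2 * N) * Real.exp (2 * r * (lam * v ^ 2))) := by
      have hE : ‖Complex.exp (-((lam : ℂ) * β 0) * (v : ℂ) ^ 2)‖ =
          Real.exp (-(lam * (β 0).re) * v ^ 2) := by
        rw [norm_cexp_neg_mul_sq, Complex.re_ofReal_mul]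
      by_cases hv : v ∈ Set.Icc (-r) r
      · rw [Set.indicator_of_mem hv, localIntegrand_imaginary, ← mul_sub, norm_mul, hE]
        have h := norm_exp_tailSeries_sub_le hβ hr hr' (2 * N) (-(lam * v ^ 2 : ℝ) : ℂ)
          (y := Complex.I * v) (by rw [hny]; exact abs_le.2 hv)
        rw [hny, hτ] at h
        gcongr
      · rw [Set.indicator_of_notMem hv, zero_sub, norm_neg, norm_mul, hE]
        have h := norm_sum_expBell_le hβ hr hr' (2 * N) (-(lam * v ^ 2 : ℝ) : ℂ)
          (y := Complex.I * v) (by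
            rw [hny]
            by_contra! hlt
            exact hv (abs_le.1 hlt.le))
        rw [hny, hτ] at h
        gcongr
    refine key.trans ?_
    have h1 : (|v| / r) ^ (2 * N) = (r ^ (2 * N))⁻¹ * v ^ (2 * N) := by
      rw [div_pow, pow_mul |v|, sq_abs, ← pow_mul]
      field_simp
    rw [h1]
    have h2 : Real.exp (-(lam * (β 0).re) * v ^ 2) * Real.exp (2 * r * (lam * v ^ 2)) ≤
        Real.exp (-(lam * (c / 2)) * v ^ 2) := by
      rw [← Real.exp_add]
      apply Real.exp_le_exp.2
      have : 0 ≤ (lam * v ^ 2) * ((β 0).re - 2 * r - c / 2) :=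
        mul_nonneg (by positivity) (by linarith)
      linarith
    have h3 : 0 ≤ (r ^ (2 * N))⁻¹ * v ^ (2 * N) := by
      rw [pow_mul v]
      positivity
    calc _ = (r ^ (2 * N))⁻¹ * v ^ (2 * N) *
          (Real.exp (-(lam * (β 0).re) * v ^ 2) * Real.exp (2 * r * (lam * v ^ 2))) := by ring
      _ ≤ (r ^ (2 * N))⁻¹ * v ^ (2 * N) * Real.exp (-(lam * (c / 2)) * v ^ 2) := by gcongr
      _ = _ := by ring
  · rw [integral_const_mul, integral_even_pow_mul_exp (by positivity), Real.sqrt_mul hlam.le,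
      mul_pow]
    have := (Real.sqrt_pos.2 hlam).ne'
    have := (Real.sqrt_pos.2 (half_pos hc)).ne'
    field_simp

end Laplace

/-! ### Size of the phase near the ends of the segment -/

section Tails

variable {β : ℕ → ℂ}

theorem hasSum_add_tailSeries (hβ : ∀ r, ‖β r‖ ≤ 1) {y : ℂ} (hy : ‖y‖ < 1) :
    HasSum (fun r : ℕ => β r * y ^ r) (β 0 + tailSeries β y) := by
  have h1 : HasSum (fun r : ℕ => if r = 0 then β 0 else 0) (β 0) := by
    simpa using hasSum_ite_eq (0 : ℕ) (β 0)
  have h2 := (summable_norm_tailSeries hβ hy).of_norm.hasSum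
  have h3 := h1.add h2
  have h4 : (fun r : ℕ => β r * y ^ r) = fun r : ℕ => (if r = 0 then β 0 else 0) +
      (if r = 0 then 0 else β r) * y ^ r := by
    funext r
    by_cases hr : r = 0 <;> simp [hr]
  rw [h4]
  exact h3

/-- At `±ir` the quadratic term is `-r²β_0`. Moving the point by `r²` and adding the tail changes
the phase by at most `19r³`, which is below `cr²/2` because `40r ≤ c`. -/
theorem re_phase_le_neg {c r : ℝ} (hβ : ∀ r, ‖β r‖ ≤ 1) (hc0 : c ≤ (β 0).re) (hr : 0 < r)
    (hrc : 40 * r ≤ c) {e z : ℂ} (he : e = Complex.I ∨ e = -Complex.I)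
    (hz : ‖z - e * r‖ ≤ r ^ 2) :
    (z ^ 2 * (β 0 + tailSeries β z)).re ≤ -(c * r ^ 2 / 2) := by
  have hc1 : c ≤ 1 := hc0.trans ((Complex.re_le_norm _).trans (hβ 0))
  have hr1 : r ≤ 1 / 40 := by linarith
  have hne : ‖e * (r : ℂ)‖ = r := by
    rcases he with rfl | rfl <;> simp [abs_of_pos hr]
  have hsq : (e * (r : ℂ)) ^ 2 = -(r : ℂ) ^ 2 := by
    rcases he with rfl | rfl <;> simp [mul_pow]
  have hzn : ‖z‖ ≤ 2 * r := by
    have := norm_sub_norm_le z (e * r)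
    nlinarith
  have h1 : ‖z ^ 2 + (r : ℂ) ^ 2‖ ≤ 3 * r ^ 3 := by
    have : z ^ 2 + (r : ℂ) ^ 2 = (z - e * r) * (z + e * r) := by linear_combination hsq
    rw [this, norm_mul]
    have h2 : ‖z + e * r‖ ≤ 3 * r := (norm_add_le _ _).trans (by rw [hne]; linarith)
    calc _ ≤ r ^ 2 * (3 * r) := by gcongr
      _ = _ := by ring
  have h2 : ‖tailSeries β z‖ ≤ 4 * r :=
    (norm_tailSeries_le hβ (by linarith)).trans (by linarith)
  have h3 : z ^ 2 * (β 0 + tailSeries β z) =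
      -((r ^ 2 : ℝ) * β 0) + ((z ^ 2 + (r : ℂ) ^ 2) * β 0 + z ^ 2 * tailSeries β z) := by
    push_cast
    ring
  rw [h3, Complex.add_re, Complex.neg_re, Complex.re_ofReal_mul]
  have h4 : ((z ^ 2 + (r : ℂ) ^ 2) * β 0 + z ^ 2 * tailSeries β z).re ≤ 19 * r ^ 3 := by
    refine (Complex.re_le_norm _).trans ((norm_add_le _ _).trans ?_)
    rw [norm_mul, norm_mul, norm_pow]
    calc _ ≤ 3 * r ^ 3 * 1 + (2 * r) ^ 2 * (4 * r) := by
          gcongr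
          exact hβ 0
      _ = _ := by ring
  have h5 : r ^ 2 * c ≤ r ^ 2 * (β 0).re := by gcongr
  have h6 : r ^ 2 * (40 * r) ≤ r ^ 2 * c := by gcongr
  nlinarith

end Tails

/-! ### The rescaled phase at a saddle -/

/-- The Taylor coefficients `β_r` of `σ ((e^{t₀ y / σ} - 1) / t₀ - log (1 + y / σ))` at `y^{r+2}`. -/
def scaledCoeff (t₀ : ℂ) (σ : ℝ) (r : ℕ) : ℂ :=
  (t₀ ^ (r + 1) / ((r + 2)! : ℂ) + (-1) ^ r / ((r : ℂ) + 2)) / (σ : ℂ) ^ (r + 1)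

theorem scaledCoeff_zero (t₀ : ℂ) (σ : ℝ) : scaledCoeff t₀ σ 0 = (1 + t₀) / (2 * σ) := by
  simp only [scaledCoeff, zero_add, pow_one, Nat.factorial_two, pow_zero, Nat.cast_zero]
  push_cast
  ring

/-- This dictates the scale: `σ ≥ ‖t₀‖` controls the exponential's coefficients and `σ ≥ 1` the
logarithm's, each contributing at most one half. -/
theorem norm_scaledCoeff_le {t₀ : ℂ} {σ : ℝ} (hσ : 1 ≤ σ) (ht : ‖t₀‖ ≤ σ) (r : ℕ) :
    ‖scaledCoeff t₀ σ r‖ ≤ 1 := by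
  have hσ0 : 0 < σ := by linarith
  rw [scaledCoeff, norm_div, norm_pow, Complex.norm_real, Real.norm_of_nonneg hσ0.le,
    div_le_one (by positivity)]
  have h1 : ‖t₀ ^ (r + 1) / ((r + 2)! : ℂ)‖ ≤ σ ^ (r + 1) / 2 := by
    rw [norm_div, norm_pow, Complex.norm_natCast]
    have h2 : (2 : ℝ) ≤ ((r + 2)! : ℝ) := by
      exact_mod_cast (Nat.factorial_le (by omega : 2 ≤ r + 2))
    gcongr
  have h2 : ‖(-1 : ℂ) ^ r / ((r : ℂ) + 2)‖ ≤ σ ^ (r + 1) / 2 := by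
    have h3 : ((r : ℂ) + 2) = ((r + 2 : ℕ) : ℂ) := by push_cast; ring
    rw [h3, norm_div, norm_pow, norm_neg, norm_one, one_pow, Complex.norm_natCast]
    have h4 : (2 : ℝ) ≤ ((r + 2 : ℕ) : ℝ) := by exact_mod_cast (by omega : 2 ≤ r + 2)
    have h5 : (1 : ℝ) ≤ σ ^ (r + 1) := one_le_pow₀ hσ
    gcongr
  linarith [norm_add_le (t₀ ^ (r + 1) / ((r + 2)! : ℂ)) ((-1 : ℂ) ^ r / ((r : ℂ) + 2))]

/-- The two Taylor series are compared termwise from order two on. Their linear terms cancel, which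
is the saddle property. -/
theorem phase_eq {t₀ : ℂ} {σ : ℝ} (hσ : 1 ≤ σ) (ht : ‖t₀‖ ≤ σ) (ht0 : t₀ ≠ 0) {y : ℂ}
    (hy : ‖y‖ < 1) :
    y ^ 2 * (scaledCoeff t₀ σ 0 + tailSeries (scaledCoeff t₀ σ) y) =
      σ * ((Complex.exp (t₀ * (y / σ)) - 1) / t₀ - Complex.log (1 + y / σ)) := by
  have hσ0 : (σ : ℂ) ≠ 0 := by
    have : σ ≠ 0 := by linarith
    exact_mod_cast this
  have hw : ‖y / (σ : ℂ)‖ < 1 := by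
    rw [norm_div, Complex.norm_real, Real.norm_of_nonneg (by linarith), div_lt_one (by linarith)]
    linarith
  have h1 := (hasSum_add_tailSeries (norm_scaledCoeff_le hσ ht) hy).mul_left (y ^ 2)
  have h2 := (hasSum_nat_add_iff' 2).2 (hasSum_exp_series (t₀ * (y / σ)))
  have h3 := (hasSum_nat_add_iff' 2).2 (Complex.hasSum_taylorSeries_log hw)
  have h4 := (h2.mul_left ((σ : ℂ) / t₀)).sub (h3.mul_left (σ : ℂ))
  refine h1.unique ?_
  have e1 : (fun r : ℕ => y ^ 2 * (scaledCoeff t₀ σ r * y ^ r)) = fun r : ℕ =>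
      (σ : ℂ) / t₀ * ((t₀ * (y / σ)) ^ (r + 2) / ((r + 2)! : ℂ)) -
        σ * ((-1) ^ (r + 2 + 1) * (y / σ) ^ (r + 2) / ((r + 2 : ℕ) : ℂ)) := by
    funext r
    rw [scaledCoeff]
    have : (r : ℂ) + 2 ≠ 0 := by exact_mod_cast (by omega : r + 2 ≠ 0)
    have : ((r + 2)! : ℂ) ≠ 0 := by exact_mod_cast Nat.factorial_ne_zero (r + 2)
    have h5 : (-1 : ℂ) ^ (r + 2 + 1) = -(-1) ^ r := by ring
    rw [h5, mul_pow, div_pow]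
    push_cast
    field_simp
    ring
  have e2 : (σ : ℂ) * ((Complex.exp (t₀ * (y / σ)) - 1) / t₀ - Complex.log (1 + y / σ)) =
      (σ : ℂ) / t₀ * (Complex.exp (t₀ * (y / σ)) -
          ∑ i ∈ Finset.range 2, (t₀ * (y / σ)) ^ i / (i ! : ℂ)) -
        σ * (Complex.log (1 + y / σ) -
          ∑ i ∈ Finset.range 2, (-1) ^ (i + 1) * (y / σ) ^ i / (i : ℂ)) := by
    simp only [Finset.sum_range_succ, Finset.sum_range_zero]
    simp
    field_simp
    ring
  rw [e1, e2]
  exact h4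

theorem localIntegrand_scaledCoeff {t₀ : ℂ} {σ : ℝ} (hσ : 1 ≤ σ) (ht : ‖t₀‖ ≤ σ) (ht0 : t₀ ≠ 0)
    {y : ℂ} (hy : ‖y‖ < 1) (n : ℕ) :
    localIntegrand (scaledCoeff t₀ σ) (n / σ) y =
      Complex.exp (n / t₀ * (Complex.exp (t₀ * (y / σ)) - 1)) * ((1 + y / σ) ^ n)⁻¹ := by
  have hσ0 : (σ : ℂ) ≠ 0 := by
    have : σ ≠ 0 := by linarith
    exact_mod_cast this
  have hw : ‖y / (σ : ℂ)‖ < 1 := by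
    rw [norm_div, Complex.norm_real, Real.norm_of_nonneg (by linarith), div_lt_one (by linarith)]
    linarith
  have h1 : 1 + y / (σ : ℂ) ≠ 0 := by
    intro h
    have : y / (σ : ℂ) = -1 := by linear_combination h
    rw [this] at hw
    simp at hw
  rw [localIntegrand, phase_eq hσ ht ht0 hy]
  have h2 : ((n / σ : ℝ) : ℂ) * (σ * ((Complex.exp (t₀ * (y / σ)) - 1) / t₀ -
      Complex.log (1 + y / σ))) = n / t₀ * (Complex.exp (t₀ * (y / σ)) - 1) +
        -(n * Complex.log (1 + y / σ)) := by
    push_cast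
    field_simp
    ring
  rw [h2, Complex.exp_add, Complex.exp_neg, Complex.exp_nat_mul, Complex.exp_log h1]

/-! ### From the circular arc to the straight segment -/

/-- The integrand of Cauchy's formula on the circle `t = t₀ e^{iϑ}`, normalized to be `1` at the
saddle `t₀`. -/
def arcIntegrand (n : ℕ) (t₀ : ℂ) (θ : ℝ) : ℂ :=
  Complex.exp (n / t₀ * (Complex.exp (t₀ * (Complex.exp (θ * Complex.I) - 1)) - 1)) *
    (Complex.exp (θ * Complex.I) * (Complex.exp (θ * Complex.I) ^ n)⁻¹)

theorem continuous_arcIntegrand (n : ℕ) (t₀ : ℂ) : Continuous (arcIntegrand n t₀) := by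
  unfold arcIntegrand
  have : Continuous fun θ : ℝ => (Complex.exp (θ * Complex.I) ^ n)⁻¹ :=
    Continuous.inv₀ (by fun_prop) fun θ => pow_ne_zero _ (Complex.exp_ne_zero _)
  fun_prop

theorem norm_exp_mul_I_sub_one_le (θ : ℝ) : ‖Complex.exp (θ * Complex.I) - 1‖ ≤ |θ| := by
  have := Real.norm_exp_I_mul_ofReal_sub_one_le (x := θ)
  rwa [mul_comm, Real.norm_eq_abs] at this

theorem localIntegrand_mul_exp_eq_arcIntegrand {t₀ : ℂ} {σ : ℝ} (hσ : 1 ≤ σ) (ht : ‖t₀‖ ≤ σ)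
    (ht0 : t₀ ≠ 0) {θ : ℝ} (hθ : σ * |θ| < 1) (n : ℕ) :
    localIntegrand (scaledCoeff t₀ σ) (n / σ) (σ * (Complex.exp (θ * Complex.I) - 1)) *
      Complex.exp (θ * Complex.I) = arcIntegrand n t₀ θ := by
  have hσ0 : (σ : ℂ) ≠ 0 := by
    have : σ ≠ 0 := by linarith
    exact_mod_cast this
  have hy : ‖(σ : ℂ) * (Complex.exp (θ * Complex.I) - 1)‖ < 1 := by
    rw [norm_mul, Complex.norm_real, Real.norm_of_nonneg (by linarith)]
    refine lt_of_le_of_lt ?_ hθ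
    have := norm_exp_mul_I_sub_one_le θ
    gcongr
  rw [localIntegrand_scaledCoeff hσ ht ht0 hy, mul_div_cancel_left₀ _ hσ0, arcIntegrand,
    add_sub_cancel]
  ring

theorem norm_arcPoint_sub_le {σ r : ℝ} (hσ : 1 ≤ σ) (hr : 0 < r) (hr1 : r ≤ 1) {e : ℝ}
    (he : e = 1 ∨ e = -1) :
    ‖(σ : ℂ) * (Complex.exp ((e * (r / σ) : ℝ) * Complex.I) - 1) - e * Complex.I * r‖ ≤ r ^ 2 := by
  have hσp : 0 < σ := by linarith
  have hσ0 : (σ : ℂ) ≠ 0 := by exact_mod_cast hσp.ne'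
  have hn : ‖((e * (r / σ) : ℝ) : ℂ) * Complex.I‖ = r / σ := by
    rw [norm_mul, Complex.norm_I, mul_one, Complex.norm_real, Real.norm_eq_abs, abs_mul,
      abs_of_pos (by positivity : 0 < r / σ)]
    rcases he with rfl | rfl <;> simp
  have hle : r / σ ≤ 1 := (div_le_one hσp).2 (by linarith)
  have h := Complex.norm_exp_sub_one_sub_id_le (x := ((e * (r / σ) : ℝ) : ℂ) * Complex.I)
    (by rw [hn]; exact hle)
  have h1 : (σ : ℂ) * (Complex.exp ((e * (r / σ) : ℝ) * Complex.I) - 1) - e * Complex.I * r =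
      σ * (Complex.exp ((e * (r / σ) : ℝ) * Complex.I) - 1 - ((e * (r / σ) : ℝ) : ℂ) * Complex.I) := by
    push_cast
    field_simp
  rw [h1, norm_mul, Complex.norm_real, Real.norm_of_nonneg hσp.le]
  rw [hn] at h
  calc _ ≤ σ * (r / σ) ^ 2 := by gcongr
    _ = r ^ 2 / σ := by field_simp
    _ ≤ r ^ 2 := div_le_self (by positivity) hσ

theorem norm_localIntegrand_le {β : ℕ → ℂ} {c r lam : ℝ} (hβ : ∀ r, ‖β r‖ ≤ 1)
    (hc0 : c ≤ (β 0).re) (hr : 0 < r) (hrc : 40 * r ≤ c) (hlam : 0 ≤ lam) {e : ℝ}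
    (he : e = 1 ∨ e = -1) {z : ℂ} (hz : ‖z - e * Complex.I * r‖ ≤ r ^ 2) :
    ‖localIntegrand β lam z‖ ≤ Real.exp (-(lam * (c * r ^ 2 / 2))) := by
  rw [localIntegrand, Complex.norm_exp, Complex.re_ofReal_mul]
  apply Real.exp_le_exp.2
  have := re_phase_le_neg hβ hc0 hr hrc (e := e * Complex.I) (z := z)
    (by rcases he with rfl | rfl <;> simp) hz
  nlinarith

theorem norm_arcIntegrand_endpoint_le {t₀ : ℂ} {σ c r : ℝ} (hσ : 1 ≤ σ) (ht : ‖t₀‖ ≤ σ)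
    (ht0 : t₀ ≠ 0) (hc0 : c ≤ (scaledCoeff t₀ σ 0).re) (hr : 0 < r) (hrc : 40 * r ≤ c) {e : ℝ}
    (he : e = 1 ∨ e = -1) (n : ℕ) :
    ‖arcIntegrand n t₀ (e * (r / σ))‖ ≤ Real.exp (-(n / σ * (c * r ^ 2 / 2))) := by
  have hβ := norm_scaledCoeff_le hσ ht
  have hσp : 0 < σ := by linarith
  have hc1 : c ≤ 1 := hc0.trans ((Complex.re_le_norm _).trans (hβ 0))
  have hlt : σ * |e * (r / σ)| < 1 := by
    rw [abs_mul, abs_of_pos (by positivity : 0 < r / σ)]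
    have : |e| = 1 := by rcases he with rfl | rfl <;> simp
    rw [this, one_mul, mul_div_cancel₀ _ hσp.ne']
    linarith
  rw [← localIntegrand_mul_exp_eq_arcIntegrand hσ ht ht0 hlt, norm_mul,
    Complex.norm_exp_ofReal_mul_I, mul_one]
  exact norm_localIntegrand_le hβ hc0 hr hrc (by positivity) he
    (norm_arcPoint_sub_le hσ hr (by linarith) he)

theorem differentiableOn_localIntegrand {t₀ : ℂ} {σ : ℝ} (hσ : 1 ≤ σ) (ht : ‖t₀‖ ≤ σ)
    (ht0 : t₀ ≠ 0) (n : ℕ) :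
    DifferentiableOn ℂ (localIntegrand (scaledCoeff t₀ σ) (n / σ)) (Metric.ball 0 1) := by
  have hσp : 0 < σ := by linarith
  have h : DifferentiableOn ℂ (fun y : ℂ =>
      Complex.exp (n / t₀ * (Complex.exp (t₀ * (y / σ)) - 1)) * ((1 + y / σ) ^ n)⁻¹)
      (Metric.ball 0 1) := by
    refine DifferentiableOn.mul (by fun_prop) (DifferentiableOn.inv (by fun_prop) ?_)
    intro y hy
    rw [mem_ball_zero_iff] at hy
    refine pow_ne_zero _ fun h => ?_
    have h1 : y / (σ : ℂ) = -1 := by linear_combination h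
    have hw : ‖y / (σ : ℂ)‖ < 1 := by
      rw [norm_div, Complex.norm_real, Real.norm_of_nonneg (by linarith), div_lt_one hσp]
      linarith
    rw [h1] at hw
    simp at hw
  exact h.congr fun y hy => localIntegrand_scaledCoeff hσ ht ht0 (mem_ball_zero_iff.1 hy) n

/-- Both integrals are increments of one primitive `G` on the unit disc. The corresponding endpoints
are within `r²` of each other, inside balls where the integrand is exponentially small. -/
theorem norm_arcIntegral_sub_le {t₀ : ℂ} {σ c r : ℝ} (hσ : 1 ≤ σ) (ht : ‖t₀‖ ≤ σ)
    (ht0 : t₀ ≠ 0) (hc0 : c ≤ (scaledCoeff t₀ σ 0).re) (hr : 0 < r) (hrc : 40 * r ≤ c) (n : ℕ) :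
    ‖σ * (∫ θ in (-(r / σ))..(r / σ), arcIntegrand n t₀ θ) -
      ∫ v in (-r)..r, localIntegrand (scaledCoeff t₀ σ) (n / σ) (Complex.I * v)‖ ≤
      2 * (Real.exp (-(n / σ * (c * r ^ 2 / 2))) * r ^ 2) := by
  have hβ := norm_scaledCoeff_le hσ ht
  have hσp : 0 < σ := by linarith
  have hc1 : c ≤ 1 := hc0.trans ((Complex.re_le_norm _).trans (hβ 0))
  have hr1 : r ≤ 1 / 40 := by linarith
  have hlam : (0 : ℝ) ≤ n / σ := by positivity
  set f := localIntegrand (scaledCoeff t₀ σ) (n / σ) with hf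
  have hd := differentiableOn_localIntegrand hσ ht ht0 n
  obtain ⟨G, hG⟩ := hd.isExactOn_ball
  have hcont := hd.continuousOn
  have hI1 : ∫ v in (-r)..r, f (Complex.I * v) * Complex.I =
      G (Complex.I * r) - G (Complex.I * (-r : ℝ)) := by
    have hmem : ∀ v ∈ Set.uIcc (-r) r, Complex.I * (v : ℂ) ∈ Metric.ball (0 : ℂ) 1 := by
      intro v hv
      rw [Set.uIcc_of_le (by linarith)] at hv
      have := abs_le.2 hv
      simp only [mem_ball_zero_iff, norm_mul, Complex.norm_I, one_mul, Complex.norm_real,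
        Real.norm_eq_abs]
      linarith
    refine intervalIntegral.integral_eq_sub_of_hasDerivAt
      (f := fun v : ℝ => G (Complex.I * v)) (fun v hv => ?_) ?_
    · have h1 : HasDerivAt (fun z : ℂ => G (Complex.I * z)) (f (Complex.I * v) * Complex.I) (v : ℂ) := by
        have h2 : HasDerivAt (fun z : ℂ => Complex.I * z) Complex.I (v : ℂ) := by
          simpa using (hasDerivAt_id (v : ℂ)).const_mul Complex.I
        exact HasDerivAt.comp (v : ℂ) (hG _ (hmem v hv)) h2
      exact h1.comp_ofReal
    · refine ContinuousOn.intervalIntegrable (ContinuousOn.mul ?_ continuousOn_const)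
      exact hcont.comp (by fun_prop) hmem
  have hI2 : ∫ θ in (-(r / σ))..(r / σ), arcIntegrand n t₀ θ * (σ * Complex.I) =
      G (σ * (Complex.exp ((1 * (r / σ) : ℝ) * Complex.I) - 1)) -
        G (σ * (Complex.exp ((-1 * (r / σ) : ℝ) * Complex.I) - 1)) := by
    rw [one_mul, neg_one_mul]
    refine intervalIntegral.integral_eq_sub_of_hasDerivAt
      (f := fun θ : ℝ => G (σ * (Complex.exp (θ * Complex.I) - 1))) (fun θ hθ => ?_) ?_
    · have hp : 0 < r / σ := by positivity
      rw [Set.uIcc_of_le (by linarith)] at hθ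
      have habs := abs_le.2 hθ
      have hlt : σ * |θ| < 1 := by
        calc σ * |θ| ≤ σ * (r / σ) := by gcongr
          _ = r := by field_simp
          _ < 1 := by linarith
      have hmem : (σ : ℂ) * (Complex.exp (θ * Complex.I) - 1) ∈ Metric.ball (0 : ℂ) 1 := by
        rw [mem_ball_zero_iff, norm_mul, Complex.norm_real, Real.norm_of_nonneg hσp.le]
        refine lt_of_le_of_lt ?_ hlt
        have := norm_exp_mul_I_sub_one_le θ
        gcongr
      have h2 : HasDerivAt (fun z : ℂ => (σ : ℂ) * (Complex.exp (z * Complex.I) - 1))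
          (σ * (Complex.exp (θ * Complex.I) * Complex.I)) (θ : ℂ) := by
        have := (((hasDerivAt_id (θ : ℂ)).mul_const Complex.I).cexp.sub_const 1).const_mul (σ : ℂ)
        simpa using this
      have h1 := (HasDerivAt.comp (θ : ℂ) (hG _ hmem) h2).comp_ofReal
      rw [← localIntegrand_mul_exp_eq_arcIntegrand hσ ht ht0 hlt]
      refine h1.congr_deriv ?_
      ring
    · exact ((continuous_arcIntegrand n t₀).mul continuous_const).intervalIntegrable _ _
  have hG' : ∀ e : ℝ, (e = 1 ∨ e = -1) →
      ‖G (σ * (Complex.exp ((e * (r / σ) : ℝ) * Complex.I) - 1)) - G (e * Complex.I * r)‖ ≤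
        Real.exp (-(n / σ * (c * r ^ 2 / 2))) * r ^ 2 := by
    intro e he
    have hnorm : ‖(e : ℂ) * Complex.I * r‖ = r := by
      rcases he with rfl | rfl <;> simp [abs_of_pos hr]
    have hpt := norm_arcPoint_sub_le hσ hr (by linarith : r ≤ 1) he
    have hsub : Metric.closedBall ((e : ℂ) * Complex.I * r) (r ^ 2) ⊆ Metric.ball 0 1 := by
      intro z hz
      rw [mem_closedBall_iff_norm] at hz
      rw [mem_ball_zero_iff]
      have := norm_sub_norm_le z (e * Complex.I * r)
      nlinarith
    have h := (convex_closedBall ((e : ℂ) * Complex.I * r) (r ^ 2)).norm_image_sub_le_of_norm_hasDerivWithin_le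
      (f := G) (f' := f) (C := Real.exp (-(n / σ * (c * r ^ 2 / 2))))
      (x := (e : ℂ) * Complex.I * r)
      (y := σ * (Complex.exp ((e * (r / σ) : ℝ) * Complex.I) - 1))
      (fun z hz => (hG z (hsub hz)).hasDerivWithinAt)
      (fun z hz => norm_localIntegrand_le hβ hc0 hr hrc hlam he (mem_closedBall_iff_norm.1 hz))
      (Metric.mem_closedBall_self (by positivity)) (mem_closedBall_iff_norm.2 hpt)
    refine h.trans ?_
    gcongr
  rw [intervalIntegral.integral_mul_const] at hI1 hI2
  have h1 := hG' 1 (Or.inl rfl)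
  have h2 := hG' (-1) (Or.inr rfl)
  have hfin : (σ * (∫ θ in (-(r / σ))..(r / σ), arcIntegrand n t₀ θ) -
      ∫ v in (-r)..r, f (Complex.I * v)) * Complex.I =
      (G (σ * (Complex.exp ((1 * (r / σ) : ℝ) * Complex.I) - 1)) - G ((1 : ℝ) * Complex.I * r)) -
      (G (σ * (Complex.exp ((-1 * (r / σ) : ℝ) * Complex.I) - 1)) - G ((-1 : ℝ) * Complex.I * r)) := by
    have e1 : ((1 : ℝ) : ℂ) * Complex.I * r = Complex.I * r := by push_cast; ring
    have e2 : ((-1 : ℝ) : ℂ) * Complex.I * r = Complex.I * (-r : ℝ) := by push_cast; ring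
    rw [e1, e2]
    linear_combination hI2 - hI1
  have hn := congrArg norm hfin
  rw [norm_mul, Complex.norm_I, mul_one] at hn
  rw [hn]
  refine (norm_sub_le _ _).trans ?_
  linarith

/-! ### Cauchy's formula for the Touchard polynomials -/

section Cauchy

open MeasureTheory

theorem integral_exp_mul_circleMap_div_pow {ρ : ℝ} (hρ : 0 < ρ) (m k : ℕ) :
    ∫ θ in (0 : ℝ)..2 * Real.pi,
      Complex.exp (k * circleMap 0 ρ θ) * (circleMap 0 ρ θ ^ m)⁻¹ =
        2 * Real.pi * (k : ℂ) ^ m / (m ! : ℂ) := by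
  have hd : DifferentiableOn ℂ (fun t : ℂ => Complex.exp (k * t)) (Metric.closedBall 0 ρ) := by
    fun_prop
  have h := hd.circleIntegral_one_div_sub_center_pow_smul hρ m
  rw [iteratedDeriv_cexp_const_mul, circleIntegral] at h
  have hfun : ∀ θ : ℝ, deriv (circleMap 0 ρ) θ • ((1 / (circleMap 0 ρ θ - 0) ^ (m + 1)) •
      Complex.exp (k * circleMap 0 ρ θ)) =
      Complex.I * (Complex.exp (k * circleMap 0 ρ θ) * (circleMap 0 ρ θ ^ m)⁻¹) := by
    intro θ
    have h0 : circleMap 0 ρ θ ≠ 0 := circleMap_ne_center hρ.ne'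
    rw [deriv_circleMap, smul_eq_mul, smul_eq_mul, sub_zero, pow_succ]
    field_simp
  simp only [hfun] at h
  rw [intervalIntegral.integral_const_mul] at h
  apply mul_left_cancel₀ Complex.I_ne_zero
  rw [h]
  simp
  ring

theorem hasSum_exp_mul_exp (z t : ℂ) :
    HasSum (fun k : ℕ => z ^ k / (k ! : ℂ) * Complex.exp (k * t))
      (Complex.exp (z * Complex.exp t)) := by
  have h := hasSum_exp_series (z * Complex.exp t)
  have e : (fun k : ℕ => z ^ k / (k ! : ℂ) * Complex.exp (k * t)) =
      fun k : ℕ => (z * Complex.exp t) ^ k / (k ! : ℂ) := by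
    funext k
    rw [Complex.exp_nat_mul, mul_pow]
    ring
  rw [e]
  exact h

/-- Expanding `exp(z e^t)` in powers of `e^t` reduces to Cauchy's formula for `e^{kt}`. On the
circle `|e^{kt}| ≤ e^{kρ}` gives a summable dominating series. -/
theorem hasSum_touchard_integral {ρ : ℝ} (hρ : 0 < ρ) (m : ℕ) (z : ℂ) :
    HasSum (fun k : ℕ => z ^ k / (k ! : ℂ) * (2 * Real.pi * (k : ℂ) ^ m / (m ! : ℂ)))
      (∫ θ in (0 : ℝ)..2 * Real.pi,
        Complex.exp (z * Complex.exp (circleMap 0 ρ θ)) * (circleMap 0 ρ θ ^ m)⁻¹) := by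
  have hne : ∀ θ : ℝ, circleMap 0 ρ θ ≠ 0 := fun θ => circleMap_ne_center hρ.ne'
  have hcinv : Continuous fun θ : ℝ => (circleMap 0 ρ θ ^ m)⁻¹ :=
    Continuous.inv₀ (by fun_prop) fun θ => pow_ne_zero _ (hne θ)
  have h := intervalIntegral.hasSum_integral_of_dominated_convergence (μ := volume)
    (a := 0) (b := 2 * Real.pi)
    (F := fun (k : ℕ) (θ : ℝ) => z ^ k / (k ! : ℂ) *
      (Complex.exp (k * circleMap 0 ρ θ) * (circleMap 0 ρ θ ^ m)⁻¹))
    (f := fun θ => Complex.exp (z * Complex.exp (circleMap 0 ρ θ)) * (circleMap 0 ρ θ ^ m)⁻¹)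
    (bound := fun (k : ℕ) (_ : ℝ) => (‖z‖ * Real.exp ρ) ^ k / (k ! : ℝ) * (ρ ^ m)⁻¹)
    (fun k => (by fun_prop : Continuous fun θ : ℝ => z ^ k / (k ! : ℂ) *
      (Complex.exp (k * circleMap 0 ρ θ) * (circleMap 0 ρ θ ^ m)⁻¹)).aestronglyMeasurable)
    (fun k => ae_of_all _ fun θ _ => ?_)
    (ae_of_all _ fun θ _ => ((hasSum_exp_series_real (‖z‖ * Real.exp ρ)).mul_right _).summable)
    (by simp)
    (ae_of_all _ fun θ _ => ?_)
  · simp only [intervalIntegral.integral_const_mul, integral_exp_mul_circleMap_div_pow hρ] at h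
    exact h
  · have hn : ‖circleMap 0 ρ θ‖ = ρ := by rw [norm_circleMap_zero, abs_of_pos hρ]
    rw [norm_mul, norm_mul, norm_div, norm_pow, Complex.norm_natCast, norm_inv, norm_pow, hn,
      mul_pow, Complex.norm_exp, ← Real.exp_nat_mul]
    have h1 : ((k : ℂ) * circleMap 0 ρ θ).re ≤ k * ρ := by
      refine (Complex.re_le_norm _).trans ?_
      rw [norm_mul, hn, Complex.norm_natCast]
    have h2 := Real.exp_le_exp.2 h1
    calc _ ≤ ‖z‖ ^ k / (k ! : ℝ) * (Real.exp (k * ρ) * (ρ ^ m)⁻¹) := by gcongr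
      _ = _ := by ring
  · have h1 := (hasSum_exp_mul_exp z (circleMap 0 ρ θ)).mul_right ((circleMap 0 ρ θ ^ m)⁻¹)
    simpa only [mul_assoc] using h1

theorem touchard_eq_integral {ρ : ℝ} (hρ : 0 < ρ) (m : ℕ) (z : ℂ) :
    touchard m z = Complex.exp (-z) * ((m ! : ℂ) / (2 * Real.pi) *
      ∫ θ in (0 : ℝ)..2 * Real.pi,
        Complex.exp (z * Complex.exp (circleMap 0 ρ θ)) * (circleMap 0 ρ θ ^ m)⁻¹) := by
  have h := (hasSum_touchard_integral hρ m z).mul_left ((m ! : ℂ) / (2 * Real.pi))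
  rw [touchard, ← h.tsum_eq]
  congr 1
  refine tsum_congr fun k => ?_
  have h1 : (m ! : ℂ) ≠ 0 := by exact_mod_cast Nat.factorial_ne_zero m
  have h2 : (Real.pi : ℂ) ≠ 0 := by exact_mod_cast Real.pi_ne_zero
  field_simp

end Cauchy

/-- `Γ(n) e^{x + n/t₀} / t₀^{n-1}`: the prefactor of the normalized contour integral. -/
def contourFactor (n : ℕ) (x : ℝ) (t₀ : ℂ) : ℂ :=
  (Real.Gamma n : ℂ) * Complex.exp ((x : ℂ) + (n : ℂ) / t₀) / t₀ ^ (n - 1)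

theorem IsSaddle.ne_zero {μ : ℝ} (hμ : μ ≠ 0) {t : ℂ} (h : IsSaddle μ t) : t ≠ 0 := by
  rintro rfl
  rw [IsSaddle, zero_mul, eq_comm, neg_eq_zero] at h
  exact hμ (by exact_mod_cast h)

theorem arcIntegrand_eq {n : ℕ} (hn : n ≠ 0) {x : ℝ} (hx : 0 < x) {t₀ : ℂ}
    (h : IsSaddle (n / x) t₀) (θ : ℝ) :
    Complex.exp (-(x : ℂ) * Complex.exp (t₀ * Complex.exp (θ * Complex.I))) *
      ((t₀ * Complex.exp (θ * Complex.I)) ^ (n - 1))⁻¹ =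
    Complex.exp (n / t₀) / t₀ ^ (n - 1) * arcIntegrand n t₀ θ := by
  have hn' : (n : ℝ) ≠ 0 := by exact_mod_cast hn
  have ht0 := h.ne_zero (div_ne_zero hn' hx.ne')
  have hx0 : (x : ℂ) ≠ 0 := by exact_mod_cast hx.ne'
  have hsad : -(x : ℂ) * Complex.exp t₀ = n / t₀ := by
    rw [IsSaddle] at h
    push_cast at h
    field_simp at h ⊢
    linear_combination -h
  have h1 : t₀ * Complex.exp (θ * Complex.I) =
      t₀ + t₀ * (Complex.exp (θ * Complex.I) - 1) := by ring
  have h2 : -(x : ℂ) * Complex.exp (t₀ * Complex.exp (θ * Complex.I)) =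
      n / t₀ + n / t₀ * (Complex.exp (t₀ * (Complex.exp (θ * Complex.I) - 1)) - 1) := by
    rw [h1, Complex.exp_add, ← mul_assoc, hsad]
    ring
  rw [h2, Complex.exp_add, arcIntegrand, mul_pow]
  obtain ⟨m, rfl⟩ := Nat.exists_eq_succ_of_ne_zero hn
  rw [Nat.succ_sub_one, Nat.succ_eq_add_one, pow_succ (Complex.exp (θ * Complex.I))]
  have := Complex.exp_ne_zero (θ * Complex.I)
  field_simp

/-- By periodicity the angle may be measured from the argument of `t₀`. -/
theorem touchard_eq_arcIntegral {n : ℕ} (hn : n ≠ 0) {x : ℝ} (hx : 0 < x) {t₀ : ℂ}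
    (h : IsSaddle (n / x) t₀) :
    touchard (n - 1) (-(x : ℂ)) = contourFactor n x t₀ *
      (1 / (2 * Real.pi) * ∫ θ in (-Real.pi)..Real.pi, arcIntegrand n t₀ θ) := by
  have hn' : (n : ℝ) ≠ 0 := by exact_mod_cast hn
  have ht0 := h.ne_zero (div_ne_zero hn' hx.ne')
  rw [touchard_eq_integral (norm_pos_iff.2 ht0)]
  set g : ℝ → ℂ := fun θ => Complex.exp (-(x : ℂ) * Complex.exp (circleMap 0 ‖t₀‖ θ)) *
    (circleMap 0 ‖t₀‖ θ ^ (n - 1))⁻¹ with hg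
  have hper : Function.Periodic g (2 * Real.pi) := by
    intro θ
    simp only [hg, periodic_circleMap 0 ‖t₀‖ θ]
  have h1 : ∀ θ : ℝ, g (θ + t₀.arg) =
      Complex.exp (n / t₀) / t₀ ^ (n - 1) * arcIntegrand n t₀ θ := by
    intro θ
    have hc : circleMap 0 ‖t₀‖ (θ + t₀.arg) = t₀ * Complex.exp (θ * Complex.I) := by
      rw [circleMap_zero]
      conv_rhs => rw [← Complex.norm_mul_exp_arg_mul_I t₀]
      push_cast
      rw [add_mul, Complex.exp_add]
      ring
    rw [← arcIntegrand_eq hn hx h, hg]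
    simp only [hc]
  have h2 : ∫ θ in (0 : ℝ)..2 * Real.pi, g θ =
      ∫ θ in (-Real.pi)..Real.pi, g (θ + t₀.arg) := by
    rw [intervalIntegral.integral_comp_add_right]
    have h3 := hper.intervalIntegral_add_eq 0 (-Real.pi + t₀.arg)
    rw [zero_add] at h3
    rw [h3]
    congr 1
    ring
  rw [h2]
  simp only [h1]
  rw [intervalIntegral.integral_const_mul, contourFactor, neg_neg, Complex.exp_add]
  have hG : (Real.Gamma n : ℂ) = ((n - 1)! : ℂ) := by
    obtain ⟨m, rfl⟩ := Nat.exists_eq_succ_of_ne_zero hn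
    rw [Nat.succ_sub_one, Nat.succ_eq_add_one]
    push_cast
    rw [Real.Gamma_nat_eq_factorial]
    norm_cast
  rw [hG]
  ring

/-! ### Complex roots of the saddle equation -/

section Roots

theorem IsSaddle.conj {μ : ℝ} {t : ℂ} (h : IsSaddle μ t) : IsSaddle μ ((starRingEnd ℂ) t) := by
  rw [IsSaddle] at h ⊢
  rw [Complex.exp_conj, ← map_mul, h]
  simp

/-- Polar form of `t e^t = -μ`. -/
theorem IsSaddle.polar {μ : ℝ} (hμ : 0 < μ) {t : ℂ} (h : IsSaddle μ t) :
    0 < ‖t‖ ∧ ‖t‖ * Real.exp t.re = μ ∧ t.re = -(‖t‖ * Real.cos t.im) ∧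
      t.im = ‖t‖ * Real.sin t.im := by
  have hn : ‖t‖ * Real.exp t.re = μ := by
    have := congrArg norm h
    rwa [norm_mul, Complex.norm_exp, norm_neg, Complex.norm_real, Real.norm_of_nonneg hμ.le] at this
  have hρ : ‖t‖ = μ * Real.exp (-t.re) := by
    rw [← hn, mul_assoc, ← Real.exp_add]
    simp
  have ht : t = -(μ : ℂ) * Complex.exp (-t) := by
    rw [IsSaddle] at h
    rw [← h, mul_assoc, ← Complex.exp_add]
    simp
  have hre := congrArg Complex.re ht
  have him := congrArg Complex.im ht
  rw [← Complex.ofReal_neg, Complex.re_ofReal_mul, Complex.exp_re, Complex.neg_re, Complex.neg_im,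
    Real.cos_neg] at hre
  rw [← Complex.ofReal_neg, Complex.im_ofReal_mul, Complex.exp_im, Complex.neg_re, Complex.neg_im,
    Real.sin_neg] at him
  refine ⟨norm_pos_iff.2 (h.ne_zero hμ.ne'), hn, ?_, ?_⟩
  · rw [hρ]
    linarith
  · rw [hρ]
    linarith

theorem norm_sq_eq_re_im (t : ℂ) : ‖t‖ ^ 2 = t.re ^ 2 + t.im ^ 2 := by
  rw [Complex.sq_norm, Complex.normSq_apply]
  ring

theorem mul_cos_lt_sin {b : ℝ} (hb : 0 < b) (hb' : b < Real.pi) :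
    b * Real.cos b < Real.sin b := by
  have hs := Real.sin_pos_of_pos_of_lt_pi hb hb'
  rcases lt_or_ge b (Real.pi / 2) with h | h
  · have hc := Real.cos_pos_of_mem_Ioo ⟨by linarith, h⟩
    have := Real.lt_tan hb h
    rwa [Real.tan_eq_sin_div_cos, lt_div_iff₀ hc] at this
  · have hc := Real.cos_nonpos_of_pi_div_two_le_of_le h (by linarith)
    nlinarith

theorem le_inv_exp_of_real_root {μ a : ℝ} (h : a * Real.exp a = -μ) : μ ≤ 1 / Real.exp 1 := by
  have h1 := Real.add_one_le_exp (-a - 1)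
  have h2 : Real.exp (-a - 1) * Real.exp a = 1 / Real.exp 1 := by
    rw [← Real.exp_add, one_div, ← Real.exp_neg]
    congr 1
    ring
  rw [← h2]
  have := Real.exp_pos a
  nlinarith

theorem IsSaddle.im_ne_zero {μ : ℝ} (hμ : 1 / Real.exp 1 < μ) {t : ℂ} (h : IsSaddle μ t) :
    t.im ≠ 0 := by
  intro h0
  have hμ0 : 0 < μ := lt_trans (by positivity) hμ
  obtain ⟨-, h1, h2, -⟩ := h.polar hμ0
  rw [h0, Real.cos_zero, mul_one] at h2
  have : t.re * Real.exp t.re = -μ := by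
    rw [← h1]
    nth_rewrite 1 [h2]
    ring
  linarith [le_inv_exp_of_real_root this]

/-- The relation `Im t = ‖t‖ sin(Im t)` forces the sine to be positive. -/
theorem IsSaddle.im_lt_pi_or {μ : ℝ} (hμ : 0 < μ) {t : ℂ} (h : IsSaddle μ t) (h0 : 0 < t.im) :
    t.im < Real.pi ∨ 2 * Real.pi < t.im := by
  obtain ⟨h1, -, -, h3⟩ := h.polar hμ
  have hs : 0 < Real.sin t.im := by
    rw [h3] at h0
    exact (pos_iff_pos_of_mul_pos h0).1 h1
  by_contra! hcon
  have := Real.sin_nonneg_of_nonneg_of_le_pi (x := t.im - Real.pi) (by linarith)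
    (by linarith)
  rw [Real.sin_sub_pi] at this
  linarith

theorem IsSaddle.one_add_re_pos {μ : ℝ} (hμ : 0 < μ) {t : ℂ} (h : IsSaddle μ t) (h0 : 0 < t.im)
    (hpi : t.im < Real.pi) : 0 < 1 + t.re := by
  obtain ⟨h1, -, h2, h3⟩ := h.polar hμ
  have h4 := mul_cos_lt_sin h0 hpi
  have h5 : t.im * (1 + t.re) = ‖t‖ * (Real.sin t.im - t.im * Real.cos t.im) := by
    linear_combination h3 + t.im * h2
  have h6 : 0 < t.im * (1 + t.re) := by
    rw [h5]
    exact mul_pos h1 (by linarith)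
  exact (pos_iff_pos_of_mul_pos h6).1 h0

theorem IsSaddle.one_lt_norm {μ : ℝ} (hμ : 0 < μ) {t : ℂ} (h : IsSaddle μ t) (h0 : 0 < t.im) :
    1 < ‖t‖ := by
  obtain ⟨h1, -, -, h3⟩ := h.polar hμ
  have h4 := Real.sin_lt h0
  by_contra! hle
  have hs : 0 < Real.sin t.im := by
    have := h0
    rw [h3] at this
    exact (pos_iff_pos_of_mul_pos this).1 h1
  nlinarith

/-- A nonpositive real part forces `cos(Im t) ≥ 0`, so `Im t ≤ π/2`, and Jordan's inequality bounds
`‖t‖ = Im t / sin(Im t)`. -/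
theorem IsSaddle.norm_le_of_re_nonpos {μ : ℝ} (hμ : 0 < μ) {t : ℂ} (h : IsSaddle μ t)
    (h0 : 0 < t.im) (hpi : t.im < Real.pi) (hre : t.re ≤ 0) : ‖t‖ ≤ Real.pi / 2 := by
  obtain ⟨h1, -, h2, h3⟩ := h.polar hμ
  have hc : 0 ≤ Real.cos t.im := by
    by_contra! hneg
    nlinarith
  have hb : t.im ≤ Real.pi / 2 := by
    by_contra! hgt
    have := Real.cos_neg_of_pi_div_two_lt_of_lt hgt (by linarith)
    linarith
  have h4 := Real.mul_le_sin h0.le hb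
  have h5 : ‖t‖ * (2 / Real.pi * t.im) ≤ t.im := by
    nth_rewrite 2 [h3]
    gcongr
  have h6 : ‖t‖ * (2 / Real.pi) ≤ 1 := by
    by_contra! hgt
    nlinarith
  have hp := Real.pi_pos
  rw [← mul_div_assoc, div_le_one hp] at h6
  linarith

/-- At a root with `b = Im t` in the strip this function equals `log μ`, so monotonicity gives
uniqueness. Its derivative has a sum of squares as numerator. -/
theorem strictMonoOn_logModulus : StrictMonoOn
    (fun b : ℝ => Real.log b - Real.log (Real.sin b) - b * Real.cos b / Real.sin b)
    (Set.Ioo 0 Real.pi) := by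
  have hd : ∀ b ∈ Set.Ioo 0 Real.pi, HasDerivAt
      (fun b : ℝ => Real.log b - Real.log (Real.sin b) - b * Real.cos b / Real.sin b)
      (((Real.sin b - b * Real.cos b) ^ 2 + b ^ 2 * Real.sin b ^ 2) / (b * Real.sin b ^ 2)) b := by
    intro b hb
    have hs := Real.sin_pos_of_mem_Ioo hb
    have h1 := ((Real.hasDerivAt_log hb.1.ne').sub ((Real.hasDerivAt_sin b).log hs.ne')).sub
      (((hasDerivAt_id b).mul (Real.hasDerivAt_cos b)).div (Real.hasDerivAt_sin b) hs.ne')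
    refine h1.congr_deriv ?_
    have hb0 := hb.1.ne'
    simp only [id, Pi.mul_apply]
    field_simp
    ring
  refine strictMonoOn_of_deriv_pos (convex_Ioo _ _)
    (fun b hb => (hd b hb).continuousAt.continuousWithinAt) fun b hb => ?_
  rw [interior_Ioo] at hb
  rw [(hd b hb).deriv]
  have hs := Real.sin_pos_of_mem_Ioo hb
  have hb0 := hb.1
  positivity

theorem IsSaddle.eq_of_im_mem {μ : ℝ} (hμ : 0 < μ) {t w : ℂ} (ht : IsSaddle μ t)
    (hw : IsSaddle μ w) (ht0 : t.im ∈ Set.Ioo 0 Real.pi) (hw0 : w.im ∈ Set.Ioo 0 Real.pi) :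
    t = w := by
  have key : ∀ z : ℂ, IsSaddle μ z → z.im ∈ Set.Ioo 0 Real.pi →
      z.re = -(z.im * Real.cos z.im / Real.sin z.im) ∧ Real.log z.im - Real.log (Real.sin z.im) -
        z.im * Real.cos z.im / Real.sin z.im = Real.log μ := by
    intro z hz hz0
    obtain ⟨h1, h2, h3, h4⟩ := hz.polar hμ
    have hs := Real.sin_pos_of_mem_Ioo hz0
    have hρ : ‖z‖ = z.im / Real.sin z.im := by
      rw [eq_div_iff hs.ne']
      exact h4.symm
    have hre : z.re = -(z.im * Real.cos z.im / Real.sin z.im) := by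
      rw [h3, hρ]
      ring
    refine ⟨hre, ?_⟩
    rw [← h2, Real.log_mul h1.ne' (Real.exp_ne_zero _), Real.log_exp, hρ,
      Real.log_div hz0.1.ne' hs.ne', hre]
    ring
  obtain ⟨h1, h2⟩ := key t ht ht0
  obtain ⟨h3, h4⟩ := key w hw hw0
  have him : t.im = w.im := strictMonoOn_logModulus.injOn ht0 hw0 (h2.trans h4.symm)
  refine Complex.ext ?_ him
  rw [h1, h3, him]

theorem exists_isSaddle_im_mem {μ : ℝ} (hμ : 1 / Real.exp 1 < μ) :
    ∃ t : ℂ, IsSaddle μ t ∧ t.im ∈ Set.Ioo 0 Real.pi := by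
  have hμ0 : 0 < μ := lt_trans (by positivity) hμ
  have hpi := Real.pi_gt_three
  -- The function used below takes the value `1/e` at `b = 0`. At `b = π - q` it is at least `μ`,
  -- because `μ sin q ≤ μq ≤ 1 ≤ π - q` and the exponential factor is at least `1`.
  set q : ℝ := 1 / (μ + 1) with hq
  have hq0 : 0 < q := by positivity
  have hq1 : q ≤ 1 := by
    rw [hq, div_le_one (by positivity)]
    linarith
  have hsinc : ∀ b : ℝ, 0 < b → b < Real.pi → 0 < Real.sinc b := by
    intro b hb hb'
    rw [Real.sinc_of_ne_zero hb.ne']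
    exact div_pos (Real.sin_pos_of_pos_of_lt_pi hb hb') hb
  have hsinc' : ∀ b ∈ Set.Icc 0 (Real.pi - q), 0 < Real.sinc b := by
    intro b hb
    rcases hb.1.eq_or_lt with h | h
    · rw [← h, Real.sinc_zero]
      exact one_pos
    · exact hsinc b h (by linarith [hb.2])
  have hcont : ContinuousOn (fun b => Real.exp (-Real.cos b / Real.sinc b) / Real.sinc b)
      (Set.Icc 0 (Real.pi - q)) := by
    have hc := Real.continuous_sinc.continuousOn (s := Set.Icc 0 (Real.pi - q))
    have hne : ∀ b ∈ Set.Icc 0 (Real.pi - q), Real.sinc b ≠ 0 := fun b hb => (hsinc' b hb).ne'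
    refine ContinuousOn.div ?_ hc hne
    exact (ContinuousOn.div (by fun_prop) hc hne).rexp
  have hleft : Real.exp (-Real.cos 0 / Real.sinc 0) / Real.sinc 0 = 1 / Real.exp 1 := by
    rw [Real.sinc_zero, Real.cos_zero, div_one, div_one, Real.exp_neg, one_div]
  have hright : μ ≤ Real.exp (-Real.cos (Real.pi - q) / Real.sinc (Real.pi - q)) /
      Real.sinc (Real.pi - q) := by
    have h1 := hsinc' (Real.pi - q) ⟨by linarith, le_rfl⟩
    have h2 : 0 ≤ Real.cos q := Real.cos_nonneg_of_mem_Icc ⟨by linarith, by linarith⟩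
    have h3 : 1 ≤ Real.exp (-Real.cos (Real.pi - q) / Real.sinc (Real.pi - q)) := by
      apply Real.one_le_exp
      rw [Real.cos_pi_sub, neg_neg]
      positivity
    rw [le_div_iff₀ h1]
    refine le_trans ?_ h3
    rw [Real.sinc_of_ne_zero (by linarith), Real.sin_pi_sub, ← mul_div_assoc,
      div_le_one (by linarith)]
    have h4 := Real.sin_le hq0.le
    have h5 : μ * q ≤ 1 := by
      rw [hq, ← mul_div_assoc, mul_one, div_le_one (by positivity)]
      linarith
    nlinarith
  obtain ⟨b, hb, hbμ⟩ := intermediate_value_Icc (by linarith : (0 : ℝ) ≤ Real.pi - q) hcont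
    (show μ ∈ Set.Icc _ _ from ⟨hleft.trans_le hμ.le, hright⟩)
  simp only at hbμ
  have hb0 : 0 < b := by
    refine lt_of_le_of_ne hb.1 fun h => ?_
    rw [← h, hleft] at hbμ
    exact hμ.ne hbμ
  have hbpi : b < Real.pi := by linarith [hb.2]
  refine ⟨⟨-Real.cos b / Real.sinc b, b⟩, ?_, hb0, hbpi⟩
  have hs := Real.sin_pos_of_pos_of_lt_pi hb0 hbpi
  rw [IsSaddle]
  set a := -Real.cos b / Real.sinc b with ha
  have hab : a * Real.sin b = -(b * Real.cos b) := by
    rw [ha, Real.sinc_of_ne_zero hb0.ne']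
    field_simp
  have hμ' : Real.exp a * b = μ * Real.sin b := by
    rw [← hbμ, Real.sinc_of_ne_zero hb0.ne']
    field_simp
  have hcs := Real.sin_sq_add_cos_sq b
  apply Complex.ext
  · rw [Complex.mul_re, Complex.exp_re, Complex.exp_im, Complex.neg_re, Complex.ofReal_re]
    apply mul_right_cancel₀ hs.ne'
    simp only
    linear_combination (Real.exp a * Real.cos b) * hab - hμ' - (Real.exp a * b) * hcs
  · rw [Complex.mul_im, Complex.exp_re, Complex.exp_im, Complex.neg_im, Complex.ofReal_im]
    simp only
    linear_combination (Real.exp a) * hab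

/-- The root in the strip `0 < Im < π` is smaller than those above `2π`. -/
theorem IsSaddle.norm_lt_of_two_pi_lt {μ : ℝ} (hμ : 0 < μ) {t w : ℂ} (ht : IsSaddle μ t)
    (hw : IsSaddle μ w) (ht0 : t.im ∈ Set.Ioo 0 Real.pi) (hw0 : 2 * Real.pi < w.im) :
    ‖t‖ < ‖w‖ := by
  have hpi := Real.pi_pos
  have hwn : w.im ≤ ‖w‖ := (le_abs_self _).trans (Complex.abs_im_le_norm w)
  -- For `Re t ≤ 0` the bound `‖t‖ ≤ π/2 < 2π` suffices. Otherwise `‖w‖ ≤ ‖t‖` would force `Re w ≥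
  -- Re t ≥ 0`, while `Im w > Im t`, contradicting the comparison of moduli.
  rcases le_total t.re 0 with hre | hre
  · have := ht.norm_le_of_re_nonpos hμ ht0.1 ht0.2 hre
    linarith
  · by_contra! hle
    obtain ⟨h1, h2, -, -⟩ := ht.polar hμ
    obtain ⟨h3, h4, -, -⟩ := hw.polar hμ
    have hexp : Real.exp t.re ≤ Real.exp w.re := by
      by_contra! hlt
      nlinarith [Real.exp_pos t.re, Real.exp_pos w.re]
    have hle' := Real.exp_le_exp.1 hexp
    have h5 := norm_sq_eq_re_im t
    have h6 := norm_sq_eq_re_im w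
    have h7 : ‖w‖ ^ 2 ≤ ‖t‖ ^ 2 := by gcongr
    have h8 := ht0.2
    have h9 := ht0.1
    nlinarith

theorem isSmallestSaddle_iff {μ : ℝ} (hμ : 1 / Real.exp 1 < μ) {t₀ : ℂ} (h₀ : IsSaddle μ t₀)
    (him : t₀.im ∈ Set.Ioo 0 Real.pi) (t : ℂ) :
    IsSmallestSaddle μ t ↔ t = t₀ ∨ t = (starRingEnd ℂ) t₀ := by
  have hμ0 : 0 < μ := lt_trans (by positivity) hμ
  have hup : ∀ w : ℂ, IsSaddle μ w → 0 < w.im → w = t₀ ∨ ‖t₀‖ < ‖w‖ := by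
    intro w hw hpos
    rcases hw.im_lt_pi_or hμ0 hpos with h | h
    · exact Or.inl (hw.eq_of_im_mem hμ0 h₀ ⟨hpos, h⟩ him)
    · exact Or.inr (h₀.norm_lt_of_two_pi_lt hμ0 hw him h)
  have hall : ∀ w : ℂ, IsSaddle μ w → (w = t₀ ∨ w = (starRingEnd ℂ) t₀) ∨ ‖t₀‖ < ‖w‖ := by
    intro w hw
    rcases lt_or_gt_of_ne (hw.im_ne_zero hμ) with h | h
    · rcases hup _ hw.conj (by rw [Complex.conj_im]; linarith) with h1 | h1
      · left
        right
        rw [← h1, Complex.conj_conj]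
      · right
        rwa [Complex.norm_conj] at h1
    · rcases hup w hw h with h1 | h1
      · exact Or.inl (Or.inl h1)
      · exact Or.inr h1
  have hmin : ∀ w : ℂ, IsSaddle μ w → ‖t₀‖ ≤ ‖w‖ := by
    intro w hw
    rcases hall w hw with (rfl | rfl) | h
    · exact le_rfl
    · rw [Complex.norm_conj]
    · exact h.le
  constructor
  · rintro ⟨ht, htmin⟩
    rcases hall t ht with h | h
    · exact h
    · exact absurd (htmin t₀ h₀) (not_le.2 h)
  · rintro (rfl | rfl)
    · exact ⟨h₀, hmin⟩
    · exact ⟨h₀.conj, fun w hw => by rw [Complex.norm_conj]; exact hmin w hw⟩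

theorem exists_smallestSaddle_pair {μ : ℝ} (hμ : 1 / Real.exp 1 < μ) :
    ∃ t₀ : ℂ, t₀.im ≠ 0 ∧
      ∀ t : ℂ, IsSmallestSaddle μ t ↔ t = t₀ ∨ t = (starRingEnd ℂ) t₀ := by
  obtain ⟨t₀, h₀, him⟩ := exists_isSaddle_im_mem hμ
  exact ⟨t₀, him.1.ne', isSmallestSaddle_iff hμ h₀ him⟩

end Roots

/-! ### Real roots -/

section RealRoots

theorem hasDerivAt_mul_exp (t : ℝ) :
    HasDerivAt (fun t : ℝ => t * Real.exp t) ((1 + t) * Real.exp t) t := by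
  refine ((hasDerivAt_id t).mul (Real.hasDerivAt_exp t)).congr_deriv ?_
  simp only [id]
  ring

theorem continuous_mul_exp : Continuous fun t : ℝ => t * Real.exp t := by fun_prop

theorem strictMonoOn_mul_exp : StrictMonoOn (fun t : ℝ => t * Real.exp t) (Set.Ici (-1)) := by
  refine strictMonoOn_of_deriv_pos (convex_Ici _) continuous_mul_exp.continuousOn fun t ht => ?_
  rw [interior_Ici, Set.mem_Ioi] at ht
  rw [(hasDerivAt_mul_exp t).deriv]
  exact mul_pos (by linarith) (Real.exp_pos t)

theorem strictAntiOn_mul_exp : StrictAntiOn (fun t : ℝ => t * Real.exp t) (Set.Iic (-1)) := by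
  refine strictAntiOn_of_deriv_neg (convex_Iic _) continuous_mul_exp.continuousOn fun t ht => ?_
  rw [interior_Iic, Set.mem_Iio] at ht
  rw [(hasDerivAt_mul_exp t).deriv]
  exact mul_neg_of_neg_of_pos (by linarith) (Real.exp_pos t)

theorem exists_real_roots {μ : ℝ} (hμ : 0 < μ) (hμ' : μ < 1 / Real.exp 1) :
    ∃ t₀ t₁ : ℝ, t₁ < -1 ∧ -1 < t₀ ∧ t₀ < 0 ∧
      (∀ t : ℝ, t * Real.exp t = -μ ↔ t = t₀ ∨ t = t₁) ∧
      ∀ t : ℝ, IsSmallestRealSaddle μ t ↔ t = t₀ := by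
  have hm1 : (-1 : ℝ) * Real.exp (-1) < -μ := by
    rw [Real.exp_neg, ← one_div]
    linarith
  obtain ⟨t₀, ht₀, h₀⟩ := intermediate_value_Icc (by norm_num : (-1 : ℝ) ≤ 0)
    continuous_mul_exp.continuousOn (show -μ ∈ Set.Icc _ _ from ⟨hm1.le, by simp [hμ.le]⟩)
  simp only at h₀
  -- Chosen so that `μs ≥ 2`; then `e^s ≥ s²/2` gives `s ≤ μe^s`, the sign needed for the
  -- intermediate value theorem at `-s`.
  set s : ℝ := 1 + 2 / μ with hs
  have hs1 : 1 < s := by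
    have : 0 < 2 / μ := by positivity
    linarith
  have hleft : -μ ≤ -s * Real.exp (-s) := by
    have h1 := Real.quadratic_le_exp_of_nonneg (x := s) (by linarith)
    have h2 : s * 2 ≤ μ * (s ^ 2) := by
      have : 2 ≤ μ * s := by
        rw [hs, mul_add, mul_div_cancel₀ _ hμ.ne']
        linarith
      nlinarith
    have h3 : s ≤ μ * Real.exp s := by nlinarith
    rw [Real.exp_neg, neg_mul, neg_le_neg_iff, ← div_eq_mul_inv, div_le_iff₀ (Real.exp_pos s)]
    exact h3
  obtain ⟨t₁, ht₁, h₁⟩ := intermediate_value_Icc' (by linarith : -s ≤ -1)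
    continuous_mul_exp.continuousOn (show -μ ∈ Set.Icc _ _ from ⟨hm1.le, hleft⟩)
  simp only at h₁
  have ht₁' : t₁ < -1 := lt_of_le_of_ne ht₁.2 fun h => by
    rw [h] at h₁
    linarith
  have ht₀' : -1 < t₀ := lt_of_le_of_ne ht₀.1 fun h => by
    rw [← h] at h₀
    linarith
  have ht₀'' : t₀ < 0 := lt_of_le_of_ne ht₀.2 fun h => by
    rw [h, zero_mul] at h₀
    linarith
  have hroots : ∀ t : ℝ, t * Real.exp t = -μ ↔ t = t₀ ∨ t = t₁ := by
    intro t
    constructor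
    · intro h
      rcases le_total t (-1) with hle | hle
      · right
        exact strictAntiOn_mul_exp.injOn hle ht₁'.le (h.trans h₁.symm)
      · left
        exact strictMonoOn_mul_exp.injOn hle ht₀'.le (h.trans h₀.symm)
    · rintro (rfl | rfl)
      · exact h₀
      · exact h₁
  have habs : |t₀| < |t₁| := by
    rw [abs_of_neg ht₀'', abs_of_neg (by linarith)]
    linarith
  refine ⟨t₀, t₁, ht₁', ht₀', ht₀'', hroots, fun t => ⟨?_, ?_⟩⟩
  · rintro ⟨h1, h2⟩
    rcases (hroots t).1 h1 with rfl | rfl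
    · rfl
    · exact absurd (h2 t₀ h₀) (not_le.2 habs)
  · rintro rfl
    refine ⟨h₀, fun w hw => ?_⟩
    rcases (hroots w).1 hw with rfl | rfl
    · exact le_rfl
    · exact habs.le

end RealRoots

/-! ### Moduli of the prefactors -/

theorem norm_cpow_half (z : ℂ) : ‖z ^ (1 / 2 : ℂ)‖ = √‖z‖ := by
  have h := Complex.norm_cpow_real z (1 / 2)
  rw [Real.sqrt_eq_rpow, ← h]
  norm_num

theorem div_re_eq (n : ℕ) (t : ℂ) : ((n : ℂ) / t).re = n * (t.re / ‖t‖ ^ 2) := by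
  rw [div_eq_mul_inv, ← Complex.ofReal_natCast, Complex.re_ofReal_mul, Complex.inv_re,
    Complex.sq_norm]

theorem norm_contourFactor {n : ℕ} (hn : n ≠ 0) (x : ℝ) (t : ℂ) :
    ‖contourFactor n x t‖ =
      Real.Gamma n * Real.exp (x + n * (t.re / ‖t‖ ^ 2)) / ‖t‖ ^ (n - 1) := by
  have hG : 0 < Real.Gamma n := Real.Gamma_pos_of_pos (by positivity)
  rw [contourFactor, norm_div, norm_mul, norm_pow, Complex.norm_real, Real.norm_of_nonneg hG.le,
    Complex.norm_exp, Complex.add_re, Complex.ofReal_re, div_re_eq]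

theorem saddleFactor_eq (n : ℕ) (x : ℝ) (t : ℂ) :
    saddleFactor n x t = contourFactor n x t / (2 * (Real.pi : ℂ) * (1 + t)) ^ (1 / 2 : ℂ) := by
  rw [saddleFactor, contourFactor, div_div, mul_comm (t ^ (n - 1))]

theorem norm_saddleFactor (n : ℕ) (x : ℝ) (t : ℂ) :
    ‖saddleFactor n x t‖ = ‖contourFactor n x t‖ / √(2 * Real.pi * ‖1 + t‖) := by
  rw [saddleFactor_eq, norm_div, norm_cpow_half, norm_mul, norm_mul, Complex.norm_real,
    Real.norm_of_nonneg Real.pi_pos.le]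
  norm_num

/-! ### Dominance of the smallest roots -/

section Dominance

variable {μ : ℝ} {t w : ℂ}

/-- The gap between the real parts of the root in the strip `0 < Im < π` and the roots above. -/
theorem IsSaddle.re_gap (hμ : 0 < μ) (ht : IsSaddle μ t) (hw : IsSaddle μ w)
    (ht0 : t.im ∈ Set.Ioo 0 Real.pi) (hw0 : 2 * Real.pi < w.im) :
    1 / (2 * ‖t‖ ^ 2) ≤ t.re - w.re ∧
      w.re / ‖w‖ ^ 2 - t.re / ‖t‖ ^ 2 ≤ 3 / 4 * (t.re - w.re) ∧
      Real.exp (t.re - w.re) = ‖w‖ / ‖t‖ := by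
  obtain ⟨h1, h2, -, -⟩ := ht.polar hμ
  obtain ⟨h3, h4, -, -⟩ := hw.polar hμ
  have hlt := ht.norm_lt_of_two_pi_lt hμ hw ht0 hw0
  have hone := ht.one_lt_norm hμ ht0.1
  have hexp : Real.exp (t.re - w.re) = ‖w‖ / ‖t‖ := by
    rw [Real.exp_sub, div_eq_div_iff (Real.exp_ne_zero _) h1.ne']
    linarith
  have hd : t.re - w.re = Real.log (‖w‖ / ‖t‖) := by rw [← hexp, Real.log_exp]
  have hdlow : (‖w‖ - ‖t‖) / ‖w‖ ≤ t.re - w.re := by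
    have := Real.one_sub_inv_le_log_of_pos (div_pos h3 h1)
    rw [← hd, inv_div] at this
    rwa [sub_div, div_self h3.ne']
  have hd0 : 0 < t.re - w.re := lt_of_lt_of_le (div_pos (by linarith) h3) hdlow
  have h5 := norm_sq_eq_re_im t
  have h6 := norm_sq_eq_re_im w
  have hpi := Real.pi_gt_three
  have hre : t.re ≤ ‖t‖ := Complex.re_le_norm t
  have hwn : w.im ≤ ‖w‖ := (le_abs_self _).trans (Complex.abs_im_le_norm w)
  refine ⟨?_, ?_, hexp⟩
  · rw [div_le_iff₀ (by positivity)]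
    -- If `‖w‖ ≥ 2‖t‖` the gap is at least `1/2`. Otherwise `‖w‖² - ‖t‖²` is at most `6‖t‖²` times
    -- the gap, while the imaginary parts contribute at least `3π² > 27` to it.
    rcases le_total (2 * ‖t‖) ‖w‖ with h | h
    · have h7 : 1 / 2 ≤ (‖w‖ - ‖t‖) / ‖w‖ := by
        rw [le_div_iff₀ h3]
        linarith
      nlinarith
    · have h7 : ‖w‖ - ‖t‖ ≤ (t.re - w.re) * (2 * ‖t‖) := by
        rw [div_le_iff₀ h3] at hdlow
        exact hdlow.trans (by gcongr)
      have h8 : ‖w‖ ^ 2 - ‖t‖ ^ 2 ≤ 6 * (t.re - w.re) * ‖t‖ ^ 2 := by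
        have : ‖w‖ ^ 2 - ‖t‖ ^ 2 = (‖w‖ - ‖t‖) * (‖w‖ + ‖t‖) := by ring
        rw [this]
        calc _ ≤ ((t.re - w.re) * (2 * ‖t‖)) * (3 * ‖t‖) := by
              gcongr
              linarith
          _ = _ := by ring
      have h9 : 27 ≤ w.im ^ 2 - t.im ^ 2 := by nlinarith [ht0.1, ht0.2]
      have h10 : w.re ^ 2 - t.re ^ 2 ≥ -(2 * ‖t‖ ^ 2 * (t.re - w.re)) := by
        have : w.re ^ 2 - t.re ^ 2 = (t.re - w.re) ^ 2 - 2 * t.re * (t.re - w.re) := by ring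
        have h11 : t.re * (t.re - w.re) ≤ ‖t‖ ^ 2 * (t.re - w.re) := by
          gcongr
          nlinarith
        nlinarith [sq_nonneg (t.re - w.re)]
      nlinarith
  -- For `Re t ≤ 0` the left side is at most `1`, while `‖w‖ ≥ 4‖t‖` makes the gap at least `2 log 2
  -- > 4/3`.
  · rcases le_total 0 t.re with hre0 | hre0
    · have h7 : w.re / ‖w‖ ^ 2 ≤ t.re / ‖t‖ ^ 2 := by
        rw [div_le_div_iff₀ (by positivity) (by positivity)]
        calc w.re * ‖t‖ ^ 2 ≤ t.re * ‖t‖ ^ 2 :=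
              mul_le_mul_of_nonneg_right (by linarith) (by positivity)
          _ ≤ t.re * ‖w‖ ^ 2 := by gcongr
      linarith
    · have h7 : w.re / ‖w‖ ^ 2 ≤ 0 := div_nonpos_of_nonpos_of_nonneg (by linarith) (by positivity)
      have h8 := ht.one_add_re_pos hμ ht0.1 ht0.2
      have h9 : -(t.re / ‖t‖ ^ 2) ≤ 1 := by
        rw [← neg_div, div_le_one (by positivity)]
        nlinarith
      have h10 := ht.norm_le_of_re_nonpos hμ ht0.1 ht0.2 hre0
      have h11 : 2 * Real.log 2 ≤ t.re - w.re := by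
        have : 2 * Real.log 2 = Real.log (2 * 2) := by
          rw [Real.log_mul two_ne_zero two_ne_zero]
          ring
        rw [hd, this]
        apply Real.log_le_log (by norm_num)
        rw [le_div_iff₀ h1]
        linarith
      linarith [Real.log_two_gt_d9]

/-- With `d = Re t - Re w`, the powers gain `e^{-(n-1)d}` and the exponentials lose at most
`e^{3nd/4}`. For `n ≥ 8` this leaves `e^{-nd/8}`, and `d ≥ 1/(2‖t‖²)` gives the `1/16`. The factor
`2` comes from `‖1+t‖ ≤ 4‖1+w‖`. -/
theorem norm_saddleFactor_le_of_upper {n : ℕ} (hn : 8 ≤ n) {x : ℝ}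
    (hμ : 0 < μ) (ht : IsSaddle μ t) (hw : IsSaddle μ w)
    (ht0 : t.im ∈ Set.Ioo 0 Real.pi) (hw0 : 2 * Real.pi < w.im) :
    ‖saddleFactor n x w‖ ≤
      2 * Real.exp (-(1 / 16) * n / ‖t‖ ^ 2) * ‖saddleFactor n x t‖ := by
  obtain ⟨hg1, hg2, hg3⟩ := ht.re_gap hμ hw ht0 hw0
  obtain ⟨h1, -, -, -⟩ := ht.polar hμ
  obtain ⟨h3, -, -, -⟩ := hw.polar hμ
  have hn0 : n ≠ 0 := by omega
  have hlt := ht.norm_lt_of_two_pi_lt hμ hw ht0 hw0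
  have hone := ht.one_lt_norm hμ ht0.1
  have hpi := Real.pi_gt_three
  have hwn : w.im ≤ ‖w‖ := (le_abs_self _).trans (Complex.abs_im_le_norm w)
  have hG : 0 < Real.Gamma n := Real.Gamma_pos_of_pos (by positivity)
  set d := t.re - w.re with hd
  have ht1 : 0 < ‖1 + t‖ := by
    refine norm_pos_iff.2 fun h => ?_
    have := congrArg Complex.im h
    simp at this
    exact ht0.1.ne' this
  have hw1 : ‖1 + t‖ ≤ 4 * ‖1 + w‖ := by
    have h5 : ‖1 + t‖ ≤ 1 + ‖t‖ := by simpa using norm_add_le (1 : ℂ) t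
    have h6 : ‖w‖ ≤ ‖1 + w‖ + 1 := by
      have := norm_sub_le (1 + w) 1
      simpa using this
    linarith
  have hw1' : 0 < ‖1 + w‖ := by linarith
  have hsqrt : √(2 * Real.pi * ‖1 + t‖) ≤ 2 * √(2 * Real.pi * ‖1 + w‖) := by
    have h4 : (2 : ℝ) = √4 := by
      rw [show (4 : ℝ) = 2 ^ 2 by norm_num, Real.sqrt_sq (by norm_num)]
    rw [show 2 * √(2 * Real.pi * ‖1 + w‖) = √4 * √(2 * Real.pi * ‖1 + w‖) by rw [← h4],
      ← Real.sqrt_mul (by norm_num)]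
    apply Real.sqrt_le_sqrt
    nlinarith
  have hpow : Real.exp (((n - 1 : ℕ) : ℝ) * d) * ‖t‖ ^ (n - 1) = ‖w‖ ^ (n - 1) := by
    rw [Real.exp_nat_mul, hg3, ← mul_pow, div_mul_cancel₀ _ h1.ne']
  have hd0 : 0 < d := lt_of_lt_of_le (by positivity) hg1
  have hn8 : (8 : ℝ) ≤ n := by exact_mod_cast hn
  have hn1 : ((n - 1 : ℕ) : ℝ) = n - 1 := by
    rw [Nat.cast_sub (by omega), Nat.cast_one]
  have hexp : Real.exp (x + n * (w.re / ‖w‖ ^ 2)) ≤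
      Real.exp (-(1 / 16) * n / ‖t‖ ^ 2) * Real.exp (x + n * (t.re / ‖t‖ ^ 2)) *
        Real.exp (((n - 1 : ℕ) : ℝ) * d) := by
    rw [← Real.exp_add, ← Real.exp_add, hn1]
    apply Real.exp_le_exp.2
    have e1 : (n : ℝ) * (w.re / ‖w‖ ^ 2 - t.re / ‖t‖ ^ 2) ≤ n * (3 / 4 * d) := by gcongr
    have e2 : (n : ℝ) / 8 * (1 / (2 * ‖t‖ ^ 2)) ≤ n / 8 * d := by gcongr
    have e3 : (n : ℝ) / 8 * (1 / (2 * ‖t‖ ^ 2)) = 1 / 16 * n / ‖t‖ ^ 2 := by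
      field_simp
      norm_num
    have e4 : -(1 / 16) * (n : ℝ) / ‖t‖ ^ 2 = -(1 / 16 * n / ‖t‖ ^ 2) := by ring
    rw [e4]
    nlinarith
  rw [norm_saddleFactor, norm_saddleFactor, norm_contourFactor hn0, norm_contourFactor hn0,
    div_div, div_div, ← mul_div_assoc (2 * _), div_le_div_iff₀ (by positivity) (by positivity), ← hpow]
  calc _ ≤ Real.Gamma n * (Real.exp (-(1 / 16) * n / ‖t‖ ^ 2) *
        Real.exp (x + n * (t.re / ‖t‖ ^ 2)) * Real.exp (((n - 1 : ℕ) : ℝ) * d)) *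
        (‖t‖ ^ (n - 1) * (2 * √(2 * Real.pi * ‖1 + w‖))) := by gcongr
    _ = _ := by ring

/-- For non-real `t` the principal square root is taken off its cut, where it commutes with
conjugation. -/
theorem saddleFactor_conj (n : ℕ) (x : ℝ) (ht : t.im ≠ 0) :
    saddleFactor n x ((starRingEnd ℂ) t) = (starRingEnd ℂ) (saddleFactor n x t) := by
  have harg : (2 * (Real.pi : ℂ) * (1 + t)).arg ≠ Real.pi := by
    intro h
    rw [Complex.arg_eq_pi_iff] at h
    have h2 := h.2
    have h3 : (2 * (Real.pi : ℂ) * (1 + t)).im = 2 * Real.pi * t.im := by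
      rw [show 2 * (Real.pi : ℂ) = ((2 * Real.pi : ℝ) : ℂ) by push_cast; ring,
        Complex.im_ofReal_mul]
      simp
    rw [h3] at h2
    have := Real.pi_pos.ne'
    simp_all
  rw [saddleFactor, saddleFactor]
  simp only [map_div₀, map_mul, map_pow, ← Complex.exp_conj, map_add, map_natCast,
    Complex.conj_ofReal]
  congr 2
  have h := Complex.conj_cpow (2 * (Real.pi : ℂ) * (1 + t)) (1 / 2) harg
  simp only [map_div₀, map_mul, map_add, map_one, map_ofNat, Complex.conj_ofReal] at h
  rw [h]

theorem norm_saddleFactor_le_of_ne {n : ℕ} (hn : 8 ≤ n) {x : ℝ} (hμ : 1 / Real.exp 1 < μ)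
    (ht : IsSmallestSaddle μ t) (hw : IsSaddle μ w) (h1 : w ≠ t) (h2 : w ≠ (starRingEnd ℂ) t) :
    ‖saddleFactor n x w‖ ≤
      2 * Real.exp (-(1 / 16) * n / ‖t‖ ^ 2) * ‖saddleFactor n x t‖ := by
  have hμ0 : 0 < μ := lt_trans (by positivity) hμ
  obtain ⟨t', ht', him⟩ := exists_isSaddle_im_mem hμ
  have hsm := isSmallestSaddle_iff hμ ht' him
  have hconj : ∀ z : ℂ, z.im ≠ 0 → ‖saddleFactor n x ((starRingEnd ℂ) z)‖ =
      ‖saddleFactor n x z‖ := fun z hz => by rw [saddleFactor_conj n x hz, Complex.norm_conj]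
  have hnorm : ‖t‖ = ‖t'‖ ∧ ‖saddleFactor n x t‖ = ‖saddleFactor n x t'‖ ∧ w ≠ t' ∧
      w ≠ (starRingEnd ℂ) t' := by
    rcases (hsm t).1 ht with rfl | rfl
    · exact ⟨rfl, rfl, h1, h2⟩
    · rw [Complex.conj_conj] at h2
      exact ⟨Complex.norm_conj _, hconj _ him.1.ne', h2, h1⟩
  obtain ⟨e1, e2, e3, e4⟩ := hnorm
  rw [e1, e2]
  have hup : ∀ z : ℂ, IsSaddle μ z → 0 < z.im → z ≠ t' → 2 * Real.pi < z.im := by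
    intro z hz hpos hne
    rcases hz.im_lt_pi_or hμ0 hpos with h | h
    · exact absurd (hz.eq_of_im_mem hμ0 ht' ⟨hpos, h⟩ him) hne
    · exact h
  rcases lt_or_gt_of_ne (hw.im_ne_zero hμ) with h | h
  · rw [← hconj w h.ne]
    refine norm_saddleFactor_le_of_upper hn hμ0 ht' hw.conj him
      (hup _ hw.conj (by rw [Complex.conj_im]; linarith) fun h5 => e4 ?_)
    rw [← h5, Complex.conj_conj]
  · exact norm_saddleFactor_le_of_upper hn hμ0 ht' hw him (hup w hw h e3)

end Dominance

/-! ### Size and position of the root in the strip -/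

section Bounds

variable {μ : ℝ} {t : ℂ}

/-- The difference vanishes at `0` and has derivative `(b/3)(sin b - b cos b) ≥ 0`. -/
theorem sq_mul_sin_le {b : ℝ} (hb : b ∈ Set.Icc 0 Real.pi) :
    b ^ 2 / 3 * Real.sin b ≤ Real.sin b - b * Real.cos b := by
  have hd : ∀ b : ℝ, HasDerivAt (fun b => Real.sin b - b * Real.cos b - b ^ 2 / 3 * Real.sin b)
      (b / 3 * (Real.sin b - b * Real.cos b)) b := by
    intro b
    have h := ((Real.hasDerivAt_sin b).sub ((hasDerivAt_id b).mul (Real.hasDerivAt_cos b))).sub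
      (((hasDerivAt_pow 2 b).div_const 3).mul (Real.hasDerivAt_sin b))
    refine h.congr_deriv ?_
    simp only [id]
    push_cast
    ring
  have hmono : MonotoneOn (fun b => Real.sin b - b * Real.cos b - b ^ 2 / 3 * Real.sin b)
      (Set.Icc 0 Real.pi) := by
    refine monotoneOn_of_deriv_nonneg (convex_Icc _ _)
      (fun b _ => (hd b).continuousAt.continuousWithinAt)
      (fun b _ => (hd b).differentiableAt.differentiableWithinAt) fun b hb => ?_
    rw [interior_Icc] at hb
    rw [(hd b).deriv]
    have := mul_cos_lt_sin hb.1 hb.2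
    have hb0 := hb.1
    exact mul_nonneg (by positivity) (by linarith)
  have := hmono ⟨le_rfl, Real.pi_pos.le⟩ hb hb.1
  simp at this
  linarith

/-- `sq_mul_sin_le` gives `(Im t)² ≤ 3(1 + Re t)`; add `(Re t)²` and use `Re t > -1`. -/
theorem IsSaddle.norm_le_two_add_re (hμ : 0 < μ) (h : IsSaddle μ t)
    (h0 : t.im ∈ Set.Ioo 0 Real.pi) : ‖t‖ ≤ 2 + t.re := by
  obtain ⟨h1, -, h2, h3⟩ := h.polar hμ
  have hs := h.one_add_re_pos hμ h0.1 h0.2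
  have h4 := sq_mul_sin_le ⟨h0.1.le, h0.2.le⟩
  have h5 : t.im * (1 + t.re) = ‖t‖ * (Real.sin t.im - t.im * Real.cos t.im) := by
    linear_combination h3 + t.im * h2
  have h6 : t.im * (t.im ^ 2 / 3) ≤ t.im * (1 + t.re) := by
    rw [h5]
    calc t.im * (t.im ^ 2 / 3) = ‖t‖ * (t.im ^ 2 / 3 * Real.sin t.im) := by
          nth_rewrite 1 [h3]
          ring
      _ ≤ _ := by gcongr
  have h7 : t.im ^ 2 / 3 ≤ 1 + t.re := le_of_mul_le_mul_left h6 h0.1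
  have h8 := norm_sq_eq_re_im t
  refine le_of_sq_le_sq ?_ (by linarith)
  rw [h8]
  nlinarith

/-- Follows from `log μ = log‖t‖ + Re t`. It keeps `1 + Re t` away from zero when `μ` stays above
`1/e + δ`. -/
theorem IsSaddle.one_add_log_le (hμ : 0 < μ) (h : IsSaddle μ t)
    (h0 : t.im ∈ Set.Ioo 0 Real.pi) : 1 + Real.log μ ≤ 2 * (1 + t.re) := by
  obtain ⟨h1, h2, -, -⟩ := h.polar hμ
  have h3 := h.norm_le_two_add_re hμ h0
  rw [← h2, Real.log_mul h1.ne' (Real.exp_ne_zero _), Real.log_exp]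
  have h4 := Real.log_le_sub_one_of_pos h1
  linarith

theorem IsSaddle.norm_le_two_add_log (hμ : 0 < μ) (h : IsSaddle μ t)
    (h0 : t.im ∈ Set.Ioo 0 Real.pi) : ‖t‖ ≤ 2 + Real.log μ := by
  obtain ⟨h1, h2, -, -⟩ := h.polar hμ
  have h3 := h.norm_le_two_add_re hμ h0
  have h4 := Real.log_nonneg (h.one_lt_norm hμ h0.1).le
  rw [← h2, Real.log_mul h1.ne' (Real.exp_ne_zero _), Real.log_exp]
  linarith

/-- Keeps the root off the real axis once `1 + Re t` is bounded below, so that the local arc fits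
inside the upper half circle. -/
theorem IsSaddle.one_add_re_le_sq (hμ : 0 < μ) (h : IsSaddle μ t) (h0 : 0 < t.im)
    (hlt : t.im < 1) : 1 + t.re ≤ t.im ^ 2 := by
  obtain ⟨h1, -, h2, h3⟩ := h.polar hμ
  have h4 : Real.sin t.im - t.im * Real.cos t.im ≤ t.im ^ 2 * Real.sin t.im := by
    have hs := Real.sin_le h0.le
    have hc := Real.one_sub_sq_div_two_le_cos (x := t.im)
    have e1 : (1 - t.im ^ 2) * Real.sin t.im ≤ (1 - t.im ^ 2) * t.im := by
      gcongr
      nlinarith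
    nlinarith
  have h5 : t.im * (1 + t.re) = ‖t‖ * (Real.sin t.im - t.im * Real.cos t.im) := by
    linear_combination h3 + t.im * h2
  have h6 : t.im * (1 + t.re) ≤ t.im * t.im ^ 2 := by
    rw [h5]
    calc _ ≤ ‖t‖ * (t.im ^ 2 * Real.sin t.im) := by gcongr
      _ = t.im * t.im ^ 2 := by
          nth_rewrite 3 [h3]
          ring
  exact le_of_mul_le_mul_left h6 h0

end Bounds

/-! ### Behaviour of the phase along the circle -/

/-- `Re (-e^t)` on the circle `t = ρ e^{iθ}`. -/
def circlePhase (ρ θ : ℝ) : ℝ :=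
  -(Real.exp (ρ * Real.cos θ) * Real.cos (ρ * Real.sin θ))

theorem hasDerivAt_circlePhase (ρ θ : ℝ) : HasDerivAt (circlePhase ρ)
    (ρ * Real.exp (ρ * Real.cos θ) * Real.sin (θ + ρ * Real.sin θ)) θ := by
  have h1 := (((Real.hasDerivAt_cos θ).const_mul ρ).exp.mul
    ((Real.hasDerivAt_sin θ).const_mul ρ).cos).neg
  refine h1.congr_deriv ?_
  rw [Real.sin_add]
  ring

theorem continuous_circlePhase (ρ : ℝ) : Continuous (circlePhase ρ) :=
  continuous_iff_continuousAt.2 fun θ => (hasDerivAt_circlePhase ρ θ).continuousAt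

/-- Since `cos` decreases, `1 + ρ cos θ ≥ 0` up to `θ₀`. Hence `θ + ρ sin θ` increases to `π` and
its sine is nonnegative. -/
theorem monotoneOn_circlePhase {ρ θ₀ : ℝ} (hρ : 0 < ρ) (h0 : 0 ≤ θ₀) (hpi : θ₀ ≤ Real.pi)
    (hcos : 0 ≤ 1 + ρ * Real.cos θ₀) (hg : θ₀ + ρ * Real.sin θ₀ = Real.pi) :
    MonotoneOn (circlePhase ρ) (Set.Icc 0 θ₀) := by
  have hd : ∀ θ : ℝ, HasDerivAt (fun θ => θ + ρ * Real.sin θ) (1 + ρ * Real.cos θ) θ :=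
    fun θ => (hasDerivAt_id θ).add ((Real.hasDerivAt_sin θ).const_mul ρ)
  have hmono : MonotoneOn (fun θ => θ + ρ * Real.sin θ) (Set.Icc 0 θ₀) := by
    refine monotoneOn_of_deriv_nonneg (convex_Icc _ _)
      (fun b _ => (hd b).continuousAt.continuousWithinAt)
      (fun b _ => (hd b).differentiableAt.differentiableWithinAt) fun b hb => ?_
    rw [interior_Icc] at hb
    rw [(hd b).deriv]
    have := Real.cos_le_cos_of_nonneg_of_le_pi hb.1.le hpi hb.2.le
    nlinarith
  refine monotoneOn_of_deriv_nonneg (convex_Icc _ _) (continuous_circlePhase ρ).continuousOn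
    (fun b _ => (hasDerivAt_circlePhase ρ b).differentiableAt.differentiableWithinAt) fun b hb => ?_
  rw [interior_Icc] at hb
  rw [(hasDerivAt_circlePhase ρ b).deriv]
  have h1 : 0 ≤ Real.sin b := Real.sin_nonneg_of_nonneg_of_le_pi hb.1.le (hb.2.le.trans hpi)
  have h2 := hmono ⟨hb.1.le, hb.2.le⟩ ⟨h0, le_rfl⟩ hb.2.le
  simp only [hg] at h2
  have h3 : 0 ≤ Real.sin (b + ρ * Real.sin b) :=
    Real.sin_nonneg_of_nonneg_of_le_pi (add_nonneg hb.1.le (by positivity)) h2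
  positivity

/-- Concavity: the value is `π` at both `θ₀` and `π`. -/
theorem pi_le_add_mul_sin {ρ θ₀ θ : ℝ} (hρ : 0 < ρ) (h0 : 0 ≤ θ₀)
    (hg : θ₀ + ρ * Real.sin θ₀ = Real.pi) (hθ : θ ∈ Set.Icc θ₀ Real.pi) :
    Real.pi ≤ θ + ρ * Real.sin θ := by
  have hconc : ConcaveOn ℝ (Set.Icc 0 Real.pi) (fun θ => θ + ρ * Real.sin θ) :=
    (concaveOn_id (convex_Icc _ _)).add (strictConcaveOn_sin_Icc.concaveOn.smul hρ.le)
  have hle : θ₀ ≤ Real.pi := hθ.1.trans hθ.2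
  have := hconc.min_le_of_mem_Icc (x := θ₀) (y := Real.pi) ⟨h0, hle⟩ ⟨Real.pi_pos.le, le_rfl⟩ hθ
  simpa [hg] using this

theorem antitoneOn_circlePhase {ρ θ₀ θ₁ : ℝ} (hρ : 0 < ρ) (h0 : 0 ≤ θ₀) (h1 : θ₁ ≤ Real.pi)
    (hg : θ₀ + ρ * Real.sin θ₀ = Real.pi)
    (hle : ∀ θ ∈ Set.Icc θ₀ θ₁, θ + ρ * Real.sin θ ≤ 2 * Real.pi) :
    AntitoneOn (circlePhase ρ) (Set.Icc θ₀ θ₁) := by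
  refine antitoneOn_of_deriv_nonpos (convex_Icc _ _) (continuous_circlePhase ρ).continuousOn
    (fun b _ => (hasDerivAt_circlePhase ρ b).differentiableAt.differentiableWithinAt) fun b hb => ?_
  have hb' := interior_subset hb
  rw [(hasDerivAt_circlePhase ρ b).deriv]
  have h2 := pi_le_add_mul_sin hρ h0 hg ⟨hb'.1, hb'.2.trans h1⟩
  have h3 := hle b hb'
  have h4 : Real.sin (b + ρ * Real.sin b) ≤ 0 := by
    have := Real.sin_nonneg_of_nonneg_of_le_pi (x := b + ρ * Real.sin b - Real.pi)
      (by linarith) (by linarith)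
    rw [Real.sin_sub_pi] at this
    linarith
  exact mul_nonpos_of_nonneg_of_nonpos (by positivity) h4

/-- Beyond the saddle, either `circlePhase` is still decreasing or it is small. -/
theorem circlePhase_large_angle {ρ θ₀ θ : ℝ} (hρ : 0 < ρ) (h0 : 0 < θ₀) (hpi : θ₀ < Real.pi)
    (hρ' : ρ * Real.cos θ₀ ≤ 0 → ρ ≤ Real.pi / 2)
    (hg : θ₀ + ρ * Real.sin θ₀ = Real.pi) (hθ : θ ∈ Set.Icc θ₀ Real.pi) :
    (∀ θ' ∈ Set.Icc θ₀ θ, θ' + ρ * Real.sin θ' ≤ 2 * Real.pi) ∨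
      circlePhase ρ θ ≤ Real.exp (ρ * Real.cos θ₀) * (Real.cos θ₀ - 1 / (8 * ρ ^ 2)) := by
  have hpi3 := Real.pi_gt_three
  rcases le_or_gt ρ Real.pi with hρpi | hρpi
  · left
    intro θ' hθ'
    have := Real.sin_le_one θ'
    have : θ' ≤ Real.pi := hθ'.2.trans hθ.2
    nlinarith
  have hcpos : 0 < Real.cos θ₀ := by
    by_contra! hneg
    have := hρ' (mul_nonpos_of_nonneg_of_nonpos hρ.le hneg)
    linarith
  have hθ2 : θ₀ < Real.pi / 2 := by
    by_contra! hge
    have := Real.cos_nonpos_of_pi_div_two_le_of_le hge (by linarith)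
    linarith
  have hs0 : 0 < Real.sin θ₀ := Real.sin_pos_of_pos_of_lt_pi h0 hpi
  have hθ3 : θ₀ < Real.pi / 3 := by
    by_contra! hge
    have h1 := Real.mul_le_sin h0.le hθ2.le
    have h2 : 2 / Real.pi * θ₀ * Real.pi = 2 * θ₀ := by field_simp
    nlinarith
  have hc2 : 1 / 2 < Real.cos θ₀ := by
    rw [← Real.cos_pi_div_three]
    exact Real.cos_lt_cos_of_nonneg_of_le_pi h0.le (by linarith) hθ3
  have hc1 := Real.cos_le_one θ₀
  set c := Real.cos θ₀ with hc
  set b := ρ * Real.sin θ₀ with hb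
  have hb2 : 2 < b := by linarith
  have hρ2 : 1 / ρ ^ 2 ≤ 1 := by
    rw [div_le_one (by positivity)]
    nlinarith
  have hρ2' : 0 < 1 / ρ ^ 2 := by positivity
  set κ := 1 / ρ ^ 2 with hκ
  -- If `ρ cos` drops by this much, `e^{-u} ≤ 1/(1+u)` turns `c` into at most `c/(1+κc) ≤ c - κ/8`.
  -- If it drops by less, `(ρ sin θ')²` exceeds `b²` by at most `2bθ₀`, so it stays below `(θ₀+b)² =
  -- π²`.
  rcases le_or_gt ((1 - c) / c + κ) (ρ * c - ρ * Real.cos θ) with hbig | hsmall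
  · right
    have h1 : circlePhase ρ θ ≤ Real.exp (ρ * Real.cos θ) := by
      rw [circlePhase]
      have := Real.neg_one_le_cos (ρ * Real.sin θ)
      have := Real.exp_pos (ρ * Real.cos θ)
      nlinarith
    have h2 : Real.exp (ρ * Real.cos θ) ≤ Real.exp (ρ * c) * (c / (1 + κ * c)) := by
      have h3 := Real.add_one_le_exp ((1 - c) / c + κ)
      have h4 : (1 - c) / c + κ + 1 = (1 + κ * c) / c := by
        field_simp
        ring
      rw [h4] at h3
      have h5 : Real.exp (ρ * Real.cos θ) * Real.exp ((1 - c) / c + κ) ≤ Real.exp (ρ * c) := by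
        rw [← Real.exp_add]
        apply Real.exp_le_exp.2
        linarith
      rw [← mul_div_assoc, le_div_iff₀ (by positivity)]
      have h6 : Real.exp (ρ * Real.cos θ) * ((1 + κ * c) / c) ≤ Real.exp (ρ * c) :=
        (mul_le_mul_of_nonneg_left h3 (Real.exp_pos _).le).trans h5
      rwa [← mul_div_assoc, div_le_iff₀ hcpos] at h6
    have h3 : c / (1 + κ * c) ≤ c - 1 / (8 * ρ ^ 2) := by
      have h4 : 1 / (8 * ρ ^ 2) = κ / 8 := by
        rw [hκ]
        field_simp
      rw [h4, div_le_iff₀ (by positivity)]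
      nlinarith [mul_pos hρ2' hcpos]
    exact h1.trans (h2.trans (by gcongr))
  · left
    intro θ' hθ'
    have hθ'pi : θ' ≤ Real.pi := hθ'.2.trans hθ.2
    have hs' : 0 ≤ Real.sin θ' :=
      Real.sin_nonneg_of_nonneg_of_le_pi (h0.le.trans hθ'.1) hθ'pi
    have hp1 : ρ * Real.cos θ ≤ ρ * Real.cos θ' := by
      have := Real.cos_le_cos_of_nonneg_of_le_pi (h0.le.trans hθ'.1) hθ.2 hθ'.2
      gcongr
    have hp2 : ρ * Real.cos θ' ≤ ρ * c := by
      have := Real.cos_le_cos_of_nonneg_of_le_pi h0.le hθ'pi hθ'.1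
      gcongr
    have e1 : (ρ * Real.sin θ') ^ 2 - b ^ 2 =
        (ρ * c - ρ * Real.cos θ') * (ρ * c + ρ * Real.cos θ') := by
      have h1 := Real.sin_sq_add_cos_sq θ'
      have h2 := Real.sin_sq_add_cos_sq θ₀
      rw [hb, hc]
      linear_combination ρ ^ 2 * (h1 - h2)
    have e2 : (ρ * c - ρ * Real.cos θ') * (ρ * c + ρ * Real.cos θ') ≤
        ((1 - c) / c + κ) * (2 * (ρ * c)) := by
      have h1 : 0 < ρ * c := by positivity
      calc _ ≤ (ρ * c - ρ * Real.cos θ') * (2 * (ρ * c)) := by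
            apply mul_le_mul_of_nonneg_left _ (by linarith)
            linarith
        _ ≤ _ := by
            apply mul_le_mul_of_nonneg_right _ (by linarith)
            linarith
    have e3 : ((1 - c) / c + κ) * (2 * (ρ * c)) = 2 * ρ * (1 - c) + 2 * c / ρ := by
      rw [hκ]
      field_simp
    have e4 : 2 * ρ * (1 - c) ≤ 4 / 3 * b * θ₀ := by
      have h1 : (1 - c) * (1 + c) = Real.sin θ₀ ^ 2 := by
        rw [hc, Real.sin_sq]
        ring
      have h2 : 1 - c ≤ 2 / 3 * Real.sin θ₀ ^ 2 := by nlinarith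
      have h3 := Real.sin_le h0.le
      calc 2 * ρ * (1 - c) ≤ 2 * ρ * (2 / 3 * Real.sin θ₀ ^ 2) := by gcongr
        _ = 4 / 3 * b * Real.sin θ₀ := by
            rw [hb]
            ring
        _ ≤ _ := by gcongr
    have e5 : 2 * c / ρ ≤ 2 / 3 * b * θ₀ := by
      have h1 : b ≤ ρ * θ₀ := by
        have := Real.sin_le h0.le
        rw [hb]
        gcongr
      rw [div_le_iff₀ hρ]
      nlinarith
    have e6 : (ρ * Real.sin θ') ^ 2 ≤ Real.pi ^ 2 := by
      have : Real.pi = θ₀ + b := hg.symm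
      rw [this]
      nlinarith
    have e7 : ρ * Real.sin θ' ≤ Real.pi := by
      refine le_of_sq_le_sq e6 Real.pi_pos.le
    linarith

/-! ### Identifying the coefficients -/

section Coefficients

theorem iteratedDeriv_phaseDeriv (μ : ℝ) {t₀ : ℂ} (ht0 : t₀ ≠ 0) (m : ℕ) :
    iteratedDeriv m (phaseDeriv μ) t₀ =
      -Complex.exp t₀ / μ - (-1) ^ m * (m ! : ℂ) * (t₀ ^ (m + 1))⁻¹ := by
  have h1 : phaseDeriv μ = (fun t : ℂ => (-1 / (μ : ℂ)) * Complex.exp (1 * t)) - Inv.inv := by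
    funext t
    simp only [phaseDeriv, Pi.sub_apply, one_mul, one_div]
    ring
  rw [h1, iteratedDeriv_sub (by fun_prop) (contDiffAt_inv ℂ ht0), iteratedDeriv_const_mul_field,
    iteratedDeriv_cexp_const_mul, iteratedDeriv_eq_iterate, iter_deriv_inv]
  have h2 : (-1 - m : ℤ) = -((m + 1 : ℕ) : ℤ) := by
    push_cast
    ring
  rw [h2, zpow_neg, zpow_natCast]
  simp only [one_pow, one_mul]
  ring

/-- Up to a constant, `ψ` is the rescaled phase divided by `σ`, with `y = (σ/t₀)(t - t₀)`. -/
theorem phaseCoeff_eq_scaledCoeff {μ : ℝ} (hμ : μ ≠ 0) {t₀ : ℂ} (h : IsSaddle μ t₀) {σ : ℝ}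
    (hσ : σ ≠ 0) (r : ℕ) :
    phaseCoeff μ t₀ r =
      ((σ : ℂ)⁻¹ * (σ / t₀) ^ 2) * (σ / t₀ : ℂ) ^ r * scaledCoeff t₀ σ r := by
  have ht0 := h.ne_zero hμ
  have hμ' : (μ : ℂ) ≠ 0 := by exact_mod_cast hμ
  have hσ' : (σ : ℂ) ≠ 0 := by exact_mod_cast hσ
  have hexp : -Complex.exp t₀ / μ = 1 / t₀ := by
    rw [IsSaddle] at h
    field_simp
    linear_combination -h
  have hr : (r : ℂ) + 2 ≠ 0 := by exact_mod_cast (by omega : r + 2 ≠ 0)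
  have hr1 : ((r + 1)! : ℂ) ≠ 0 := by exact_mod_cast Nat.factorial_ne_zero (r + 1)
  have hfac : ((r + 2)! : ℂ) = ((r : ℂ) + 2) * ((r + 1)! : ℂ) := by
    rw [Nat.factorial_succ (r + 1)]
    push_cast
    ring
  rw [phaseCoeff, iteratedDeriv_phaseDeriv μ ht0, hexp, scaledCoeff, hfac, div_pow, div_pow]
  field_simp
  ring

/-- The powers of `σ/t₀` cancel against those of `a_0`. The remaining `σ^s` turns `n^{-s}` into
`λ^{-s}`. -/
theorem saddleCoeff_eq_laplaceCoeff {μ : ℝ} (hμ : μ ≠ 0) {t₀ : ℂ} (h : IsSaddle μ t₀) {σ : ℝ}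
    (hσ : σ ≠ 0) (h0 : scaledCoeff t₀ σ 0 ≠ 0) (s : ℕ) :
    saddleCoeff μ t₀ s = (σ : ℂ) ^ s * laplaceCoeff (scaledCoeff t₀ σ) s := by
  have ht0 := h.ne_zero hμ
  have hσ' : (σ : ℂ) ≠ 0 := by exact_mod_cast hσ
  have hfun : phaseCoeff μ t₀ = fun r =>
      ((σ : ℂ)⁻¹ * (σ / t₀) ^ 2) * (σ / t₀ : ℂ) ^ r * scaledCoeff t₀ σ r :=
    funext fun r => phaseCoeff_eq_scaledCoeff hμ h hσ r
  have hpz := phaseCoeff_eq_scaledCoeff hμ h hσ 0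
  rw [pow_zero, mul_one] at hpz
  rw [saddleCoeff, laplaceCoeff, hpz, hfun, Finset.mul_sum, Finset.mul_sum, Finset.mul_sum]
  refine Finset.sum_congr rfl fun j _ => ?_
  rw [ordBell_scale]
  have hj : (j ! : ℂ) ≠ 0 := by exact_mod_cast Nat.factorial_ne_zero j
  generalize scaledCoeff t₀ σ 0 = z at h0 ⊢
  generalize ordBell (scaledCoeff t₀ σ) (2 * s) j = B
  have hd : (σ / t₀ : ℂ) ≠ 0 := div_ne_zero hσ' ht0
  generalize (σ / t₀ : ℂ) = d at hd ⊢
  rw [mul_pow, mul_pow, mul_pow, mul_pow, inv_pow, inv_pow, pow_mul]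
  field_simp

theorem saddleSeries_eq {n : ℕ} (hn : n ≠ 0) {x : ℝ} (hx : 0 < x) {t₀ : ℂ}
    (h : IsSaddle (n / x) t₀) {σ : ℝ} (hσ : 0 < σ) (h0 : scaledCoeff t₀ σ 0 ≠ 0) (N : ℕ) :
    saddleSeries N n x t₀ = contourFactor n x t₀ * (1 / (2 * Real.pi * σ) *
      ∑ s ∈ Finset.range N, laplaceCoeff (scaledCoeff t₀ σ) s * (Real.Gamma (s + 1 / 2) : ℂ) /
        (((n / σ : ℝ) : ℂ) ^ s * (√(n / σ) : ℂ) * scaledCoeff t₀ σ 0 ^ (1 / 2 : ℂ))) := by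
  have hn0 : 0 < (n : ℝ) := by positivity
  have hσ' : (σ : ℂ) ≠ 0 := by exact_mod_cast hσ.ne'
  have hz := scaledCoeff_zero t₀ σ
  have h1 : 2 * (Real.pi : ℂ) * (1 + t₀) = ((4 * Real.pi * σ : ℝ) : ℂ) * scaledCoeff t₀ σ 0 := by
    rw [hz]
    push_cast
    field_simp
    ring
  rw [saddleSeries, saddleFactor_eq, h1, ofReal_mul_cpow_half (by positivity) h0, div_mul_eq_mul_div,
    mul_div_assoc, Finset.sum_div, Finset.mul_sum (a := 1 / (2 * (Real.pi : ℂ) * σ))]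
  congr 1
  refine Finset.sum_congr rfl fun s _ => ?_
  rw [saddleCoeff_eq_laplaceCoeff (div_ne_zero hn0.ne' hx.ne') h hσ.ne' h0, Real.Gamma_one_half_eq,
    Real.rpow_add hn0, Real.rpow_natCast, ← Real.sqrt_eq_rpow,
    Real.sqrt_div hn0.le]
  have hs1 : √(4 * Real.pi * σ) = 2 * √Real.pi * √σ := by
    rw [Real.sqrt_mul (by positivity), Real.sqrt_mul (by norm_num),
      show (4 : ℝ) = 2 ^ 2 by norm_num, Real.sqrt_sq (by norm_num)]
  rw [hs1]
  have e1 : (√Real.pi : ℂ) ^ 2 = (Real.pi : ℂ) := by exact_mod_cast Real.sq_sqrt Real.pi_pos.le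
  have e2 : (√σ : ℂ) ^ 2 = (σ : ℂ) := by exact_mod_cast Real.sq_sqrt hσ.le
  have n1 : (√Real.pi : ℂ) ≠ 0 := by exact_mod_cast (Real.sqrt_pos.2 Real.pi_pos).ne'
  have n2 : (√σ : ℂ) ≠ 0 := by exact_mod_cast (Real.sqrt_pos.2 hσ).ne'
  have n3 : (√(n : ℝ) : ℂ) ≠ 0 := by exact_mod_cast (Real.sqrt_pos.2 hn0).ne'
  have n4 : (n : ℂ) ≠ 0 := by exact_mod_cast hn
  have n5 : scaledCoeff t₀ σ 0 ^ (1 / 2 : ℂ) ≠ 0 := by simp [h0]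
  have n6 : (Real.pi : ℂ) ≠ 0 := by exact_mod_cast Real.pi_ne_zero
  push_cast
  rw [div_pow]
  field_simp
  rw [e1, e2]

end Coefficients

/-! ### The expansion, given decay away from the saddle -/

section Expansion

theorem pow_mul_exp_neg_sqrt_le {k : ℝ} (hk : 0 < k) (N : ℕ) {n : ℝ} (hn : 0 < n) :
    n ^ (N + 1) * Real.exp (-(k * √n)) ≤ ((2 * N + 2)! : ℝ) / k ^ (2 * N + 2) := by
  have h1 := Real.pow_div_factorial_le_exp (k * √n) (by positivity) (2 * N + 2)
  have h2 : (k * √n) ^ (2 * N + 2) = k ^ (2 * N + 2) * n ^ (N + 1) := by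
    rw [mul_pow, show 2 * N + 2 = 2 * (N + 1) by ring, pow_mul √n, Real.sq_sqrt hn.le]
  rw [h2, div_le_iff₀ (by positivity)] at h1
  rw [Real.exp_neg, ← div_eq_mul_inv, div_le_div_iff₀ (Real.exp_pos _) (by positivity)]
  linarith

theorem norm_contourFactor_le (n : ℕ) (x : ℝ) {t₀ : ℂ} {σ : ℝ} (h0 : scaledCoeff t₀ σ 0 ≠ 0)
    (hσ : 1 ≤ σ) (hσt : ‖t₀‖ ≤ σ) :
    ‖contourFactor n x t₀‖ ≤ ‖saddleFactor n x t₀‖ * √(4 * Real.pi * σ) := by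
  have h1 : 1 + t₀ ≠ 0 := by
    rw [scaledCoeff_zero] at h0
    exact fun h => h0 (by rw [h, zero_div])
  have h2 := norm_pos_iff.2 h1
  have h3 : ‖1 + t₀‖ ≤ 2 * σ := by
    have := norm_add_le (1 : ℂ) t₀
    rw [norm_one] at this
    linarith
  have hpi := Real.pi_pos
  have h4 : ‖contourFactor n x t₀‖ = ‖saddleFactor n x t₀‖ * √(2 * Real.pi * ‖1 + t₀‖) := by
    rw [norm_saddleFactor, div_mul_cancel₀]
    positivity
  rw [h4]
  refine mul_le_mul_of_nonneg_left (Real.sqrt_le_sqrt ?_) (norm_nonneg _)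
  calc 2 * Real.pi * ‖1 + t₀‖ ≤ 2 * Real.pi * (2 * σ) := by gcongr
    _ = _ := by ring

theorem sqrt_mul_inv_le (N : ℕ) {σ n : ℝ} (hσ0 : 0 < σ) (hn0 : 0 < n) :
    √(4 * Real.pi * σ) * (1 / (2 * Real.pi * σ) * (1 / ((n / σ) ^ N * √(n / σ)))) ≤
      (σ / n) ^ N / √n := by
  have hs1 : √(4 * Real.pi * σ) = 2 * √Real.pi * √σ := by
    rw [Real.sqrt_mul (by positivity), Real.sqrt_mul (by norm_num),
      show (4 : ℝ) = 2 ^ 2 by norm_num, Real.sqrt_sq (by norm_num)]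
  have hp1 : 1 ≤ √Real.pi := Real.one_le_sqrt.2 (by linarith [Real.pi_gt_three])
  have hs0 := Real.sqrt_pos.2 hσ0
  have hn1 := Real.sqrt_pos.2 hn0
  have e1 : √Real.pi ^ 2 = Real.pi := Real.sq_sqrt Real.pi_pos.le
  have e2 : √σ ^ 2 = σ := Real.sq_sqrt hσ0.le
  have h1 : √(4 * Real.pi * σ) * (1 / (2 * Real.pi * σ) * (1 / ((n / σ) ^ N * √(n / σ)))) =
      (1 / √Real.pi) * ((σ / n) ^ N / √n) := by
    rw [hs1, Real.sqrt_div hn0.le, div_pow, div_pow]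
    field_simp
    rw [e1, e2]
  rw [h1]
  exact mul_le_of_le_one_left (by positivity) ((div_le_one (by positivity)).2 hp1)

/-- Three errors are added: the outer arcs, the passage from arc to segment, and Laplace's method.
The interval `[l, u]` is kept general to serve both the full circle and a half circle. -/
theorem saddle_expansion (N : ℕ) {c k : ℝ} (hc : 0 < c) (hk : 0 < k) :
    ∃ C : ℝ, ∀ n : ℕ, n ≠ 0 → ∀ x : ℝ, 0 < x → ∀ t₀ : ℂ, IsSaddle (n / x) t₀ →
      ∀ σ : ℝ, 1 ≤ σ → ‖t₀‖ ≤ σ → c ≤ (scaledCoeff t₀ σ 0).re → σ ≤ √n →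
        ∀ l u : ℝ, l ≤ -(c / 40 / σ) → c / 40 / σ ≤ u → u - l ≤ 2 * Real.pi →
          (∀ θ ∈ Set.Icc l u, c / 40 / σ ≤ |θ| → ‖arcIntegrand n t₀ θ‖ ≤ Real.exp (-(k * √n))) →
            ‖contourFactor n x t₀ * (1 / (2 * Real.pi) * ∫ θ in l..u, arcIntegrand n t₀ θ) -
              saddleSeries N n x t₀‖ ≤ C * ‖saddleFactor n x t₀‖ * (σ / n) ^ N / √n := by
  set r := c / 40 with hr
  have hr0 : 0 < r := by positivity
  set k' := min k (c * r ^ 2 / 2) with hk'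
  have hk'0 : 0 < k' := lt_min hk (by positivity)
  set C₁ := Real.Gamma (N + 1 / 2) / (r ^ (2 * N) * (c / 2) ^ N * √(c / 2)) with hC₁
  set C₂ := ((2 * N + 2)! : ℝ) / k' ^ (2 * N + 2) with hC₂
  have hC₂0 : 0 < C₂ := by positivity
  -- Of the `9`, `7 > 2π` pays for the outer arcs and `2` for the endpoints of the segment.
  refine ⟨C₁ + 9 * C₂, fun n hn x hx t₀ ht σ hσ hσt hc0 hσn l u hl hu hlu hout => ?_⟩
  have hn0 : 0 < (n : ℝ) := by positivity
  have hσ0 : 0 < σ := by linarith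
  have ht0 := ht.ne_zero (div_ne_zero hn0.ne' hx.ne')
  have hβ := norm_scaledCoeff_le hσ hσt
  have hc1 : c ≤ 1 := hc0.trans ((Complex.re_le_norm _).trans (hβ 0))
  have hr1 : r ≤ 1 / 40 := by linarith
  have hβ0 : scaledCoeff t₀ σ 0 ≠ 0 := ne_zero_of_re_pos (hc.trans_le hc0)
  set lam : ℝ := n / σ with hlam
  have hlam0 : 0 < lam := by positivity
  have hsn : 0 < √(n : ℝ) := Real.sqrt_pos.2 hn0
  have hsq : √(n : ℝ) * √n = n := Real.mul_self_sqrt hn0.le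
  have hlamn : √n ≤ lam := by
    rw [hlam, le_div_iff₀ hσ0]
    nlinarith
  have hlamle : lam ≤ n := div_le_self hn0.le hσ
  set ε := r / σ with hε
  have hε0 : 0 < ε := by positivity
  set S := ∑ s ∈ Finset.range N, laplaceCoeff (scaledCoeff t₀ σ) s *
    (Real.Gamma (s + 1 / 2) : ℂ) / ((lam : ℂ) ^ s * (√lam : ℂ) * scaledCoeff t₀ σ 0 ^ (1 / 2 : ℂ))
    with hS
  set L := ∫ v in (-r)..r, localIntegrand (scaledCoeff t₀ σ) lam (Complex.I * v) with hL
  have hcont : ContinuousOn (fun v : ℝ => localIntegrand (scaledCoeff t₀ σ) lam (Complex.I * v))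
      (Set.Icc (-r) r) := by
    refine (differentiableOn_localIntegrand hσ hσt ht0 n).continuousOn.comp (by fun_prop) ?_
    intro v hv
    have := abs_le.2 hv
    simp only [mem_ball_zero_iff, norm_mul, Complex.norm_I, one_mul, Complex.norm_real,
      Real.norm_eq_abs]
    linarith
  set Q := lam ^ N * √lam with hQ
  have hQ0 : 0 < Q := by positivity
  have b3 : ‖L - S‖ ≤ C₁ / Q :=
    norm_localIntegral_sub_le hβ hc hc0 hr0 (by linarith) (by linarith) hlam0 hcont N
  -- As `σ ≤ √n` and `λ ≤ n`, the quantity `σQ` is at most `n^{N+1}`, which `e^{-k'√n}` beats.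
  have hE : Real.exp (-(k' * √n)) ≤ C₂ / (σ * Q) := by
    rw [le_div_iff₀ (by positivity)]
    have h1 : σ * Q ≤ (n : ℝ) ^ (N + 1) := by
      calc σ * Q ≤ √n * ((n : ℝ) ^ N * √n) := by
            rw [hQ]
            gcongr
        _ = (n : ℝ) ^ N * (√n * √n) := by ring
        _ = _ := by rw [hsq, pow_succ]
    calc _ ≤ Real.exp (-(k' * √n)) * (n : ℝ) ^ (N + 1) := by gcongr
      _ = (n : ℝ) ^ (N + 1) * Real.exp (-(k' * √n)) := mul_comm _ _
      _ ≤ _ := pow_mul_exp_neg_sqrt_le hk'0 N hn0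
  have b2 : ‖σ * (∫ θ in (-ε)..ε, arcIntegrand n t₀ θ) - L‖ ≤ 2 * Real.exp (-(k' * √n)) := by
    refine (norm_arcIntegral_sub_le hσ hσt ht0 hc0 hr0 (by linarith) n).trans ?_
    have h1 : Real.exp (-(n / σ * (c * r ^ 2 / 2))) ≤ Real.exp (-(k' * √n)) := by
      apply Real.exp_le_exp.2
      have : k' * √n ≤ (c * r ^ 2 / 2) * (n / σ) :=
        mul_le_mul (min_le_right _ _) hlamn hsn.le (by positivity)
      linarith
    have h2 : r ^ 2 ≤ 1 := by nlinarith
    have h3 := Real.exp_pos (-(k' * √n))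
    have h4 : Real.exp (-(n / σ * (c * r ^ 2 / 2))) * r ^ 2 ≤ Real.exp (-(k' * √n)) * 1 := by
      gcongr
    linarith
  have hout' : ∀ θ ∈ Set.Icc l u, ε ≤ |θ| → ‖arcIntegrand n t₀ θ‖ ≤ Real.exp (-(k' * √n)) := by
    intro θ hθ h
    refine (hout θ hθ h).trans (Real.exp_le_exp.2 ?_)
    have : k' * √n ≤ k * √n := by
      gcongr
      exact min_le_left _ _
    linarith
  have hint : ∀ a b : ℝ, IntervalIntegrable (arcIntegrand n t₀) MeasureTheory.volume a b :=
    fun a b => (continuous_arcIntegrand n t₀).intervalIntegrable a b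
  have b1l : ‖∫ θ in l..(-ε), arcIntegrand n t₀ θ‖ ≤ Real.exp (-(k' * √n)) * (-ε - l) := by
    have := intervalIntegral.norm_integral_le_of_norm_le_const (a := l) (b := -ε)
      (f := arcIntegrand n t₀) (C := Real.exp (-(k' * √n))) fun θ hθ => by
        rw [Set.uIoc_of_le hl] at hθ
        refine hout' θ ⟨hθ.1.le, by linarith [hθ.2]⟩ ?_
        rw [abs_of_nonpos (by linarith [hθ.2])]
        linarith [hθ.2]
    rwa [abs_of_nonneg (by linarith)] at this
  have b1u : ‖∫ θ in ε..u, arcIntegrand n t₀ θ‖ ≤ Real.exp (-(k' * √n)) * (u - ε) := by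
    have := intervalIntegral.norm_integral_le_of_norm_le_const (a := ε) (b := u)
      (f := arcIntegrand n t₀) (C := Real.exp (-(k' * √n))) fun θ hθ => by
        rw [Set.uIoc_of_le hu] at hθ
        refine hout' θ ⟨by linarith [hθ.1], hθ.2⟩ ?_
        rw [abs_of_nonneg (by linarith [hθ.1])]
        exact hθ.1.le
    rwa [abs_of_nonneg (by linarith)] at this
  have hsplit : ∫ θ in l..u, arcIntegrand n t₀ θ = (∫ θ in l..(-ε), arcIntegrand n t₀ θ) +
      (∫ θ in (-ε)..ε, arcIntegrand n t₀ θ) + ∫ θ in ε..u, arcIntegrand n t₀ θ := by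
    rw [intervalIntegral.integral_add_adjacent_intervals (hint _ _) (hint _ _),
      intervalIntegral.integral_add_adjacent_intervals (hint _ _) (hint _ _)]
  have hσ' : (σ : ℂ) ≠ 0 := by exact_mod_cast hσ0.ne'
  have hpi' : (Real.pi : ℂ) ≠ 0 := by exact_mod_cast Real.pi_ne_zero
  have hdiff : 1 / (2 * (Real.pi : ℂ)) * (∫ θ in l..u, arcIntegrand n t₀ θ) -
      1 / (2 * Real.pi * σ) * S = ((1 / (2 * Real.pi * σ) : ℝ) : ℂ) *
        (σ * ((∫ θ in l..(-ε), arcIntegrand n t₀ θ) + ∫ θ in ε..u, arcIntegrand n t₀ θ) +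
          (σ * (∫ θ in (-ε)..ε, arcIntegrand n t₀ θ) - L) + (L - S)) := by
    rw [hsplit]
    push_cast
    field_simp
    ring
  have hEpos := Real.exp_pos (-(k' * √n))
  have hpi4 := Real.pi_lt_d2
  have hbound : ‖σ * ((∫ θ in l..(-ε), arcIntegrand n t₀ θ) + ∫ θ in ε..u, arcIntegrand n t₀ θ) +
      (σ * (∫ θ in (-ε)..ε, arcIntegrand n t₀ θ) - L) + (L - S)‖ ≤ (C₁ + 9 * C₂) / Q := by
    have h1 : ‖(σ : ℂ) * ((∫ θ in l..(-ε), arcIntegrand n t₀ θ) +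
        ∫ θ in ε..u, arcIntegrand n t₀ θ)‖ ≤ σ * (Real.exp (-(k' * √n)) * (2 * Real.pi)) := by
      rw [norm_mul, Complex.norm_real, Real.norm_of_nonneg hσ0.le]
      gcongr
      refine (norm_add_le _ _).trans ((add_le_add b1l b1u).trans ?_)
      rw [← mul_add]
      gcongr
      linarith
    have h2 : σ * Real.exp (-(k' * √n)) ≤ C₂ / Q := by
      calc _ ≤ σ * (C₂ / (σ * Q)) := by gcongr
        _ = _ := by field_simp
    refine (norm_add₃_le).trans ?_
    have h3 : (C₁ + 9 * C₂) / Q = C₁ / Q + 9 * (C₂ / Q) := by ring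
    rw [h3]
    have h4 : Real.exp (-(k' * √n)) ≤ σ * Real.exp (-(k' * √n)) := le_mul_of_one_le_left hEpos.le hσ
    have h5 : σ * (Real.exp (-(k' * √n)) * (2 * Real.pi)) ≤ 7 * (σ * Real.exp (-(k' * √n))) := by
      have : σ * (Real.exp (-(k' * √n)) * (2 * Real.pi)) =
          (2 * Real.pi) * (σ * Real.exp (-(k' * √n))) := by ring
      rw [this]
      apply mul_le_mul_of_nonneg_right _ (by positivity)
      linarith
    linarith
  rw [saddleSeries_eq hn hx ht hσ0 hβ0, ← mul_sub, norm_mul, hdiff, norm_mul, Complex.norm_real,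
    Real.norm_of_nonneg (by positivity)]
  have hfac := norm_contourFactor_le n x hβ0 hσ hσt
  have hC0 : 0 ≤ C₁ + 9 * C₂ := by
    have : 0 < Real.Gamma (N + 1 / 2) := Real.Gamma_pos_of_pos (by positivity)
    positivity
  have hfin := sqrt_mul_inv_le N hσ0 hn0
  calc _ ≤ ‖saddleFactor n x t₀‖ * √(4 * Real.pi * σ) *
        (1 / (2 * Real.pi * σ) * ((C₁ + 9 * C₂) / Q)) := by gcongr
    _ = (C₁ + 9 * C₂) * ‖saddleFactor n x t₀‖ *
        (√(4 * Real.pi * σ) * (1 / (2 * Real.pi * σ) * (1 / Q))) := by ring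
    _ ≤ (C₁ + 9 * C₂) * ‖saddleFactor n x t₀‖ * ((σ / n) ^ N / √n) := by gcongr
    _ = _ := by ring

end Expansion

/-! ### Decay on the circle: the real saddle -/

theorem norm_arcIntegrand (n : ℕ) (t₀ : ℂ) (θ : ℝ) :
    ‖arcIntegrand n t₀ θ‖ = Real.exp
      (n * ((Complex.exp (t₀ * (Complex.exp (θ * Complex.I) - 1)) - 1) / t₀).re) := by
  rw [arcIntegrand, norm_mul, norm_mul, norm_inv, norm_pow, Complex.norm_exp_ofReal_mul_I, one_pow,
    inv_one, mul_one, mul_one, Complex.norm_exp, div_mul_eq_mul_div, mul_div_assoc,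
    ← Complex.ofReal_natCast, Complex.re_ofReal_mul]

theorem periodic_arcIntegrand (n : ℕ) (t₀ : ℂ) :
    Function.Periodic (arcIntegrand n t₀) (2 * Real.pi) := by
  intro θ
  have : Complex.exp (((θ + 2 * Real.pi : ℝ) : ℂ) * Complex.I) = Complex.exp (θ * Complex.I) := by
    push_cast
    rw [add_mul, Complex.exp_add, Complex.exp_two_pi_mul_I, mul_one]
  rw [arcIntegrand, arcIntegrand, this]

section RealSaddle

/-- The claim is `e^y cos(ρ sin θ) ≥ 1 + (1-ρ)y` with `y = ρ(1 - cos θ)`. It follows from the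
quadratic lower bounds for `exp` and `cos`, because `(ρ sin θ)²/2 = ρy - y²/2`. -/
theorem norm_arcIntegrand_real_le {ρ : ℝ} (h0 : 0 < ρ) (h1 : ρ < 1) (n : ℕ) (θ : ℝ) :
    ‖arcIntegrand n ((-ρ : ℝ) : ℂ) θ‖ ≤ Real.exp (-(n * ((1 - ρ) * (1 - Real.cos θ)))) := by
  rw [norm_arcIntegrand]
  apply Real.exp_le_exp.2
  set y := ρ * (1 - Real.cos θ) with hy
  have hy0 : 0 ≤ y := mul_nonneg h0.le (by linarith [Real.cos_le_one θ])
  have hexp : (Complex.exp (((-ρ : ℝ) : ℂ) * (Complex.exp (θ * Complex.I) - 1))).re =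
      Real.exp y * Real.cos (ρ * Real.sin θ) := by
    rw [Complex.exp_re, Complex.re_ofReal_mul, Complex.im_ofReal_mul, Complex.sub_re,
      Complex.sub_im, Complex.exp_ofReal_mul_I_re, Complex.exp_ofReal_mul_I_im, Complex.one_re,
      Complex.one_im, sub_zero, neg_mul, neg_mul, Real.cos_neg, hy]
    congr 2
    ring
  have hre : ((Complex.exp (((-ρ : ℝ) : ℂ) * (Complex.exp (θ * Complex.I) - 1)) - 1) /
      ((-ρ : ℝ) : ℂ)).re = -((Real.exp y * Real.cos (ρ * Real.sin θ) - 1) / ρ) := by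
    rw [Complex.div_ofReal_re, Complex.sub_re, hexp, Complex.one_re, div_neg]
  have hx2 : (ρ * Real.sin θ) ^ 2 / 2 = ρ * y - y ^ 2 / 2 := by
    rw [hy, mul_pow, Real.sin_sq]
    ring
  have hx1 : (ρ * Real.sin θ) ^ 2 / 2 ≤ 1 := by
    have h2 := Real.sin_sq_le_one θ
    have h3 : ρ ^ 2 ≤ 1 := by nlinarith
    rw [mul_pow]
    nlinarith [sq_nonneg (Real.sin θ)]
  have hcos := Real.one_sub_sq_div_two_le_cos (x := ρ * Real.sin θ)
  have hexp2 := Real.quadratic_le_exp_of_nonneg hy0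
  have hprod : 1 + (1 - ρ) * y ≤ Real.exp y * Real.cos (ρ * Real.sin θ) := by
    have h2 : (1 + y + y ^ 2 / 2) * (1 - (ρ * Real.sin θ) ^ 2 / 2) ≤
        Real.exp y * Real.cos (ρ * Real.sin θ) :=
      mul_le_mul hexp2 hcos (by linarith) (Real.exp_pos _).le
    refine le_trans ?_ h2
    rw [hx2]
    have h3 : 0 ≤ (1 - ρ) * y ^ 2 := mul_nonneg (by linarith) (by positivity)
    have h4 : 0 ≤ (1 - ρ) * y ^ 3 := mul_nonneg (by linarith) (by positivity)
    have h5 : 0 ≤ y ^ 4 := by positivity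
    nlinarith
  rw [hre, mul_neg, neg_le_neg_iff]
  gcongr
  rw [le_div_iff₀ h0]
  rw [hy] at hprod
  linarith

theorem isSaddle_ofReal {μ t : ℝ} (h : t * Real.exp t = -μ) : IsSaddle μ (t : ℂ) := by
  rw [IsSaddle]
  exact_mod_cast congrArg (fun r : ℝ => (r : ℂ)) h

theorem real_saddle_expansion (N : ℕ) {δ : ℝ} (hδ : 0 < δ) :
    ∃ C : ℝ, ∀ n : ℕ, n ≠ 0 → ∀ x : ℝ, 0 < x → (n : ℝ) / x ≤ 1 / Real.exp 1 - δ →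
      ∀ t₀ : ℝ, IsSmallestRealSaddle ((n : ℝ) / x) t₀ →
        ‖touchard (n - 1) (-(x : ℂ)) - saddleSeries N n x (t₀ : ℂ)‖ ≤
          C * ‖saddleFactor n x (t₀ : ℂ)‖ * (1 / (n : ℝ)) ^ N / √n := by
  set q := √(Real.exp 1 * δ) with hq
  have hq0 : 0 < q := Real.sqrt_pos.2 (by positivity)
  set c := q / 2 with hc
  set r := c / 40 / 1 with hr
  have hr0 : 0 < r := by positivity
  -- For `q ≥ 1` we have `δ ≥ 1/e`, so no positive `n/x` is in range.
  rcases le_or_gt 1 q with hq1 | hq1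
  · refine ⟨0, fun n hn x hx hμ => ?_⟩
    have hn0 : 0 < (n : ℝ) := by positivity
    have h1 : 0 < (n : ℝ) / x := by positivity
    have h2 : 1 ≤ Real.exp 1 * δ := Real.one_le_sqrt.1 hq1
    have h3 : 1 / Real.exp 1 ≤ δ := by
      rw [div_le_iff₀ (Real.exp_pos 1)]
      linarith
    linarith
  have hpi := Real.pi_gt_three
  have hcosr : Real.cos r < 1 := by
    have := Real.cos_lt_cos_of_nonneg_of_le_pi le_rfl (by linarith) hr0
    rwa [Real.cos_zero] at this
  obtain ⟨C, hC⟩ := saddle_expansion N (c := c) (k := q * (1 - Real.cos r)) (by positivity)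
    (mul_pos hq0 (by linarith))
  refine ⟨C, fun n hn x hx hμ t₀ ht₀ => ?_⟩
  have hn0 : 0 < (n : ℝ) := by positivity
  have hn1 : (1 : ℝ) ≤ n := by exact_mod_cast Nat.one_le_iff_ne_zero.2 hn
  have hμ0 : 0 < (n : ℝ) / x := by positivity
  obtain ⟨s₀, s₁, -, h2, h3, -, h4⟩ := exists_real_roots hμ0 (by linarith)
  obtain rfl := (h4 t₀).1 ht₀
  have hroot := ht₀.1
  -- From `-t₀e^{1+t₀} = eμ ≤ 1 - eδ` and `e^{1+t₀} ≥ 2 + t₀` one gets `(1+t₀)² ≥ eδ`.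
  have hs : q ≤ 1 + t₀ := by
    rw [hq]
    apply Real.sqrt_le_iff.2 ⟨by linarith, ?_⟩
    have e1 := Real.add_one_le_exp (1 + t₀)
    have e2 : -t₀ * Real.exp (1 + t₀) ≤ 1 - Real.exp 1 * δ := by
      have : -t₀ * Real.exp (1 + t₀) = Real.exp 1 * (n / x) := by
        rw [Real.exp_add]
        linear_combination (-Real.exp 1) * hroot
      rw [this]
      calc _ ≤ Real.exp 1 * (1 / Real.exp 1 - δ) := by gcongr
        _ = _ := by
          have := Real.exp_ne_zero 1
          field_simp
    nlinarith
  have hsad := isSaddle_ofReal hroot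
  have hz : (scaledCoeff (t₀ : ℂ) 1 0).re = (1 + t₀) / 2 := by
    rw [scaledCoeff_zero]
    have : (1 + (t₀ : ℂ)) / (2 * ((1 : ℝ) : ℂ)) = (((1 + t₀) / 2 : ℝ) : ℂ) := by
      push_cast
      ring
    rw [this, Complex.ofReal_re]
  have hsn : 1 ≤ √(n : ℝ) := Real.one_le_sqrt.2 hn1
  -- Here `|t₀| < 1`, so the scale is `σ = 1` and the error carries `n^{-N}`.
  have h := hC n hn x hx t₀ hsad 1 le_rfl
    (by rw [Complex.norm_real, Real.norm_eq_abs, abs_of_neg h3]; linarith)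
    (by rw [hz]; linarith) hsn (-Real.pi) Real.pi (by linarith) (by linarith) (by linarith)
    (fun θ hθ hθr => by
      have e1 := norm_arcIntegrand_real_le (ρ := -t₀) (by linarith) (by linarith) n θ
      rw [neg_neg] at e1
      refine e1.trans (Real.exp_le_exp.2 (neg_le_neg ?_))
      have e2 : Real.cos θ ≤ Real.cos r := by
        rw [← Real.cos_abs θ]
        exact Real.cos_le_cos_of_nonneg_of_le_pi hr0.le (abs_le.2 hθ) hθr
      have e3 : √(n : ℝ) ≤ n := Real.sqrt_le_iff.2 ⟨by linarith, by nlinarith⟩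
      have e4 : q * (1 - Real.cos r) ≤ (1 - -t₀) * (1 - Real.cos θ) :=
        mul_le_mul (by linarith) (by linarith) (by linarith) (by linarith)
      rw [mul_comm]
      exact mul_le_mul e3 e4 (mul_nonneg hq0.le (by linarith)) hn0.le)
  rwa [← touchard_eq_arcIntegral hn hx hsad] at h

end RealSaddle

/-! ### Decay on the circle: the complex saddles -/

section ComplexSaddle

theorem IsSaddle.eq_polar {μ : ℝ} (hμ : 0 < μ) {t : ℂ} (h : IsSaddle μ t) :
    t.re = ‖t‖ * Real.cos (Real.pi - t.im) ∧ t.im = ‖t‖ * Real.sin (Real.pi - t.im) ∧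
      t = ‖t‖ * Complex.exp ((Real.pi - t.im : ℝ) * Complex.I) := by
  obtain ⟨-, -, h1, h2⟩ := h.polar hμ
  have e1 : t.re = ‖t‖ * Real.cos (Real.pi - t.im) := by
    rw [Real.cos_pi_sub]
    linarith
  have e2 : t.im = ‖t‖ * Real.sin (Real.pi - t.im) := by
    rw [Real.sin_pi_sub]
    exact h2
  refine ⟨e1, e2, Complex.ext ?_ ?_⟩
  · rw [Complex.re_ofReal_mul, Complex.exp_ofReal_mul_I_re]
    exact e1
  · rw [Complex.im_ofReal_mul, Complex.exp_ofReal_mul_I_im]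
    exact e2

theorem IsSaddle.mul_exp_eq {μ : ℝ} (hμ : 0 < μ) {t : ℂ} (h : IsSaddle μ t) (θ : ℝ) :
    t * Complex.exp (θ * Complex.I) =
      ‖t‖ * Complex.exp ((Real.pi - t.im + θ : ℝ) * Complex.I) := by
  conv_lhs => rw [(h.eq_polar hμ).2.2]
  rw [mul_assoc, ← Complex.exp_add]
  congr 2
  push_cast
  ring

theorem norm_arcIntegrand_circle {μ : ℝ} (hμ : 0 < μ) {t : ℂ} (h : IsSaddle μ t) (n : ℕ) (θ : ℝ) :
    ‖arcIntegrand n t θ‖ = Real.exp (n * (circlePhase ‖t‖ (Real.pi - t.im + θ) / μ -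
      Real.cos (Real.pi - t.im) / ‖t‖)) := by
  have ht0 := h.ne_zero hμ.ne'
  have hμ' : (μ : ℂ) ≠ 0 := by exact_mod_cast hμ.ne'
  have h1 : (Complex.exp (t * (Complex.exp (θ * Complex.I) - 1)) - 1) / t =
      -Complex.exp (t * Complex.exp (θ * Complex.I)) / μ - 1 / t := by
    have e1 : Complex.exp (t * Complex.exp (θ * Complex.I)) =
        Complex.exp t * Complex.exp (t * (Complex.exp (θ * Complex.I) - 1)) := by
      rw [← Complex.exp_add]
      congr 1
      ring
    rw [e1]
    rw [IsSaddle] at h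
    field_simp
    linear_combination (Complex.exp (t * (Complex.exp (θ * Complex.I) - 1))) * h
  have h2 : (1 / t).re = Real.cos (Real.pi - t.im) / ‖t‖ := by
    have h3 := (norm_pos_iff.2 ht0).ne'
    rw [one_div, Complex.inv_re, ← Complex.sq_norm, div_eq_div_iff (by positivity) h3]
    nth_rewrite 1 [(h.eq_polar hμ).1]
    ring
  rw [norm_arcIntegrand, h1, Complex.sub_re, h2, Complex.div_ofReal_re, h.mul_exp_eq hμ,
    Complex.neg_re, Complex.exp_re, Complex.re_ofReal_mul, Complex.im_ofReal_mul,
    Complex.exp_ofReal_mul_I_re, Complex.exp_ofReal_mul_I_im, circlePhase]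

theorem norm_arcIntegrand_le_of_circlePhase_le {μ : ℝ} (hμ : 0 < μ) {t : ℂ} (h : IsSaddle μ t)
    (n : ℕ) {θ θ' : ℝ}
    (hle : circlePhase ‖t‖ (Real.pi - t.im + θ) ≤ circlePhase ‖t‖ (Real.pi - t.im + θ')) :
    ‖arcIntegrand n t θ‖ ≤ ‖arcIntegrand n t θ'‖ := by
  rw [norm_arcIntegrand_circle hμ h, norm_arcIntegrand_circle hμ h]
  apply Real.exp_le_exp.2
  gcongr

/-- On the upper half of the circle `|t| = |t₀|`, away from the saddle, the normalized integrand is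
exponentially small. -/
theorem norm_arcIntegrand_upper_le {μ : ℝ} (hμ : 0 < μ) {t : ℂ} (h : IsSaddle μ t)
    (him : t.im ∈ Set.Ioo 0 Real.pi) {c : ℝ} (hc : 0 < c)
    (hc0 : c ≤ (scaledCoeff t ‖t‖ 0).re) {n : ℕ} (hn : ‖t‖ ^ 3 ≤ √n)
    (hr : c / 40 ≤ t.im) {θ : ℝ}
    (hθ : θ ∈ Set.Icc (-(Real.pi - t.im)) t.im) (hθr : c / 40 / ‖t‖ ≤ |θ|) :
    ‖arcIntegrand n t θ‖ ≤ Real.exp (-(min (1 / 8) (c * (c / 40) ^ 2 / 2) * √n)) := by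
  have hone := h.one_lt_norm hμ him.1
  obtain ⟨hρ, hexp, -, -⟩ := h.polar hμ
  obtain ⟨hre, himp, -⟩ := h.eq_polar hμ
  have ht0 := h.ne_zero hμ.ne'
  have hadd := h.one_add_re_pos hμ him.1 him.2
  have hsmall := h.norm_le_of_re_nonpos hμ him.1 him.2
  set ρ := ‖t‖ with hρdef
  set θ₀ := Real.pi - t.im with hθ₀
  set r := c / 40 with hrdef
  have hr0 : 0 < r := by positivity
  have hg : θ₀ + ρ * Real.sin θ₀ = Real.pi := by
    rw [← himp, hθ₀]
    ring
  have hε0 : 0 < r / ρ := by positivity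
  have hθ₀0 : 0 < θ₀ := by
    rw [hθ₀]
    linarith [him.2]
  have hθ₀pi : θ₀ < Real.pi := by
    rw [hθ₀]
    linarith [him.1]
  have hsn0 : 0 ≤ √(n : ℝ) := Real.sqrt_nonneg _
  have hsq : √(n : ℝ) * √n = n := Real.mul_self_sqrt (Nat.cast_nonneg n)
  have hn3 : √(n : ℝ) ≤ n / ρ ^ 3 := by
    rw [le_div_iff₀ (by positivity)]
    calc √(n : ℝ) * ρ ^ 3 ≤ √n * √n := by gcongr
      _ = n := hsq
  have hn1 : √(n : ℝ) ≤ n / ρ := by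
    refine hn3.trans ?_
    gcongr
    exact le_self_pow₀ hone.le (by norm_num)
  -- The values at the two ends of the local arc; monotonicity of the phase propagates them outward.
  have hend : ∀ e : ℝ, (e = 1 ∨ e = -1) → ‖arcIntegrand n t (e * (r / ρ))‖ ≤
      Real.exp (-(min (1 / 8) (c * r ^ 2 / 2) * √n)) := by
    intro e he
    refine (norm_arcIntegrand_endpoint_le hone.le le_rfl ht0 hc0 hr0 (by linarith) he n).trans ?_
    apply Real.exp_le_exp.2
    have : min (1 / 8) (c * r ^ 2 / 2) * √n ≤ (c * r ^ 2 / 2) * (n / ρ) :=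
      mul_le_mul (min_le_right _ _) hn1 hsn0 (by positivity)
    linarith
  rcases le_total θ 0 with hθ0 | hθ0
  · rw [abs_of_nonpos hθ0] at hθr
    refine (norm_arcIntegrand_le_of_circlePhase_le hμ h n ?_).trans (hend (-1) (Or.inr rfl))
    refine monotoneOn_circlePhase hρ hθ₀0.le hθ₀pi.le (by rw [← hre]; exact hadd.le) hg
      ⟨?_, ?_⟩ ⟨?_, ?_⟩ ?_ <;> linarith [hθ.1]
  · rw [abs_of_nonneg hθ0] at hθr
    have hmem : θ₀ + θ ∈ Set.Icc θ₀ Real.pi := ⟨by linarith, by rw [hθ₀]; linarith [hθ.2]⟩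
    rcases circlePhase_large_angle hρ hθ₀0 hθ₀pi (by rw [← hre]; exact hsmall) hg hmem with h1 | h1
    · refine (norm_arcIntegrand_le_of_circlePhase_le hμ h n ?_).trans (hend 1 (Or.inl rfl))
      refine antitoneOn_circlePhase hρ hθ₀0.le hmem.2 hg h1 ⟨?_, ?_⟩ ⟨?_, ?_⟩ ?_ <;> linarith
    -- The drop `1/(8ρ²)` in the cosine becomes an exponent `-n/(8ρ³)`, which is why `ρ³ ≤ √n` is
    -- required.
    · rw [norm_arcIntegrand_circle hμ h]
      apply Real.exp_le_exp.2
      rw [← hre] at h1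
      have e1 : circlePhase ρ (θ₀ + θ) / μ ≤ (Real.cos θ₀ - 1 / (8 * ρ ^ 2)) / ρ := by
        rw [div_le_div_iff₀ hμ hρ, ← hexp]
        calc circlePhase ρ (θ₀ + θ) * ρ ≤
              (Real.exp t.re * (Real.cos θ₀ - 1 / (8 * ρ ^ 2))) * ρ := by gcongr
          _ = _ := by ring
      have e2 : (Real.cos θ₀ - 1 / (8 * ρ ^ 2)) / ρ - Real.cos θ₀ / ρ = -(1 / (8 * ρ ^ 3)) := by
        field_simp
        ring
      have e3 : (n : ℝ) * (circlePhase ρ (θ₀ + θ) / μ - Real.cos θ₀ / ρ) ≤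
          n * -(1 / (8 * ρ ^ 3)) := by
        gcongr
        linarith
      have e4 : (n : ℝ) * -(1 / (8 * ρ ^ 3)) = -(1 / 8 * (n / ρ ^ 3)) := by
        field_simp
      have e5 : min (1 / 8) (c * r ^ 2 / 2) * √n ≤ 1 / 8 * (n / ρ ^ 3) :=
        mul_le_mul (min_le_left _ _) hn3 hsn0 (by norm_num)
      linarith

theorem arcIntegrand_conj (n : ℕ) (t : ℂ) (θ : ℝ) :
    arcIntegrand n ((starRingEnd ℂ) t) θ = (starRingEnd ℂ) (arcIntegrand n t (-θ)) := by
  have h1 : (starRingEnd ℂ) (Complex.exp (((-θ : ℝ) : ℂ) * Complex.I)) =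
      Complex.exp (θ * Complex.I) := by
    rw [← Complex.exp_conj, map_mul, Complex.conj_ofReal, Complex.conj_I]
    congr 1
    push_cast
    ring
  rw [arcIntegrand, arcIntegrand]
  simp only [map_mul, map_inv₀, map_pow, ← Complex.exp_conj (_ * (_ - 1)), map_sub, map_one,
    map_div₀, map_natCast, h1]

theorem contourFactor_conj (n : ℕ) (x : ℝ) (t : ℂ) :
    contourFactor n x ((starRingEnd ℂ) t) = (starRingEnd ℂ) (contourFactor n x t) := by
  rw [contourFactor, contourFactor]
  simp only [map_div₀, map_mul, map_pow, ← Complex.exp_conj, map_add, map_natCast,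
    Complex.conj_ofReal]

theorem intervalIntegral_conj (f : ℝ → ℂ) (a b : ℝ) :
    ∫ x in a..b, (starRingEnd ℂ) (f x) = (starRingEnd ℂ) (∫ x in a..b, f x) := by
  rw [intervalIntegral, intervalIntegral, integral_conj, integral_conj, map_sub]

/-- With the root at angle `θ₀ = π - Im t`, the reflection `θ ↦ -2θ₀ - θ` is complex conjugation on
the circle. It carries the upper half to the lower and conjugates the full integrand. -/
theorem touchard_eq_two_re {n : ℕ} (hn : n ≠ 0) {x : ℝ} (hx : 0 < x) {t : ℂ}
    (h : IsSaddle (n / x) t) :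
    touchard (n - 1) (-(x : ℂ)) = ((2 * (contourFactor n x t * (1 / (2 * Real.pi) *
      ∫ θ in (-(Real.pi - t.im))..t.im, arcIntegrand n t θ)).re : ℝ) : ℂ) := by
  have hμ : 0 < (n : ℝ) / x := by positivity
  set θ₀ := Real.pi - t.im with hθ₀
  have him : t.im = Real.pi - θ₀ := by
    rw [hθ₀]
    ring
  set P := contourFactor n x t with hP
  have hrefl : ∀ θ : ℝ, P * arcIntegrand n t (-2 * θ₀ - θ) =
      (starRingEnd ℂ) (P * arcIntegrand n t θ) := by
    intro θ
    have h1 : ∀ θ : ℝ, P * arcIntegrand n t θ = (Real.Gamma n * Real.exp x : ℝ) *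
        (Complex.exp (-(x : ℂ) * Complex.exp (t * Complex.exp (θ * Complex.I))) *
          ((t * Complex.exp (θ * Complex.I)) ^ (n - 1))⁻¹) := by
      intro θ
      rw [arcIntegrand_eq hn hx h, hP, contourFactor, Complex.exp_add]
      push_cast
      ring
    have h2 : t * Complex.exp (((-2 * θ₀ - θ : ℝ) : ℂ) * Complex.I) =
        (starRingEnd ℂ) (t * Complex.exp (θ * Complex.I)) := by
      rw [h.mul_exp_eq hμ, h.mul_exp_eq hμ, map_mul, Complex.conj_ofReal, ← Complex.exp_conj,
        map_mul, Complex.conj_ofReal, Complex.conj_I, ← hθ₀]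
      congr 2
      push_cast
      ring
    rw [h1, h1, h2]
    simp only [map_mul, map_inv₀, map_pow, ← Complex.exp_conj, map_neg, Complex.conj_ofReal]
  have hint : ∀ a b : ℝ, IntervalIntegrable (arcIntegrand n t) MeasureTheory.volume a b :=
    fun a b => (continuous_arcIntegrand n t).intervalIntegrable a b
  have hshift : ∫ θ in (-Real.pi)..Real.pi, arcIntegrand n t θ =
      (∫ θ in (-θ₀ - Real.pi)..(-θ₀), arcIntegrand n t θ) +
        ∫ θ in (-θ₀)..t.im, arcIntegrand n t θ := by
    rw [intervalIntegral.integral_add_adjacent_intervals (hint _ _) (hint _ _)]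
    have := (periodic_arcIntegrand n t).intervalIntegral_add_eq (-Real.pi) (-θ₀ - Real.pi)
    rw [show -Real.pi + 2 * Real.pi = Real.pi by ring,
      show -θ₀ - Real.pi + 2 * Real.pi = t.im by rw [him]; ring] at this
    exact this
  have hleft : P * ∫ θ in (-θ₀ - Real.pi)..(-θ₀), arcIntegrand n t θ =
      (starRingEnd ℂ) (P * ∫ θ in (-θ₀)..t.im, arcIntegrand n t θ) := by
    have h1 := intervalIntegral.integral_comp_sub_left (a := -θ₀) (b := t.im)
      (fun θ => P * arcIntegrand n t θ) (-2 * θ₀)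
    rw [show -2 * θ₀ - t.im = -θ₀ - Real.pi by rw [him]; ring,
      show -2 * θ₀ - -θ₀ = -θ₀ by ring] at h1
    simp only [hrefl] at h1
    rw [intervalIntegral_conj, intervalIntegral.integral_const_mul,
      intervalIntegral.integral_const_mul] at h1
    exact h1.symm
  rw [touchard_eq_arcIntegral hn hx h, ← hP, hshift]
  set J := ∫ θ in (-θ₀)..t.im, arcIntegrand n t θ with hJ
  have hz : P * (1 / (2 * Real.pi) * J) = ((1 / (2 * Real.pi) : ℝ) : ℂ) * (P * J) := by
    push_cast
    ring
  rw [hz, Complex.re_ofReal_mul]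
  have hadd := Complex.add_conj (P * J)
  rw [← hleft] at hadd
  push_cast at hadd ⊢
  linear_combination (1 / (2 * (Real.pi : ℂ))) * hadd

theorem scaledCoeff_zero_re (t : ℂ) (σ : ℝ) : (scaledCoeff t σ 0).re = (1 + t.re) / (2 * σ) := by
  rw [scaledCoeff_zero, show (2 * (σ : ℂ)) = ((2 * σ : ℝ) : ℂ) by push_cast; ring,
    Complex.div_ofReal_re, Complex.add_re, Complex.one_re]

theorem complex_saddle_expansion (N : ℕ) {δ : ℝ} (hδ : 0 < δ) :
    ∃ C : ℝ, ∀ n : ℕ, n ≠ 0 → ∀ x : ℝ, 0 < x → 1 / Real.exp 1 + δ ≤ (n : ℝ) / x →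
      (2 + Real.log (n / x)) ^ 3 ≤ √n → ∀ t₀ : ℂ, IsSmallestSaddle ((n : ℝ) / x) t₀ →
        ‖touchard (n - 1) (-(x : ℂ)) - ((2 * (saddleSeries N n x t₀).re : ℝ) : ℂ)‖ ≤
          C * ‖saddleFactor n x t₀‖ * (‖t₀‖ / n) ^ N / √n := by
  set s := (1 + Real.log (1 / Real.exp 1 + δ)) / 2 with hs
  have hs0 : 0 < s := by
    have h1 : Real.log (1 / Real.exp 1) < Real.log (1 / Real.exp 1 + δ) :=
      Real.log_lt_log (by positivity) (by linarith)
    rw [one_div, Real.log_inv, Real.log_exp, ← one_div] at h1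
    rw [hs]
    linarith
  -- With `σ = ‖t‖ ≤ 2 + Re t`, `Re β_0 = (1 + Re t)/(2‖t‖)` is at least `u/(2(1+u))` for `u = 1 +
  -- Re t ≥ s`, and this increases in `u`.
  set c := s / (2 * (1 + s)) with hc
  have hc0 : 0 < c := by positivity
  have hcs : 2 * c ≤ s := by
    rw [hc, ← mul_div_assoc, div_le_iff₀ (by positivity)]
    nlinarith
  obtain ⟨C, hC⟩ := saddle_expansion N (c := c) (k := min (1 / 8) (c * (c / 40) ^ 2 / 2)) hc0
    (by positivity)
  refine ⟨2 * C, fun n hn x hx hμδ hlog t₀ ht₀ => ?_⟩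
  have hμ : 1 / Real.exp 1 < (n : ℝ) / x := by linarith
  have hμ0 : 0 < (n : ℝ) / x := lt_trans (by positivity) hμ
  obtain ⟨t, ht, him⟩ := exists_isSaddle_im_mem hμ
  have hone := ht.one_lt_norm hμ0 him.1
  have hρ := ht.norm_le_two_add_re hμ0 him
  have hst : s ≤ 1 + t.re := by
    have h1 := ht.one_add_log_le hμ0 him
    have h2 : Real.log (1 / Real.exp 1 + δ) ≤ Real.log (n / x) :=
      Real.log_le_log (by positivity) hμδ
    rw [hs]
    linarith
  have hcre : c ≤ (scaledCoeff t ‖t‖ 0).re := by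
    rw [scaledCoeff_zero_re, hc, div_le_div_iff₀ (by positivity) (by positivity)]
    nlinarith
  have hc1 : c ≤ 1 := hcre.trans ((Complex.re_le_norm _).trans
    (norm_scaledCoeff_le hone.le le_rfl 0))
  have hr : c / 40 ≤ t.im := by
    rcases le_or_gt 1 t.im with h1 | h1
    · linarith
    · have h2 := ht.one_add_re_le_sq hμ0 him.1 h1
      nlinarith [him.1]
  have hcube : ‖t‖ ^ 3 ≤ √n := by
    refine le_trans ?_ hlog
    have := ht.norm_le_two_add_log hμ0 him
    gcongr
  have hσn : ‖t‖ ≤ √n := (le_self_pow₀ hone.le (by norm_num)).trans hcube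
  have hup : ∀ θ ∈ Set.Icc (-(Real.pi - t.im)) t.im, c / 40 / ‖t‖ ≤ |θ| → ‖arcIntegrand n t θ‖ ≤
      Real.exp (-(min (1 / 8) (c * (c / 40) ^ 2 / 2) * √n)) := fun θ hθ hθr =>
    norm_arcIntegrand_upper_le hμ0 ht him hc0 hcre hcube hr hθ hθr
  have hεle : c / 40 / ‖t‖ ≤ t.im := (div_le_self (by positivity) hone.le).trans hr
  have hεle' : c / 40 / ‖t‖ ≤ Real.pi - t.im := by
    have h1 := (ht.eq_polar hμ0).2.1
    have h2 := Real.sin_le (x := Real.pi - t.im) (by linarith [him.2])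
    rw [div_le_iff₀ (by linarith)]
    nlinarith
  have hfinal : ∀ w : ℂ, ∀ z : ℂ, touchard (n - 1) (-(x : ℂ)) = ((2 * z.re : ℝ) : ℂ) →
      ‖z - saddleSeries N n x w‖ ≤ C * ‖saddleFactor n x w‖ * (‖t‖ / n) ^ N / √n →
      ‖touchard (n - 1) (-(x : ℂ)) - ((2 * (saddleSeries N n x w).re : ℝ) : ℂ)‖ ≤
        2 * C * ‖saddleFactor n x w‖ * (‖t‖ / n) ^ N / √n := by
    intro w z hz hb
    rw [hz, ← Complex.ofReal_sub, ← mul_sub, ← Complex.sub_re, Complex.norm_real, norm_mul,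
      Real.norm_ofNat, Real.norm_eq_abs]
    have := (Complex.abs_re_le_norm (z - saddleSeries N n x w)).trans hb
    calc _ ≤ 2 * (C * ‖saddleFactor n x w‖ * (‖t‖ / n) ^ N / √n) := by gcongr
      _ = _ := by ring
  have htou := touchard_eq_two_re hn hx ht
  rcases (isSmallestSaddle_iff hμ ht him t₀).1 ht₀ with rfl | rfl
  · exact hfinal _ _ htou (hC n hn x hx _ ht _ hone.le le_rfl hcre hσn _ _ (by linarith) hεle
      (by linarith [Real.pi_pos]) hup)
  -- The lower root is the saddle of the lower half circle, whose integral is the conjugate and so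
  -- has the same real part.
  · rw [Complex.norm_conj]
    have hconj : (starRingEnd ℂ) (contourFactor n x t * (1 / (2 * Real.pi) *
        ∫ θ in (-(Real.pi - t.im))..t.im, arcIntegrand n t θ)) =
        contourFactor n x ((starRingEnd ℂ) t) * (1 / (2 * Real.pi) *
          ∫ θ in (-t.im)..(Real.pi - t.im), arcIntegrand n ((starRingEnd ℂ) t) θ) := by
      simp only [arcIntegrand_conj]
      rw [intervalIntegral.integral_comp_neg (fun θ => (starRingEnd ℂ) (arcIntegrand n t θ)),
        intervalIntegral_conj, contourFactor_conj, neg_neg]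
      simp only [map_mul, map_div₀, map_one, map_ofNat, Complex.conj_ofReal]
    refine hfinal _ (contourFactor n x ((starRingEnd ℂ) t) * (1 / (2 * Real.pi) *
      ∫ θ in (-t.im)..(Real.pi - t.im), arcIntegrand n ((starRingEnd ℂ) t) θ)) ?_ ?_
    · rw [← hconj, Complex.conj_re]
      exact htou
    · refine hC n hn x hx _ ht.conj ‖t‖ hone.le (Complex.norm_conj t).le ?_ hσn _ _
        (by linarith) hεle' (by linarith [Real.pi_pos]) ?_
      · rw [scaledCoeff_zero_re, Complex.conj_re, ← scaledCoeff_zero_re]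
        exact hcre
      · intro θ hθ hθr
        rw [arcIntegrand_conj, Complex.norm_conj]
        exact hup (-θ) ⟨by linarith [hθ.2], by linarith [hθ.1]⟩ (by rwa [abs_neg])

end ComplexSaddle

/-! ### Growth condition and conclusion -/

theorem eventually_log_pow_le {a : ℝ} (ha : 0 < a) :
    ∀ᶠ n : ℕ in Filter.atTop, (2 + Real.log (n / a)) ^ 3 ≤ √n ∧ a ≤ n := by
  have h1 : (fun x : ℝ => (2 - Real.log a) + Real.log x) =o[Filter.atTop]
      fun x : ℝ => x ^ (1 / 6 : ℝ) := by
    refine Asymptotics.IsLittleO.add ?_ (isLittleO_log_rpow_atTop (by norm_num))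
    rw [Asymptotics.isLittleO_const_left]
    right
    exact tendsto_norm_atTop_atTop.comp (tendsto_rpow_atTop (by norm_num))
  have h2 := (h1.bound one_pos).and (Filter.eventually_ge_atTop (max a 1))
  filter_upwards [tendsto_natCast_atTop_atTop.eventually h2] with n hn
  obtain ⟨hb, hge⟩ := hn
  have hna : a ≤ n := (le_max_left _ _).trans hge
  have hn0 : 0 < (n : ℝ) := lt_of_lt_of_le one_pos ((le_max_right _ _).trans hge)
  refine ⟨?_, hna⟩
  rw [one_mul, Real.norm_of_nonneg (by positivity : (0 : ℝ) ≤ (n : ℝ) ^ (1 / 6 : ℝ))] at hb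
  have h3 : 2 + Real.log (n / a) ≤ (n : ℝ) ^ (1 / 6 : ℝ) := by
    rw [Real.log_div hn0.ne' ha.ne']
    exact le_trans (by linarith) ((le_abs_self _).trans hb)
  have h4 : 0 ≤ Real.log (n / a) := Real.log_nonneg ((one_le_div ha).2 hna)
  calc (2 + Real.log (n / a)) ^ 3 ≤ ((n : ℝ) ^ (1 / 6 : ℝ)) ^ 3 := by gcongr
    _ = √n := by
      rw [Real.sqrt_eq_rpow, ← Real.rpow_natCast, ← Real.rpow_mul hn0.le]
      norm_num

end

theorem theorem2 :
    -- For `μ > 1/e` the roots of smallest modulus form one pair of non-real conjugates.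
    (∀ μ : ℝ, 1 / Real.exp 1 < μ →
      ∃ t₀ : ℂ, t₀.im ≠ 0 ∧
        ∀ t : ℂ, IsSmallestSaddle μ t ↔ t = t₀ ∨ t = (starRingEnd ℂ) t₀) ∧
    -- For `0 < μ < 1/e` there are exactly two real roots, `t₁ < -1 < t₀ < 0`.
    (∀ μ : ℝ, 0 < μ → μ < 1 / Real.exp 1 →
      ∃ t₀ t₁ : ℝ, t₁ < -1 ∧ -1 < t₀ ∧ t₀ < 0 ∧
        (∀ t : ℝ, t * Real.exp t = -μ ↔ t = t₀ ∨ t = t₁) ∧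
        ∀ t : ℝ, IsSmallestRealSaddle μ t ↔ t = t₀) ∧
    -- The expansion for `μ = n / x > 1/e`, with `x` bounded below and `μ` away from `1/e`.
    (∀ (N : ℕ) (a δ : ℝ), 0 < a → 0 < δ →
      ∃ C : ℝ, ∀ᶠ n : ℕ in Filter.atTop, ∀ x : ℝ, a ≤ x →
        1 / Real.exp 1 + δ ≤ (n : ℝ) / x →
        ∀ t₀ : ℂ, IsSmallestSaddle ((n : ℝ) / x) t₀ →
          ‖touchard (n - 1) (-(x : ℂ)) - ((2 * (saddleSeries N n x t₀).re : ℝ) : ℂ)‖ ≤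
            C * ‖saddleFactor n x t₀‖ * (‖t₀‖ / n) ^ N / (n : ℝ) ^ (1 / 2 : ℝ)) ∧
    -- Dominance: the leading factor at any other root is exponentially smaller.
    (∀ a δ : ℝ, 0 < a → 0 < δ →
      ∃ C c : ℝ, 0 < c ∧ ∀ᶠ n : ℕ in Filter.atTop, ∀ x : ℝ, a ≤ x →
        1 / Real.exp 1 + δ ≤ (n : ℝ) / x →
        ∀ t₀ : ℂ, IsSmallestSaddle ((n : ℝ) / x) t₀ →
          ∀ t : ℂ, IsSaddle ((n : ℝ) / x) t → t ≠ t₀ → t ≠ (starRingEnd ℂ) t₀ →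
            ‖saddleFactor n x t‖ ≤
              C * Real.exp (-c * n / ‖t₀‖ ^ 2) * ‖saddleFactor n x t₀‖) ∧
    -- The expansion for `0 < μ = n / x < 1/e`, with `x ≤ B n` and `μ` away from `1/e`.
    (∀ (N : ℕ) (B δ : ℝ), 0 < δ →
      ∃ C : ℝ, ∀ᶠ n : ℕ in Filter.atTop, ∀ x : ℝ, 0 < x → x ≤ B * n →
        (n : ℝ) / x ≤ 1 / Real.exp 1 - δ →
        ∀ t₀ : ℝ, IsSmallestRealSaddle ((n : ℝ) / x) t₀ →
          ‖touchard (n - 1) (-(x : ℂ)) - saddleSeries N n x (t₀ : ℂ)‖ ≤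
            C * ‖saddleFactor n x (t₀ : ℂ)‖ * (1 / (n : ℝ)) ^ N / (n : ℝ) ^ (1 / 2 : ℝ)) := by
  refine ⟨fun μ hμ => exists_smallestSaddle_pair hμ, fun μ h1 h2 => exists_real_roots h1 h2,
    fun N a δ ha hδ => ?_, fun a δ ha hδ => ⟨2, 1 / 16, by norm_num, ?_⟩, fun N B δ hδ => ?_⟩
  · obtain ⟨C, hC⟩ := complex_saddle_expansion N hδ
    refine ⟨C, ?_⟩
    filter_upwards [eventually_log_pow_le ha, Filter.eventually_ne_atTop 0]
      with n hn hn0 x hx hμ t₀ ht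
    have hx0 : 0 < x := ha.trans_le hx
    have hn1 : 0 < (n : ℝ) := by positivity
    -- Makes `2 + log(n/x)` positive, so that cubing preserves the comparison with `2 + log(n/a)`.
    have hlog : -1 ≤ Real.log (n / x) := by
      have h1 := Real.log_le_log (by positivity) (show 1 / Real.exp 1 ≤ (n : ℝ) / x by linarith)
      rwa [one_div, Real.log_inv, Real.log_exp] at h1
    have hle : Real.log (n / x) ≤ Real.log (n / a) :=
      Real.log_le_log (by positivity) (div_le_div_of_nonneg_left hn1.le ha hx)
    rw [← Real.sqrt_eq_rpow]
    exact hC n hn0 x hx0 hμ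
      ((pow_le_pow_left₀ (by linarith) (by linarith) 3).trans hn.1) t₀ ht
  · filter_upwards [Filter.eventually_ge_atTop 8] with n hn x hx hμ t₀ ht t hw h1 h2
    exact norm_saddleFactor_le_of_ne hn (by linarith) ht hw h1 h2
  · obtain ⟨C, hC⟩ := real_saddle_expansion N hδ
    refine ⟨C, ?_⟩
    filter_upwards [Filter.eventually_ne_atTop 0] with n hn0 x hx _ hμ t₀ ht
    rw [← Real.sqrt_eq_rpow]
    exact hC n hn0 x hx hμ t₀ ht
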